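/- **Setting.** Let $S$ be a non-empty Polish space with a fixed complete metric, $\pi$ a probability measure on $S$, $\lambda$ Lebesgue measure on $\mathbb{R}^m$. Let $\Lambda=\{\Lambda(B)\}$, $B$ ranging over the bounded Borel sets of $S\times\mathbb{R}^m$, be an $\mathbb{R}^d$-valued Lévy basis with characteristic quadruplet $(\gamma,\Sigma,\nu,\pi)$: each $\Lambda(B)$ is infinitely divisible, $\Lambda$ is independent on disjoint sets and almost surely $\sigma$-additive, and $E[e^{i\langle u,\Lambda(B)\rangle}]=e^{\Phi(u)(\pi\times\lambda)(B)}$ with $$\Phi(u)=i\langle\gamma,u\rangle-\tfrac12\langle u,\Sigma u\rangle+\int_{\mathbb{R}^d}\big(e^{i\langle u,x\rangle}-1-i\langle u,x\rangle 1_{\{\|x\|\le1\}}\big)\nu(dx),$$ where $\gamma\in\mathbb{R}^d$, $\Sigma$ is symmetric positive semidefinite and $\nu$ is a Lévy measure. Let $f:S\times\mathbb{R}^m\to M_{n\times d}(\mathbb{R})$ be measurable, and let $X=(X_t)_{t\in\mathbb{R}^m}$, $$X_t=\int_S\int_{\mathbb{R}^m}f(A,t-s)\,\Lambda(dA,ds),$$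 be the associated mixed moving average field (MMAF), the integral being that of Rajput and Rosinski (limit in probability of the integrals of approximating simple functions). **Weak dependence.** For $u\ge1$ let $\mathcal{G}_u$ be the set of bounded functions $F:(\mathbb{R}^n)^u\to\mathbb{R}$ that are Lipschitz for the distance $\sum_i\|x_i-y_i\|$, with Lipschitz constant $Lip(F)$. Put $$\eta_X(h)=\sup_{u,v\ge1}\ \sup\frac{|Cov(F(X_\Gamma),G(X_{\tilde\Gamma}))|}{u\|G\|_\infty Lip(F)+v\|F\|_\infty Lip(G)},$$ with $0/0:=0$, where the inner supremum is over $F\in\mathcal{G}_u$, $G\in\mathcal{G}_v$ and finite $\Gamma,\tilde\Gamma\subset\mathbb{R}^m$ with $|\Gamma|=u$, $|\tilde\Gamma|=v$ and sup-norm distance at least $h$. $X$ is called $\eta$-weakly dependent if $\eta_X(h)\to0$ as $h\to\infty$. **Notation.** $Q_h=\big((-\tfrac h2,\tfrac h2)^m\big)^c$, $\Sigma_\Lambda=\Sigma+\int_{\mathbb{R}^d}xx'\nu(dx)$, $\Sigma_{\Lambda_1}=\Sigma+\int_{\|x\|\le1}xx'\nu(dx)$, $\mu_\Lambda=\gamma+\int_{\|x\|>1}x\,\nu(dx)$,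 $\gamma_0=\gamma-\int_{\|x\|\le1}x\,\nu(dx)$, and $L^p=L^p(S\times\mathbb{R}^m,\pi\otimes\lambda)$. **Proposition.** In each of the following cases $X$ is $\eta$-weakly dependent, and for all $h>0$ its $\eta$-coefficients satisfy the stated bound. (i) If $\int_{\|x\|>1}\|x\|^2\nu(dx)<\infty$, $\gamma+\int_{\|x\|>1}x\,\nu(dx)=0$ and $f\in L^2$: $$\eta_X(h)\le\Big(\int_S\int_{Q_h}\mathrm{tr}\big(f(A,-s)\Sigma_\Lambda f(A,-s)'\big)ds\,\pi(dA)\Big)^{1/2}.$$ (ii) If $\int_{\|x\|>1}\|x\|^2\nu(dx)<\infty$ and $f\in L^2\cap L^1$: $$\eta_X(h)\le\Big(\int_S\int_{Q_h}\mathrm{tr}\big(f(A,-s)\Sigma_\Lambda f(A,-s)'\big)ds\,\pi(dA)+\Big\|\int_S\int_{Q_h}f(A,-s)\mu_\Lambda\,ds\,\pi(dA)\Big\|^2\Big)^{1/2}.$$ (iii) If $\int_{\mathbb{R}^d}\|x\|\nu(dx)<\infty$, $\Sigma=0$ and $f\in L^1$: $$\eta_X(h)\le2\Big(\int_S\int_{Q_h}\|f(A,-s)\gamma_0\|\,ds\,\pi(dA)+\int_S\int_{Q_h}\int_{\mathbb{R}^d}\|f(A,-s)x\|\,\nu(dx)\,ds\,\pi(dA)\Big).$$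 (iv) If $\int_{\|x\|>1}\|x\|\nu(dx)<\infty$ and $f\in L^1\cap L^2$: $$\eta_X(h)\le\Big(\int_S\int_{Q_h}\mathrm{tr}\big(f(A,-s)\Sigma_{\Lambda_1}f(A,-s)'\big)ds\,\pi(dA)+\Big\|\int_S\int_{Q_h}f(A,-s)\gamma\,ds\,\pi(dA)\Big\|^2\Big)^{1/2}+2\int_S\int_{Q_h}\int_{\|x\|>1}\|f(A,-s)x\|\,\nu(dx)\,ds\,\pi(dA).$$ -/

import Mathlib

open MeasureTheory ProbabilityTheory Filter Topology

noncomputable section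

namespace MMAF

/-- `ℝ^k` with its Euclidean norm. -/
abbrev Euc (k : ℕ) : Type := EuclideanSpace ℝ (Fin k)

/-- The matrix-vector product `A x` between Euclidean spaces. -/
def act {n d : ℕ} (A : Matrix (Fin n) (Fin d) ℝ) (x : Euc d) : Euc n :=
  WithLp.toLp 2 (A.mulVec (fun j => x j))

/-- The Frobenius norm of a matrix. -/
def frob {n d : ℕ} (A : Matrix (Fin n) (Fin d) ℝ) : ℝ :=
  Real.sqrt (A * A.transpose).trace

/-! ### Eta-weak dependence -/

/-- Supremum norm of a (bounded) real function. -/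
def supNorm {α : Type*} (F : α → ℝ) : ℝ :=
  sSup {r : ℝ | ∃ x, r = |F x|}

/-- `Lip(F)` for functions on `(ℝ^n)^u`, with respect to the distance `∑ i, ‖x i - y i‖`. -/
def lipConst {n u : ℕ} (F : (Fin u → Euc n) → ℝ) : ℝ :=
  sSup {r : ℝ | ∃ x y : Fin u → Euc n, x ≠ y ∧ r = |F x - F y| / ∑ i, ‖x i - y i‖}

/-- The class `𝒢_u` of bounded functions `(ℝ^n)^u → ℝ` that are globally Lipschitz continuous
with respect to the distance `∑ i, ‖x i - y i‖`. -/
def IsBddLip {n u : ℕ} (F : (Fin u → Euc n) → ℝ) : Prop :=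
  (∃ C : ℝ, ∀ x, |F x| ≤ C) ∧
    ∃ L : ℝ, ∀ x y : Fin u → Euc n, |F x - F y| ≤ L * ∑ i, ‖x i - y i‖

variable {Ω : Type*} [MeasurableSpace Ω]

/-- The coefficient `η_{u,v}(h)` of a random field `X` indexed by `ℝ^m = (Fin m → ℝ)` (whose
`dist` is the supremum distance). A finite set of cardinality `u` is given by an injective
enumeration of its points. Here `0 / 0 = 0`. -/
def etaUV {m n : ℕ} (P : Measure Ω) (X : (Fin m → ℝ) → Ω → Euc n) (u v : ℕ) (h : ℝ) : ENNReal :=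
  sSup {r : ENNReal | ∃ (F : (Fin u → Euc n) → ℝ) (G : (Fin v → Euc n) → ℝ)
      (I : Fin u → Fin m → ℝ) (J : Fin v → Fin m → ℝ),
      IsBddLip F ∧ IsBddLip G ∧ Function.Injective I ∧ Function.Injective J ∧
      (∀ a b, h ≤ dist (I a) (J b)) ∧
      r = ENNReal.ofReal
            |covariance (fun ω => F (fun a => X (I a) ω)) (fun ω => G (fun b => X (J b) ω)) P| /
          ENNReal.ofReal (u * supNorm G * lipConst F + v * supNorm F * lipConst G)}

/-- The coefficient `η(h) = sup_{u,v ≥ 1} η_{u,v}(h)`. -/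
def eta {m n : ℕ} (P : Measure Ω) (X : (Fin m → ℝ) → Ω → Euc n) (h : ℝ) : ENNReal :=
  ⨆ (u : ℕ) (_ : 1 ≤ u) (v : ℕ) (_ : 1 ≤ v), etaUV P X u v h

/-- `X` is eta-weakly dependent if `η(h) → 0` as `h → ∞`. -/
def IsEtaWeaklyDependent {m n : ℕ} (P : Measure Ω) (X : (Fin m → ℝ) → Ω → Euc n) : Prop :=
  Tendsto (eta P X) atTop (𝓝 0)

/-! ### Lévy bases -/

/-- A measure is infinitely divisible if for every `k ≥ 1` it is the law of a sum of `k`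
independent identically distributed random vectors. -/
def IsInfDivisible {d : ℕ} (μ : Measure (Euc d)) : Prop :=
  ∀ k : ℕ, 1 ≤ k → ∃ ρ : Measure (Euc d), IsProbabilityMeasure ρ ∧
    μ = Measure.map (fun x : Fin k → Euc d => ∑ i, x i) (Measure.pi fun _ => ρ)

/-- Lévy measures on `ℝ^d`. -/
def IsLevyMeasure {d : ℕ} (ν : Measure (Euc d)) : Prop :=
  ν {0} = 0 ∧ ∫⁻ x, ENNReal.ofReal (min 1 (‖x‖ ^ 2)) ∂ν < ⊤

/-- The cumulant transform `Φ` of the characteristic triplet `(γ, Sig, ν)`. -/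
def cumulant {d : ℕ} (γ : Euc d) (Sig : Matrix (Fin d) (Fin d) ℝ) (ν : Measure (Euc d))
    (u : Euc d) : ℂ :=
  Complex.I * ((inner ℝ γ u : ℝ) : ℂ) - (1 / 2 : ℂ) * ((inner ℝ u (act Sig u) : ℝ) : ℂ) +
    ∫ x, (Complex.exp (Complex.I * ((inner ℝ u x : ℝ) : ℂ)) - 1 -
      Complex.I * ((inner ℝ u x : ℝ) : ℂ) *
        (Metric.closedBall (0 : Euc d) 1).indicator (fun _ => (1 : ℂ)) x) ∂ν

variable {S : Type*} [MetricSpace S] [MeasurableSpace S]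

/-- The bounded Borel sets of `S × ℝ^m`. -/
def BddBorel {m : ℕ} (B : Set (S × (Fin m → ℝ))) : Prop :=
  MeasurableSet B ∧ Bornology.IsBounded B

/-- `ℝ^d`-valued Lévy bases (infinitely divisible independently scattered random measures) on
`S × ℝ^m`. Only the values of `Λ` at bounded Borel sets matter. The series in `sigma_additive`
is the limit of its partial sums: it need not converge absolutely. -/
structure IsLevyBasis {m d : ℕ} (P : Measure Ω) (Λ : Set (S × (Fin m → ℝ)) → Ω → Euc d) :
    Prop where
  measurable : ∀ B, BddBorel B → Measurable (Λ B)
  infDivisible : ∀ B, BddBorel B → IsInfDivisible (P.map (Λ B))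
  indep : ∀ (k : ℕ) (B : Fin k → Set (S × (Fin m → ℝ))), (∀ i, BddBorel (B i)) →
    Pairwise (fun i j => Disjoint (B i) (B j)) → iIndepFun (fun i => Λ (B i)) P
  sigma_additive : ∀ B : ℕ → Set (S × (Fin m → ℝ)), (∀ i, BddBorel (B i)) →
    Pairwise (fun i j => Disjoint (B i) (B j)) → BddBorel (⋃ i, B i) →
    ∀ᵐ ω ∂P, Tendsto (fun N => ∑ i ∈ Finset.range N, Λ (B i) ω) atTop (𝓝 (Λ (⋃ i, B i) ω))

/-- `Λ` is a (homogeneous, factorisable) Lévy basis with characteristic quadruplet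
`(γ, Sig, ν, π)`: the characteristic function of `Λ(B)` is `u ↦ exp (Φ(u) (π × λ)(B))`. -/
structure IsLevyBasisWith {m d : ℕ} (P : Measure Ω) (Λ : Set (S × (Fin m → ℝ)) → Ω → Euc d)
    (γ : Euc d) (Sig : Matrix (Fin d) (Fin d) ℝ) (ν : Measure (Euc d)) (π : Measure S) :
    Prop extends IsLevyBasis P Λ where
  posSemidef : Sig.PosSemidef
  levyMeasure : IsLevyMeasure ν
  prob : IsProbabilityMeasure π
  charFun_eq : ∀ B, BddBorel B → ∀ u : Euc d,
    charFun (P.map (Λ B)) u =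
      Complex.exp (cumulant γ Sig ν u * (((π.prod volume) B).toReal : ℂ))

/-! ### Integration of deterministic kernels with respect to a Lévy basis -/

/-- The integral over `E` of the simple function `φ = ∑_a a 1_{φ = a}`, that is,
`∑_a a Λ(E ∩ {φ = a})` (the term with `a = 0` vanishes). -/
def simpleIntegral {m n d : ℕ} (Λ : Set (S × (Fin m → ℝ)) → Ω → Euc d)
    (φ : SimpleFunc (S × (Fin m → ℝ)) (Matrix (Fin n) (Fin d) ℝ)) (E : Set (S × (Fin m → ℝ)))
    (ω : Ω) : Euc n :=
  ∑ a ∈ φ.range, act a (Λ (E ∩ φ ⁻¹' {a}) ω)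

/-- A sequence of simple functions over bounded Borel sets that converges to `g` almost everywhere
with respect to `π × λ` and whose integrals over each measurable set converge in probability. -/
structure IsApproxSeq {m n d : ℕ} (P : Measure Ω) (Λ : Set (S × (Fin m → ℝ)) → Ω → Euc d)
    (π : Measure S) (g : S × (Fin m → ℝ) → Matrix (Fin n) (Fin d) ℝ)
    (φ : ℕ → SimpleFunc (S × (Fin m → ℝ)) (Matrix (Fin n) (Fin d) ℝ)) : Prop where
  bounded : ∀ k, Bornology.IsBounded (Function.support (φ k))
  tendsto_ae : ∀ᵐ p ∂(π.prod volume), Tendsto (fun k => φ k p) atTop (𝓝 (g p))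
  tendsto_integral : ∀ E : Set (S × (Fin m → ℝ)), MeasurableSet E →
    ∃ Y : Ω → Euc n, TendstoInMeasure P (fun k => simpleIntegral Λ (φ k) E) atTop Y

/-- `Y` is the integral `∫ g dΛ` in the sense of Rajput and Rosinski: `g` is `Λ`-integrable, that
is, it has an approximating sequence, and `Y` is the limit in probability of the integrals of the
approximating sequences (whichever is chosen). -/
structure IsLevyIntegral {m n d : ℕ} (P : Measure Ω) (Λ : Set (S × (Fin m → ℝ)) → Ω → Euc d)
    (π : Measure S) (g : S × (Fin m → ℝ) → Matrix (Fin n) (Fin d) ℝ) (Y : Ω → Euc n) :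
    Prop where
  measurable : Measurable Y
  integrable : ∃ φ, IsApproxSeq P Λ π g φ
  tendsto : ∀ φ, IsApproxSeq P Λ π g φ →
    TendstoInMeasure P (fun k => simpleIntegral Λ (φ k) Set.univ) atTop Y

/-- `X` is the mixed moving average field `X_t = ∫_S ∫_{ℝ^m} f(A, t - s) Λ(dA, ds)`. -/
def IsMMAF {m n d : ℕ} (P : Measure Ω) (Λ : Set (S × (Fin m → ℝ)) → Ω → Euc d) (π : Measure S)
    (f : S × (Fin m → ℝ) → Matrix (Fin n) (Fin d) ℝ) (X : (Fin m → ℝ) → Ω → Euc n) : Prop :=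
  ∀ t : Fin m → ℝ, IsLevyIntegral P Λ π (fun p => f (p.1, t - p.2)) (X t)

/-- The complement in `ℝ^m` of the open cube `(-h/2, h/2)^m`. -/
def cubeCompl (m : ℕ) (h : ℝ) : Set (Fin m → ℝ) :=
  {s : Fin m → ℝ | ∀ i, -(h / 2) < s i ∧ s i < h / 2}ᶜ

/-- The iterated integral `∫_S ∫_{((-h/2, h/2)^m)^c} g(A, s) ds π(dA)`. -/
def tailInt {m : ℕ} {E : Type*} [NormedAddCommGroup E] [NormedSpace ℝ E] (π : Measure S) (h : ℝ)
    (g : S → (Fin m → ℝ) → E) : E :=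
  ∫ A, (∫ s in cubeCompl m h, g A s ∂volume) ∂π

/-- The matrix `∫_D x x' ν(dx)`. -/
def secondMoment {d : ℕ} (ν : Measure (Euc d)) (D : Set (Euc d)) : Matrix (Fin d) (Fin d) ℝ :=
  Matrix.of fun i j => ∫ x in D, x i * x j ∂ν

end MMAF

end

/-! ### Matrix action, bounded Lipschitz functionals, and the covariance inequality -/

noncomputable section

namespace MMAF

/-! ### Matrices acting on Euclidean vectors -/

section Act

variable {n d : ℕ}

/-! For each time `t` the kernel of `X_t` is cut at the open cube of side `h` centred at `t`. Two
index points at sup-norm distance at least `h` have disjoint cubes, so the cube parts of the two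
families are integrals over disjoint regions, hence independent, and functionals of them have
covariance zero. Everything else is the price of replacing `X_t` by its cube part, which by the
Lipschitz property is governed by the tail integral over the complement of the cube.

The tail is written as `Y + Z` with `Y` square integrable and `Z` integrable. Against a variable
bounded by `C`, a quantity controlled by `Y` costs `C` times an `L²` norm, because centring the
bounded variable leaves its second moment at most `C²`. One controlled by `Z` costs `2C` times an
`L¹` norm. These are the factors 1 and 2 in the four bounds (`abs_covariance_le_of_split`). In
regimes (i) and (ii) all jumps go into `Y`, in (iii) everything goes into `Z`, and in (iv) the jumps
are cut at norm 1.

This split, which is the role of a Lévy-Itô decomposition, is made for approximating laws and not on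
`Ω`. For simple kernels the covariance depends only on the joint law of finitely many independent
vectors `Λ(B_j)`, and each law with characteristic function `exp (c Φ)` is a weak limit of laws of
sums of `M` independent rare jumps, each with intensity `c / M` times a finite measure. That measure
is `ν` cut off at small norms, plus symmetric atoms `± r v_l` that imitate the Gaussian part. For
such sums the split is literal, and the mean and the moment bounds hold at every stage
(`splitApprox_of_jumps`, `tendsto_exponent_jumpApprox`). The continuity theorem for characteristic
functions carries the covariance bound to the limit (`SplitApprox.abs_covariance_le`).

To reach `X`, all simple kernels involved are read off one common partition
(`abs_covariance_simpleIntegral_le`). The split laws also bound truncated first moments, so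
integrals of simple functions that approach the kernel fast enough converge in probability. This
gives an approximating sequence dominated by the kernel (`exists_isApproxSeq`), along which both
sides of the inequality converge (`abs_covariance_le`). By translation invariance the resulting
bound is the same for every `t`, and it tends to zero because the cube complements decrease to the
empty set. -/

lemma act_apply (A : Matrix (Fin n) (Fin d) ℝ) (x : Euc d) (i : Fin n) :
    act A x i = ∑ j, A i j * x j := rfl

/-- `act A` as a continuous linear map. -/
def actL (A : Matrix (Fin n) (Fin d) ℝ) : Euc d →L[ℝ] Euc n :=
  LinearMap.toContinuousLinearMap
    { toFun := act A
      map_add' := fun x y => by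
        ext i; simp [act_apply, mul_add, Finset.sum_add_distrib]
      map_smul' := fun c x => by
        ext i; simp [act_apply, Finset.mul_sum, mul_left_comm] }

@[simp] lemma actL_apply (A : Matrix (Fin n) (Fin d) ℝ) (x : Euc d) : actL A x = act A x := rfl

lemma act_add (A : Matrix (Fin n) (Fin d) ℝ) (x y : Euc d) : act A (x + y) = act A x + act A y :=
  (actL A).map_add x y

lemma act_sub (A : Matrix (Fin n) (Fin d) ℝ) (x y : Euc d) : act A (x - y) = act A x - act A y :=
  (actL A).map_sub x y

lemma act_smul (A : Matrix (Fin n) (Fin d) ℝ) (c : ℝ) (x : Euc d) : act A (c • x) = c • act A x :=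
  (actL A).map_smul c x

@[simp] lemma act_zero (A : Matrix (Fin n) (Fin d) ℝ) : act A 0 = 0 := (actL A).map_zero

@[simp] lemma zero_act (x : Euc d) : act (0 : Matrix (Fin n) (Fin d) ℝ) x = 0 := by
  ext i; simp [act_apply]

lemma add_act (A B : Matrix (Fin n) (Fin d) ℝ) (x : Euc d) :
    act (A + B) x = act A x + act B x := by
  ext i; simp [act_apply, add_mul, Finset.sum_add_distrib]

lemma sub_act (A B : Matrix (Fin n) (Fin d) ℝ) (x : Euc d) :
    act (A - B) x = act A x - act B x := by
  ext i; simp [act_apply, sub_mul, Finset.sum_sub_distrib]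

lemma act_sum {ι : Type*} (s : Finset ι) (A : Matrix (Fin n) (Fin d) ℝ) (x : ι → Euc d) :
    act A (∑ i ∈ s, x i) = ∑ i ∈ s, act A (x i) := map_sum (actL A) x s

@[fun_prop]
lemma continuous_act_right (A : Matrix (Fin n) (Fin d) ℝ) : Continuous (act A) :=
  (actL A).continuous

lemma continuous_act :
    Continuous fun p : Matrix (Fin n) (Fin d) ℝ × Euc d => act p.1 p.2 := by
  refine (PiLp.continuous_toLp 2 _).comp (continuous_pi fun i => ?_)
  change Continuous fun p : Matrix (Fin n) (Fin d) ℝ × Euc d => ∑ j, p.1 i j * p.2 j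
  exact continuous_finsetSum _ fun j _ => (continuous_fst.matrix_elem i j).mul (by fun_prop)

lemma frob_nonneg (A : Matrix (Fin n) (Fin d) ℝ) : 0 ≤ frob A := Real.sqrt_nonneg _

lemma trace_mul_transpose_self (A : Matrix (Fin n) (Fin d) ℝ) :
    (A * A.transpose).trace = ∑ i, ∑ j, A i j ^ 2 := by
  simp [Matrix.trace, Matrix.mul_apply, pow_two]

lemma frob_sq (A : Matrix (Fin n) (Fin d) ℝ) : frob A ^ 2 = ∑ i, ∑ j, A i j ^ 2 := by
  rw [frob, Real.sq_sqrt, trace_mul_transpose_self]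
  rw [trace_mul_transpose_self]
  positivity

@[simp] lemma frob_zero : frob (0 : Matrix (Fin n) (Fin d) ℝ) = 0 := by simp [frob]

lemma continuous_frob : Continuous (frob : Matrix (Fin n) (Fin d) ℝ → ℝ) := by
  unfold frob; fun_prop

lemma abs_apply_le_frob (A : Matrix (Fin n) (Fin d) ℝ) (i : Fin n) (j : Fin d) :
    |A i j| ≤ frob A := by
  refine abs_le_of_sq_le_sq ?_ (frob_nonneg A)
  rw [frob_sq]
  calc A i j ^ 2 ≤ ∑ j, A i j ^ 2 :=
        Finset.single_le_sum (f := fun j => A i j ^ 2) (fun _ _ => sq_nonneg _) (Finset.mem_univ j)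
    _ ≤ _ := Finset.single_le_sum (f := fun i => ∑ j, A i j ^ 2)
        (fun _ _ => Finset.sum_nonneg fun _ _ => sq_nonneg _) (Finset.mem_univ i)

lemma norm_act_sq_le (A : Matrix (Fin n) (Fin d) ℝ) (x : Euc d) :
    ‖act A x‖ ^ 2 ≤ frob A ^ 2 * ‖x‖ ^ 2 := by
  rw [EuclideanSpace.norm_sq_eq, EuclideanSpace.norm_sq_eq, frob_sq, Finset.sum_mul]
  refine Finset.sum_le_sum fun i _ => ?_
  simp only [Real.norm_eq_abs, sq_abs, act_apply]
  exact Finset.sum_mul_sq_le_sq_mul_sq _ _ _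

lemma norm_act_le (A : Matrix (Fin n) (Fin d) ℝ) (x : Euc d) : ‖act A x‖ ≤ frob A * ‖x‖ := by
  refine le_of_sq_le_sq ?_ (mul_nonneg (frob_nonneg A) (norm_nonneg x))
  rw [mul_pow]; exact norm_act_sq_le A x

/-- The Frobenius norm is dominated by the maximum of the entries. -/
lemma frob_le_of_abs_le (A : Matrix (Fin n) (Fin d) ℝ) {r : ℝ} (hr : 0 ≤ r)
    (h : ∀ i j, |A i j| ≤ r) : frob A ≤ Real.sqrt (n * d) * r := by
  refine le_of_sq_le_sq ?_ (mul_nonneg (Real.sqrt_nonneg _) hr)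
  rw [mul_pow, Real.sq_sqrt (by positivity), frob_sq]
  calc ∑ i, ∑ j, A i j ^ 2 ≤ ∑ _i : Fin n, ∑ _j : Fin d, r ^ 2 :=
        Finset.sum_le_sum fun i _ => Finset.sum_le_sum fun j _ => by
          rw [← sq_abs]; exact pow_le_pow_left₀ (abs_nonneg _) (h i j) 2
    _ = n * d * r ^ 2 := by simp; ring

lemma frob_sub_le (A B : Matrix (Fin n) (Fin d) ℝ) :
    frob (A - B) ^ 2 ≤ 2 * frob A ^ 2 + 2 * frob B ^ 2 := by
  simp only [frob_sq, Finset.mul_sum, ← Finset.sum_add_distrib]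
  refine Finset.sum_le_sum fun i _ => Finset.sum_le_sum fun j _ => ?_
  simp only [Matrix.sub_apply]
  nlinarith [sq_nonneg (A i j + B i j)]

end Act

/-! ### Bounded Lipschitz functions -/

section BddLip

lemma supNorm_nonneg {α : Type*} (F : α → ℝ) : 0 ≤ supNorm F :=
  Real.sSup_nonneg (by rintro _ ⟨x, rfl⟩; positivity)

lemma lipConst_nonneg {n u : ℕ} (F : (Fin u → Euc n) → ℝ) : 0 ≤ lipConst F :=
  Real.sSup_nonneg (by rintro _ ⟨x, y, -, rfl⟩; positivity)

variable {n u : ℕ} {F : (Fin u → Euc n) → ℝ}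

/-- The real `sSup` of an unbounded set is 0, so `supNorm` and `lipConst` are genuine bounds only
because membership in the class supplies an upper bound for the set. -/
lemma IsBddLip.abs_le (hF : IsBddLip F) (x : Fin u → Euc n) : |F x| ≤ supNorm F := by
  obtain ⟨⟨C, hC⟩, -⟩ := hF
  exact le_csSup ⟨C, by rintro _ ⟨y, rfl⟩; exact hC y⟩ ⟨x, rfl⟩

lemma IsBddLip.abs_sub_le (hF : IsBddLip F) (x y : Fin u → Euc n) :
    |F x - F y| ≤ lipConst F * ∑ i, ‖x i - y i‖ := by
  obtain ⟨-, L, hL⟩ := hF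
  by_cases hxy : x = y
  · subst hxy; simp
  have hpos : ∀ x y : Fin u → Euc n, x ≠ y → 0 < ∑ i, ‖x i - y i‖ := by
    intro x y hxy
    obtain ⟨i, hi⟩ := Function.ne_iff.mp hxy
    exact Finset.sum_pos' (fun _ _ => norm_nonneg _)
      ⟨i, Finset.mem_univ i, norm_pos_iff.mpr (sub_ne_zero.mpr hi)⟩
  rw [← div_le_iff₀ (hpos x y hxy)]
  refine le_csSup ⟨L, ?_⟩ ⟨x, y, hxy, rfl⟩
  rintro _ ⟨x, y, hxy, rfl⟩
  rw [div_le_iff₀ (hpos x y hxy)]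
  exact hL x y

lemma IsBddLip.continuous (hF : IsBddLip F) : Continuous F := by
  rw [continuous_iff_continuousAt]
  intro x
  rw [ContinuousAt, tendsto_iff_dist_tendsto_zero]
  have h0 : Tendsto (fun y : Fin u → Euc n => lipConst F * ∑ i, ‖y i - x i‖) (𝓝 x) (𝓝 0) := by
    have : Continuous fun y : Fin u → Euc n => lipConst F * ∑ i, ‖y i - x i‖ := by fun_prop
    simpa using this.tendsto x
  exact squeeze_zero (fun _ => dist_nonneg) (fun y => by
    rw [Real.dist_eq]; exact hF.abs_sub_le y x) h0

end BddLip

/-! ### A covariance inequality -/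

section Covariance

/-- Minkowski's inequality for a finite sum of norms in `L²`. -/
lemma sqrt_integral_sum_norm_sq_le {Ω' : Type*} [MeasurableSpace Ω'] {Q : Measure Ω'}
    {ι : Type*} (s : Finset ι) {E : Type*} [NormedAddCommGroup E]
    {Y : ι → Ω' → E} (hY : ∀ i, MemLp (Y i) 2 Q) :
    Real.sqrt (∫ ω, (∑ i ∈ s, ‖Y i ω‖) ^ 2 ∂Q) ≤
      ∑ i ∈ s, Real.sqrt (∫ ω, ‖Y i ω‖ ^ 2 ∂Q) := by
  have key : ∀ f : Ω' → ℝ, MemLp f 2 Q → eLpNorm f 2 Q =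
      ENNReal.ofReal (Real.sqrt (∫ ω, f ω ^ 2 ∂Q)) := by
    intro f hf
    rw [hf.eLpNorm_eq_integral_rpow_norm two_ne_zero ENNReal.ofNat_ne_top]
    simp [Real.sqrt_eq_rpow]
  have h := eLpNorm_sum_le (μ := Q) (s := s) (f := fun i ω => ‖Y i ω‖)
    (fun i _ => (hY i).1.norm) (one_le_two : (1 : ENNReal) ≤ 2)
  rw [key _ (memLp_finsetSum' s fun i _ => (hY i).norm),
    Finset.sum_congr rfl (fun i _ => key _ (hY i).norm),
    ← ENNReal.ofReal_sum_of_nonneg (fun _ _ => Real.sqrt_nonneg _),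
    ENNReal.ofReal_le_ofReal_iff (Finset.sum_nonneg fun _ _ => Real.sqrt_nonneg _)] at h
  simpa using h

variable {Ω' : Type*} [MeasurableSpace Ω'] {Q : Measure Ω'} [IsProbabilityMeasure Q]

lemma memLp_of_abs_le {f : Ω' → ℝ} (hf : Measurable f) {C : ℝ} (h : ∀ ω, |f ω| ≤ C)
    (p : ENNReal) : MemLp f p Q :=
  MemLp.of_bound hf.aestronglyMeasurable C (Eventually.of_forall h)

/-- Cauchy-Schwarz for the covariance with a bounded variable. -/
lemma abs_covariance_le_sqrt {f g : Ω' → ℝ} (hf : MemLp f 2 Q) (hg : Measurable g) {C : ℝ}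
    (h : ∀ ω, |g ω| ≤ C) : |cov[f, g; Q]| ≤ C * Real.sqrt (∫ ω, f ω ^ 2 ∂Q) := by
  have hgL : MemLp g 2 Q := memLp_of_abs_le hg h 2
  obtain ⟨ω0⟩ : Nonempty Ω' := Q.nonempty_of_neZero
  have hC : 0 ≤ C := (abs_nonneg _).trans (h ω0)
  set g' : Ω' → ℝ := fun ω => g ω - ∫ ω, g ω ∂Q with hg'
  have hg'L : MemLp g' 2 Q := hgL.sub (memLp_const _)
  -- Only the bounded factor is centred; this already removes the product of means, so `f` keeps its
  -- full second moment.
  have hcov : cov[f, g; Q] = ∫ ω, f ω * g' ω ∂Q := by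
    rw [← covariance_sub_const_right (hgL.integrable one_le_two) (∫ ω, g ω ∂Q)]
    have h0 : ∫ ω, g' ω ∂Q = 0 := by
      rw [hg', integral_sub (hgL.integrable one_le_two) (integrable_const _)]; simp
    have := covariance_eq_sub hf hg'L
    rw [h0, mul_zero, sub_zero] at this
    exact this
  -- The variance of `g` is at most its second moment. Bounding `|g'|` pointwise by `2C` would lose
  -- a factor 2.
  have hg2 : ∫ ω, g' ω ^ 2 ∂Q ≤ C ^ 2 := by
    rw [← variance_eq_integral hg.aemeasurable, variance_eq_sub hgL]
    have : ∫ ω, (g ^ 2) ω ∂Q ≤ ∫ _ω, C ^ 2 ∂Q := by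
      refine integral_mono hgL.integrable_sq (integrable_const _) fun ω => ?_
      exact sq_le_sq' (abs_le.mp (h ω)).1 (abs_le.mp (h ω)).2
    simp only [integral_const, probReal_univ, smul_eq_mul, one_mul] at this
    nlinarith [sq_nonneg (∫ ω, g ω ∂Q)]
  have hCS : |∫ ω, f ω * g' ω ∂Q| ≤
      Real.sqrt (∫ ω, f ω ^ 2 ∂Q) * Real.sqrt (∫ ω, g' ω ^ 2 ∂Q) := by
    have h2 : (2 : ℝ).HolderConjugate 2 := by
      constructor <;> norm_num
    have := integral_mul_norm_le_Lp_mul_Lq (μ := Q) (f := f) (g := g') h2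
      (by simpa using hf) (by simpa using hg'L)
    rw [← Real.sqrt_eq_rpow, ← Real.sqrt_eq_rpow] at this
    simp only [Real.norm_eq_abs, Real.rpow_two, sq_abs] at this
    refine (abs_integral_le_integral_abs).trans ?_
    simpa only [abs_mul] using this
  rw [hcov]
  refine hCS.trans ?_
  rw [mul_comm]
  refine mul_le_mul_of_nonneg_right ?_ (Real.sqrt_nonneg _)
  exact Real.sqrt_le_iff.mpr ⟨hC, hg2⟩

/-- `E[fg]` and `E[f] E[g]` are each at most `C E|f|`. This is the origin of the factor 2 in front
of all `L¹` terms. -/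
lemma abs_covariance_le_integral {f g : Ω' → ℝ} (hf : Integrable f Q) (hf2 : MemLp f 2 Q)
    (hg : Measurable g) {C : ℝ}
    (h : ∀ ω, |g ω| ≤ C) : |cov[f, g; Q]| ≤ C * (2 * ∫ ω, |f ω| ∂Q) := by
  have hgL : MemLp g 2 Q := memLp_of_abs_le hg h 2
  rw [covariance_eq_sub hf2 hgL]
  have h1 : |∫ ω, (f * g) ω ∂Q| ≤ C * ∫ ω, |f ω| ∂Q := by
    refine abs_integral_le_integral_abs.trans ?_
    rw [← integral_const_mul]
    refine integral_mono_of_nonneg (Eventually.of_forall fun _ => abs_nonneg _)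
      (hf.abs.const_mul _) (Eventually.of_forall fun ω => ?_)
    simp only [Pi.mul_apply, abs_mul]
    rw [mul_comm]
    exact mul_le_mul_of_nonneg_right (h ω) (abs_nonneg _)
  have h2 : |(∫ ω, f ω ∂Q) * ∫ ω, g ω ∂Q| ≤ C * ∫ ω, |f ω| ∂Q := by
    rw [abs_mul, mul_comm]
    refine mul_le_mul ?_ abs_integral_le_integral_abs (abs_nonneg _) ?_
    · have := norm_integral_le_of_norm_le_const (μ := Q) (f := g) (C := C)
        (Eventually.of_forall h)
      simpa using this
    · obtain ⟨ω0⟩ : Nonempty Ω' := Q.nonempty_of_neZero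
      exact (abs_nonneg _).trans (h ω0)
  calc _ ≤ |∫ ω, (f * g) ω ∂Q| + |(∫ ω, f ω ∂Q) * ∫ ω, g ω ∂Q| := abs_sub _ _
    _ ≤ _ := by linarith

variable {n u v : ℕ}

/-- The difference telescopes through `Xh + Z`: removing `Y` changes `F` by at most `lipConst F * ∑
‖Y a‖`, which is treated in `L²`, and then removing `Z` by at most `lipConst F * ∑ ‖Z a‖`, treated
in `L¹`. -/
lemma abs_covariance_sub_le {F : (Fin u → Euc n) → ℝ} (hF : IsBddLip F)
    {X Xh Y Z : Fin u → Ω' → Euc n} (hXh : ∀ a, Measurable (Xh a)) (hY : ∀ a, Measurable (Y a))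
    (hZ : ∀ a, Measurable (Z a)) (hX : ∀ a ω, X a ω = Xh a ω + Y a ω + Z a ω)
    {k l : Fin u → ℝ} (hY2 : ∀ a, MemLp (Y a) 2 Q)
    (hYk : ∀ a, Real.sqrt (∫ ω, ‖Y a ω‖ ^ 2 ∂Q) ≤ k a) (hZ1 : ∀ a, Integrable (Z a) Q)
    (hZl : ∀ a, ∫ ω, ‖Z a ω‖ ∂Q ≤ l a) {g : Ω' → ℝ} (hg : Measurable g) {C : ℝ}
    (hC : ∀ ω, |g ω| ≤ C) :
    |cov[fun ω => F (fun a => X a ω) - F (fun a => Xh a ω), g; Q]| ≤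
      C * lipConst F * ∑ a, (k a + 2 * l a) := by
  have hL := lipConst_nonneg F
  obtain ⟨ω0⟩ : Nonempty Ω' := Q.nonempty_of_neZero
  have hC0 : 0 ≤ C := (abs_nonneg _).trans (hC ω0)
  have hFm := hF.continuous.measurable
  set A1 : Ω' → ℝ := fun ω => F (fun a => X a ω) - F (fun a => Xh a ω + Z a ω) with hA1
  set A2 : Ω' → ℝ := fun ω => F (fun a => Xh a ω + Z a ω) - F (fun a => Xh a ω) with hA2
  have hXm : ∀ a, Measurable (X a) := fun a => by
    have : X a = fun ω => Xh a ω + Y a ω + Z a ω := funext (hX a)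
    rw [this]
    exact ((hXh a).add (hY a)).add (hZ a)
  have hA1m : Measurable A1 := (hFm.comp (measurable_pi_lambda _ hXm)).sub
    (hFm.comp (measurable_pi_lambda _ fun a => (hXh a).add (hZ a)))
  have hA2m : Measurable A2 := (hFm.comp (measurable_pi_lambda _ fun a => (hXh a).add (hZ a))).sub
    (hFm.comp (measurable_pi_lambda _ hXh))
  have hbd : ∀ x y, |F x - F y| ≤ supNorm F + supNorm F := fun x y =>
    (abs_sub _ _).trans (add_le_add (hF.abs_le x) (hF.abs_le y))
  have hA1L : MemLp A1 2 Q := memLp_of_abs_le hA1m (fun ω => hbd _ _) 2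
  have hA2L : MemLp A2 2 Q := memLp_of_abs_le hA2m (fun ω => hbd _ _) 2
  have hsum : (fun ω => F (fun a => X a ω) - F (fun a => Xh a ω)) = A1 + A2 := by
    ext ω; simp [hA1, hA2]
  rw [hsum, covariance_add_left hA1L hA2L (memLp_of_abs_le hg hC 2)]
  have h1 : |cov[A1, g; Q]| ≤ C * (lipConst F * ∑ a, k a) := by
    refine (abs_covariance_le_sqrt hA1L hg hC).trans (mul_le_mul_of_nonneg_left ?_ hC0)
    have hle : ∫ ω, A1 ω ^ 2 ∂Q ≤ ∫ ω, (lipConst F * ∑ a, ‖Y a ω‖) ^ 2 ∂Q := by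
      refine integral_mono hA1L.integrable_sq ?_ fun ω => ?_
      · have : MemLp (fun ω => lipConst F * ∑ a, ‖Y a ω‖) 2 Q :=
          (memLp_finsetSum _ fun a _ => (hY2 a).norm).const_mul _
        exact this.integrable_sq
      · refine sq_le_sq' ?_ ?_ <;>
        [refine (abs_le.mp ?_).1; refine (abs_le.mp ?_).2] <;>
        · refine (hF.abs_sub_le _ _).trans (le_of_eq ?_)
          congr 1
          refine Finset.sum_congr rfl fun a _ => ?_
          rw [hX a ω]; congr 1; abel
    refine (Real.sqrt_le_sqrt hle).trans ?_
    simp only [mul_pow]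
    rw [integral_const_mul, Real.sqrt_mul (sq_nonneg _), Real.sqrt_sq hL]
    exact mul_le_mul_of_nonneg_left ((sqrt_integral_sum_norm_sq_le _ hY2).trans
      (Finset.sum_le_sum fun a _ => hYk a)) hL
  have h2 : |cov[A2, g; Q]| ≤ C * (2 * (lipConst F * ∑ a, l a)) := by
    refine (abs_covariance_le_integral (hA2L.integrable one_le_two) hA2L hg hC).trans
      (mul_le_mul_of_nonneg_left (mul_le_mul_of_nonneg_left ?_ zero_le_two) hC0)
    have hle : ∫ ω, |A2 ω| ∂Q ≤ ∫ ω, lipConst F * ∑ a, ‖Z a ω‖ ∂Q := by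
      refine integral_mono (hA2L.integrable one_le_two).abs
        ((integrable_finsetSum _ fun a _ => (hZ1 a).norm).const_mul _) fun ω => ?_
      refine (hF.abs_sub_le _ _).trans (le_of_eq ?_)
      simp
    refine hle.trans ?_
    rw [integral_const_mul, integral_finsetSum _ fun a _ => (hZ1 a).norm]
    exact mul_le_mul_of_nonneg_left (Finset.sum_le_sum fun a _ => hZl a) hL
  calc _ ≤ |cov[A1, g; Q]| + |cov[A2, g; Q]| := abs_add_le _ _
    _ ≤ _ := by
      rw [Finset.sum_add_distrib, ← Finset.mul_sum]
      linarith

/-- If the two families have independent main parts and remainders that split into an `L²` and an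
`L¹` part, then the covariance of bounded Lipschitz functionals is controlled by the remainders. -/
lemma abs_covariance_le_of_split {F : (Fin u → Euc n) → ℝ} (hF : IsBddLip F)
    {G : (Fin v → Euc n) → ℝ} (hG : IsBddLip G)
    {X Xh Y Z : Fin u → Ω' → Euc n} (hXh : ∀ a, Measurable (Xh a)) (hY : ∀ a, Measurable (Y a))
    (hZ : ∀ a, Measurable (Z a)) (hX : ∀ a ω, X a ω = Xh a ω + Y a ω + Z a ω)
    {k l : Fin u → ℝ} (hY2 : ∀ a, MemLp (Y a) 2 Q)
    (hYk : ∀ a, Real.sqrt (∫ ω, ‖Y a ω‖ ^ 2 ∂Q) ≤ k a) (hZ1 : ∀ a, Integrable (Z a) Q)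
    (hZl : ∀ a, ∫ ω, ‖Z a ω‖ ∂Q ≤ l a)
    {X' Xh' Y' Z' : Fin v → Ω' → Euc n} (hXh' : ∀ a, Measurable (Xh' a))
    (hY' : ∀ a, Measurable (Y' a))
    (hZ' : ∀ a, Measurable (Z' a)) (hX' : ∀ a ω, X' a ω = Xh' a ω + Y' a ω + Z' a ω)
    {k' l' : Fin v → ℝ} (hY2' : ∀ a, MemLp (Y' a) 2 Q)
    (hYk' : ∀ a, Real.sqrt (∫ ω, ‖Y' a ω‖ ^ 2 ∂Q) ≤ k' a) (hZ1' : ∀ a, Integrable (Z' a) Q)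
    (hZl' : ∀ a, ∫ ω, ‖Z' a ω‖ ∂Q ≤ l' a)
    (hind : IndepFun (fun ω a => Xh a ω) (fun ω b => Xh' b ω) Q) :
    |cov[fun ω => F (fun a => X a ω), fun ω => G (fun b => X' b ω); Q]| ≤
      supNorm G * lipConst F * ∑ a, (k a + 2 * l a) +
        supNorm F * lipConst G * ∑ b, (k' b + 2 * l' b) := by
  have hFm := hF.continuous.measurable
  have hGm := hG.continuous.measurable
  have hXm : ∀ a, Measurable (X a) := fun a => by
    have : X a = fun ω => Xh a ω + Y a ω + Z a ω := funext (hX a)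
    rw [this]
    exact ((hXh a).add (hY a)).add (hZ a)
  have hXm' : ∀ a, Measurable (X' a) := fun a => by
    have : X' a = fun ω => Xh' a ω + Y' a ω + Z' a ω := funext (hX' a)
    rw [this]
    exact ((hXh' a).add (hY' a)).add (hZ' a)
  have mF : Measurable fun ω => F (fun a => X a ω) := hFm.comp (measurable_pi_lambda _ hXm)
  have mFh : Measurable fun ω => F (fun a => Xh a ω) := hFm.comp (measurable_pi_lambda _ hXh)
  have mG : Measurable fun ω => G (fun a => X' a ω) := hGm.comp (measurable_pi_lambda _ hXm')
  have mGh : Measurable fun ω => G (fun a => Xh' a ω) := hGm.comp (measurable_pi_lambda _ hXh')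
  have LF := memLp_of_abs_le (Q := Q) mF (fun ω => hF.abs_le _) 2
  have LFh := memLp_of_abs_le (Q := Q) mFh (fun ω => hF.abs_le _) 2
  have LG := memLp_of_abs_le (Q := Q) mG (fun ω => hG.abs_le _) 2
  have LGh := memLp_of_abs_le (Q := Q) mGh (fun ω => hG.abs_le _) 2
  have h0 : cov[fun ω => F (fun a => Xh a ω), fun ω => G (fun b => Xh' b ω); Q] = 0 :=
    IndepFun.covariance_eq_zero (hind.comp hFm hGm) LFh LGh
  have hA := abs_covariance_sub_le (Q := Q) hF hXh hY hZ hX hY2 hYk hZ1 hZl mG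
    (fun ω => hG.abs_le _)
  have hB := abs_covariance_sub_le (Q := Q) hG hXh' hY' hZ' hX' hY2' hYk' hZ1' hZl' mFh
    (fun ω => hF.abs_le _)
  rw [covariance_fun_sub_left LF LFh LG] at hA
  rw [covariance_comm, covariance_fun_sub_right LFh LG LGh, h0, sub_zero] at hB
  -- First `F(X)` is replaced by `F(Xh)` against `G(X')`, then `G(X')` by `G(Xh')` against `F(Xh)`;
  -- what remains is zero by independence.
  calc _ = |(cov[fun ω => F (fun a => X a ω), fun ω => G (fun b => X' b ω); Q] -
        cov[fun ω => F (fun a => Xh a ω), fun ω => G (fun b => X' b ω); Q]) +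
        cov[fun ω => F (fun a => Xh a ω), fun ω => G (fun b => X' b ω); Q]| := by
        rw [sub_add_cancel]
    _ ≤ _ := (abs_add_le _ _).trans (add_le_add hA hB)

end Covariance

end MMAF

end

/-! ### Moments of independent sums and of compound rare jumps -/

noncomputable section

namespace MMAF

/-! ### Second moments of sums of independent random vectors -/

section Variance

lemma integral_norm_sq_eq {Ω' : Type*} [MeasurableSpace Ω'] {Q : Measure Ω'} {n : ℕ}
    {V : Ω' → Euc n} (hV : MemLp V 2 Q) :
    ∫ ω, ‖V ω‖ ^ 2 ∂Q = ∑ i, ∫ ω, V ω i ^ 2 ∂Q := by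
  simp only [EuclideanSpace.norm_sq_eq, Real.norm_eq_abs, sq_abs]
  refine integral_finsetSum _ fun i _ => ?_
  have : MemLp (fun ω => V ω i) 2 Q := hV.of_le
    ((PiLp.continuous_apply 2 _ i).comp_aestronglyMeasurable hV.1)
    (Eventually.of_forall fun ω => PiLp.norm_apply_le (V ω) i)
  exact this.integrable_sq

lemma integral_euc_apply {Ω' : Type*} [MeasurableSpace Ω'] {Q : Measure Ω'} {n : ℕ}
    {V : Ω' → Euc n} (hV : Integrable V Q) (i : Fin n) :
    (∫ ω, V ω ∂Q) i = ∫ ω, V ω i ∂Q :=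
  ((EuclideanSpace.proj i : Euc n →L[ℝ] ℝ).integral_comp_comm hV).symm

variable {J : Type*} [Fintype J] {Ω' : J → Type*} [∀ j, MeasurableSpace (Ω' j)]
  {Q : ∀ j, Measure (Ω' j)} [∀ j, IsProbabilityMeasure (Q j)] {n : ℕ}

lemma integral_eval_pi {E : Type*} [NormedAddCommGroup E] [NormedSpace ℝ E] (j : J)
    {g : Ω' j → E} (hg : AEStronglyMeasurable g (Q j)) :
    ∫ ω, g (ω j) ∂Measure.pi Q = ∫ x, g x ∂Q j := by
  have h := (measurePreserving_eval Q j)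
  rw [← h.map_eq] at hg
  have := integral_map h.measurable.aemeasurable hg
  rw [h.map_eq] at this
  exact this.symm

/-- Second moment of a sum of independent random vectors. -/
lemma integral_norm_sum_sq_pi {V : ∀ j, Ω' j → Euc n} (hV : ∀ j, MemLp (V j) 2 (Q j)) :
    ∫ ω, ‖∑ j, V j (ω j)‖ ^ 2 ∂Measure.pi Q =
      ‖∑ j, ∫ x, V j x ∂Q j‖ ^ 2 + ∑ j, ∫ x, ‖V j x - ∫ y, V j y ∂Q j‖ ^ 2 ∂Q j := by
  have hVi : ∀ j, Integrable (V j) (Q j) := fun j => (hV j).integrable one_le_two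
  have hc : ∀ j i, MemLp (fun x => V j x i) 2 (Q j) := fun j i => (hV j).of_le
    ((PiLp.continuous_apply 2 _ i).comp_aestronglyMeasurable (hV j).1)
    (Eventually.of_forall fun ω => PiLp.norm_apply_le (V j ω) i)
  have hpi : MemLp (fun ω => ∑ j, V j (ω j)) 2 (Measure.pi Q) :=
    memLp_finsetSum _ fun j _ => (hV j).comp_measurePreserving (measurePreserving_eval Q j)
  rw [integral_norm_sq_eq hpi, EuclideanSpace.norm_sq_eq]
  have hR : ∀ j, ∫ x, ‖V j x - ∫ y, V j y ∂Q j‖ ^ 2 ∂Q j =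
      ∑ i, Var[fun x => V j x i; Q j] := by
    intro j
    have h : MemLp (fun x => V j x - ∫ y, V j y ∂Q j) 2 (Q j) := (hV j).sub (memLp_const _)
    rw [integral_norm_sq_eq h]
    refine Finset.sum_congr rfl fun i _ => ?_
    rw [variance_eq_integral (hc j i).1.aemeasurable]
    simp only [PiLp.sub_apply]
    rw [integral_euc_apply (hVi j)]
  simp only [hR]
  rw [Finset.sum_comm, ← Finset.sum_add_distrib]
  refine Finset.sum_congr rfl fun i _ => ?_
  rw [← variance_sum_pi (fun j => hc j i)]
  have hS : MemLp (∑ j, fun ω : (∀ j, Ω' j) => V j (ω j) i) 2 (Measure.pi Q) :=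
    memLp_finsetSum' _ fun j _ => (hc j i).comp_measurePreserving (measurePreserving_eval Q j)
  rw [variance_eq_sub hS]
  have e1 : (∫ ω, (∑ j, fun ω : (∀ j, Ω' j) => V j (ω j) i) ω ∂Measure.pi Q) =
      (∑ j, ∫ x, V j x ∂Q j) i := by
    simp only [Finset.sum_apply]
    have hint : ∀ j, Integrable (fun ω : (∀ j, Ω' j) => V j (ω j) i) (Measure.pi Q) := fun j =>
      ((hc j i).comp_measurePreserving (measurePreserving_eval Q j)).integrable one_le_two
    rw [integral_finsetSum _ fun j _ => hint j]
    simp only [WithLp.ofLp_sum, Finset.sum_apply]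
    refine Finset.sum_congr rfl fun j _ => ?_
    rw [integral_euc_apply (hVi j)]
    exact integral_eval_pi j (hc j i).1
  rw [e1]
  simp [Finset.sum_apply]

lemma integral_norm_sub_integral_sq_le {Ω' : Type*} [MeasurableSpace Ω'] {Q : Measure Ω'}
    [IsProbabilityMeasure Q] {V : Ω' → Euc n} (hV : MemLp V 2 Q) :
    ∫ x, ‖V x - ∫ y, V y ∂Q‖ ^ 2 ∂Q ≤ ∫ x, ‖V x‖ ^ 2 ∂Q := by
  -- With a single summand the formula reads: second moment = squared mean + variance.
  have h := integral_norm_sum_sq_pi (J := Unit) (Q := fun _ => Q) (V := fun _ => V)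
    (fun _ => hV)
  simp only [Finset.univ_unique, Finset.sum_singleton] at h
  rw [integral_eval_pi (Q := fun _ : Unit => Q) default
    (g := fun x => ‖V x‖ ^ 2) (hV.1.norm.pow 2)] at h
  have := sq_nonneg ‖∫ y, V y ∂Q‖
  linarith

end Variance

/-! ### Sums of rare jumps -/

section RareJumps

variable {d : ℕ}

/-- The law of a vector that equals `0` with probability `1 - t ρ(ℝ^d)` and otherwise is drawn
from `ρ`. -/
def rareJump (ρ : Measure (Euc d)) (t : ℝ) : Measure (Euc d) :=
  ENNReal.ofReal (1 - t * ρ.real Set.univ) • Measure.dirac 0 + ENNReal.ofReal t • ρ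

variable {ρ : Measure (Euc d)} {t : ℝ}

lemma integrable_rareJump {E : Type*} [NormedAddCommGroup E] {g : Euc d → E}
    (hg : Integrable g ρ) : Integrable g (rareJump ρ t) :=
  ((integrable_dirac (by finiteness)).smul_measure ENNReal.ofReal_ne_top).add_measure
    (hg.smul_measure ENNReal.ofReal_ne_top)

lemma integral_rareJump {E : Type*} [NormedAddCommGroup E] [NormedSpace ℝ E] [CompleteSpace E]
    (ht : 0 ≤ t) (h : t * ρ.real Set.univ ≤ 1) {g : Euc d → E} (hg : Integrable g ρ) :
    ∫ x, g x ∂rareJump ρ t = (1 - t * ρ.real Set.univ) • g 0 + t • ∫ x, g x ∂ρ := by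
  rw [rareJump, integral_add_measure
    ((integrable_dirac (by finiteness)).smul_measure ENNReal.ofReal_ne_top)
    (hg.smul_measure ENNReal.ofReal_ne_top), integral_smul_measure, integral_smul_measure,
    integral_dirac, ENNReal.toReal_ofReal (by linarith), ENNReal.toReal_ofReal ht]

lemma indicator_id_zero (D : Set (Euc d)) : D.indicator (id : Euc d → Euc d) 0 = 0 := by
  by_cases h0 : (0 : Euc d) ∈ D <;> simp [h0]

lemma memLp_indicator_rareJump {D : Set (Euc d)} (hD : MeasurableSet D)
    (h2 : MemLp id 2 (ρ.restrict D)) :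
    MemLp (D.indicator id) 2 (rareJump ρ t) := by
  have h1 : Measurable (D.indicator (id : Euc d → Euc d)) := measurable_id.indicator hD
  rw [memLp_two_iff_integrable_sq_norm h1.aestronglyMeasurable]
  apply integrable_rareJump
  rw [← memLp_two_iff_integrable_sq_norm h1.aestronglyMeasurable]
  exact (memLp_indicator_iff_restrict hD).mpr h2

variable [IsFiniteMeasure ρ]

lemma isProbabilityMeasure_rareJump (ht : 0 ≤ t) (h : t * ρ.real Set.univ ≤ 1) :
    IsProbabilityMeasure (rareJump ρ t) := by
  constructor
  simp only [rareJump, Measure.add_apply, Measure.smul_apply, smul_eq_mul, measure_univ, mul_one]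
  rw [← ofReal_measureReal (μ := ρ), ← ENNReal.ofReal_mul ht,
    ← ENNReal.ofReal_add (by linarith) (by positivity)]
  simp

/-- The atom at 0 carries the missing mass `1 - t ρ(ℝ^d)`, which turns `t ∫ e` into `1 + t ∫ (e -
1)`, the first-order expansion of a compound Poisson characteristic function. -/
lemma charFun_rareJump (ht : 0 ≤ t) (h : t * ρ.real Set.univ ≤ 1) (u : Euc d) :
    charFun (rareJump ρ t) u =
      1 + t * ∫ x, (Complex.exp (Complex.I * ((inner ℝ u x : ℝ) : ℂ)) - 1) ∂ρ := by
  have hI : Integrable (fun x : Euc d => Complex.exp (((inner ℝ x u : ℝ) : ℂ) * Complex.I)) ρ := by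
    refine Integrable.of_bound (by fun_prop) 1 (Eventually.of_forall fun x => ?_)
    rw [Complex.norm_exp_ofReal_mul_I]
  rw [charFun_apply, integral_rareJump ht h hI]
  have : ∀ x : Euc d, Complex.exp (Complex.I * ((inner ℝ u x : ℝ) : ℂ)) =
      Complex.exp (((inner ℝ x u : ℝ) : ℂ) * Complex.I) := fun x => by
    rw [real_inner_comm, mul_comm]
  simp only [this]
  rw [integral_sub hI (integrable_const _)]
  simp
  ring

/-- The law of the pair of the sums of the small and of the large jumps of `M` independent rare
jumps, with drifts. -/
def splitLaw (ρ : Measure (Euc d)) (D : Set (Euc d)) (t : ℝ) (M : ℕ) (b₁ b₂ : Euc d) :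
    Measure (Euc d × Euc d) :=
  (Measure.pi fun _ : Fin M => rareJump ρ t).map fun ω =>
    (b₁ + ∑ i, D.indicator id (ω i), b₂ + ∑ i, Dᶜ.indicator id (ω i))

lemma measurable_splitMap {D : Set (Euc d)} (hD : MeasurableSet D) (M : ℕ) (b₁ b₂ : Euc d) :
    Measurable fun ω : Fin M → Euc d =>
      (b₁ + ∑ i, D.indicator id (ω i), b₂ + ∑ i, Dᶜ.indicator id (ω i)) := by
  have h1 : Measurable (D.indicator (id : Euc d → Euc d)) := measurable_id.indicator hD
  have h2 : Measurable (Dᶜ.indicator (id : Euc d → Euc d)) := measurable_id.indicator hD.compl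
  fun_prop

variable {D : Set (Euc d)} {M : ℕ} {b₁ b₂ : Euc d}

lemma isProbabilityMeasure_splitLaw (hD : MeasurableSet D) (ht : 0 ≤ t)
    (h : t * ρ.real Set.univ ≤ 1) : IsProbabilityMeasure (splitLaw ρ D t M b₁ b₂) := by
  have := isProbabilityMeasure_rareJump ht h
  exact Measure.isProbabilityMeasure_map (measurable_splitMap hD M b₁ b₂).aemeasurable

/-- The parts of a jump in `D` and in `Dᶜ` add up to the jump, so the total does not see the split
and is a drift plus a sum of `M` i.i.d. rare jumps. -/
lemma charFun_splitLaw (hD : MeasurableSet D) (ht : 0 ≤ t) (h : t * ρ.real Set.univ ≤ 1)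
    (u : Euc d) :
    charFun ((splitLaw ρ D t M b₁ b₂).map fun p => p.1 + p.2) u =
      (1 + t * ∫ x, (Complex.exp (Complex.I * ((inner ℝ u x : ℝ) : ℂ)) - 1) ∂ρ) ^ M *
        Complex.exp (Complex.I * ((inner ℝ (b₁ + b₂) u : ℝ) : ℂ)) := by
  have := isProbabilityMeasure_rareJump ht h
  rw [splitLaw, Measure.map_map (by fun_prop) (measurable_splitMap hD M b₁ b₂)]
  have hfun : ((fun p : Euc d × Euc d => p.1 + p.2) ∘ fun ω : Fin M → Euc d =>
      (b₁ + ∑ i, D.indicator id (ω i), b₂ + ∑ i, Dᶜ.indicator id (ω i))) =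
      (fun x => x + (b₁ + b₂)) ∘ fun ω : Fin M → Euc d => ∑ i, ω i := by
    funext ω
    have : ∀ i, ω i = D.indicator id (ω i) + Dᶜ.indicator id (ω i) := fun i => by
      rw [Set.indicator_self_add_compl_apply, id]
    simp only [Function.comp]
    conv_rhs => rw [Finset.sum_congr rfl fun i _ => this i, Finset.sum_add_distrib]
    abel
  rw [hfun, ← Measure.map_map (by fun_prop) (by fun_prop), charFun_map_add_const,
    charFun_map_sum_pi_eq_prod]
  simp [charFun_rareJump ht h, mul_comm]

lemma memLp_fst_splitLaw (hD : MeasurableSet D) (ht : 0 ≤ t)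
    (h : t * ρ.real Set.univ ≤ 1) (h2 : MemLp id 2 (ρ.restrict D)) :
    MemLp Prod.fst 2 (splitLaw ρ D t M b₁ b₂) := by
  have := isProbabilityMeasure_rareJump ht h
  rw [splitLaw, memLp_map_measure_iff measurable_fst.aestronglyMeasurable
    (measurable_splitMap hD M b₁ b₂).aemeasurable]
  refine (memLp_const b₁).add (memLp_finsetSum _ fun i _ => ?_)
  exact (memLp_indicator_rareJump hD h2).comp_measurePreserving
    (measurePreserving_eval (fun _ : Fin M => rareJump ρ t) i)

lemma integral_fst_splitLaw (hD : MeasurableSet D) (ht : 0 ≤ t)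
    (h : t * ρ.real Set.univ ≤ 1) (h2 : MemLp id 2 (ρ.restrict D)) :
    ∫ p, p.1 ∂splitLaw ρ D t M b₁ b₂ = b₁ + (M * t) • ∫ x in D, x ∂ρ := by
  have := isProbabilityMeasure_rareJump ht h
  have h1 : Measurable (D.indicator (id : Euc d → Euc d)) := measurable_id.indicator hD
  have hL := memLp_indicator_rareJump (t := t) hD h2
  rw [splitLaw, integral_map (measurable_splitMap hD M b₁ b₂).aemeasurable
    measurable_fst.aestronglyMeasurable]
  have hi : ∀ i : Fin M, Integrable (fun ω : Fin M → Euc d => D.indicator id (ω i))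
      (Measure.pi fun _ : Fin M => rareJump ρ t) := fun i =>
    (hL.comp_measurePreserving
      (measurePreserving_eval (fun _ : Fin M => rareJump ρ t) i)).integrable one_le_two
  simp only
  rw [integral_add (integrable_const _) (integrable_finsetSum _ fun i _ => hi i),
    integral_finsetSum _ fun i _ => hi i]
  have : ∀ i : Fin M, ∫ ω : Fin M → Euc d, D.indicator id (ω i)
      ∂(Measure.pi fun _ : Fin M => rareJump ρ t) = t • ∫ x in D, x ∂ρ := by
    intro i
    rw [integral_eval_pi (Q := fun _ : Fin M => rareJump ρ t) i h1.aestronglyMeasurable,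
      integral_rareJump ht h, integral_indicator hD]
    · simp [indicator_id_zero]
    · exact ((memLp_indicator_iff_restrict hD).mpr h2).integrable one_le_two
  simp only [this]
  simp [mul_smul, ← Nat.cast_smul_eq_nsmul ℝ]

/-- After centring, the sum has `M` independent mean-zero terms, so variances add. Each is at most
the second moment `t ∫_D ‖T x‖²`; only the squared mean of a single jump is thrown away. -/
lemma integral_norm_act_fst_sub_sq_le {n : ℕ} (T : Matrix (Fin n) (Fin d) ℝ)
    (hD : MeasurableSet D) (ht : 0 ≤ t)
    (h : t * ρ.real Set.univ ≤ 1) (h2 : MemLp id 2 (ρ.restrict D)) :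
    ∫ p, ‖act T (p.1 - (b₁ + (M * t) • ∫ x in D, x ∂ρ))‖ ^ 2 ∂splitLaw ρ D t M b₁ b₂ ≤
      (M * t) * ∫ x in D, ‖act T x‖ ^ 2 ∂ρ := by
  have := isProbabilityMeasure_rareJump ht h
  have h1 : Measurable (D.indicator (id : Euc d → Euc d)) := measurable_id.indicator hD
  have hL := memLp_indicator_rareJump (t := t) hD h2
  have hm : ∫ x, D.indicator id x ∂rareJump ρ t = t • ∫ x in D, x ∂ρ := by
    rw [integral_rareJump ht h, integral_indicator hD, indicator_id_zero]
    · simp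
    · exact ((memLp_indicator_iff_restrict hD).mpr h2).integrable one_le_two
  rw [splitLaw, integral_map (measurable_splitMap hD M b₁ b₂).aemeasurable
    (by
      have : Continuous fun p : Euc d × Euc d =>
        ‖act T (p.1 - (b₁ + (M * t) • ∫ x in D, x ∂ρ))‖ ^ 2 := by fun_prop
      exact this.aestronglyMeasurable)]
  set m : Euc d := t • ∫ x in D, x ∂ρ with hmdef
  set V : Euc d → Euc n := fun x => act T (D.indicator id x) with hVdef
  have hV : MemLp V 2 (rareJump ρ t) := (actL T).comp_memLp' hL
  have hVm : ∫ x, V x ∂rareJump ρ t = act T m := by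
    have := (actL T).integral_comp_comm (hL.integrable one_le_two)
    simp only [actL_apply] at this
    rw [hVdef, this, hm]
  have hVc : MemLp (fun x => V x - act T m) 2 (rareJump ρ t) := hV.sub (memLp_const _)
  have e : ∀ ω : Fin M → Euc d, act T (b₁ + ∑ i, D.indicator id (ω i) -
      (b₁ + (M * t) • ∫ x in D, x ∂ρ)) = ∑ i, (V (ω i) - act T m) := by
    intro ω
    rw [add_sub_add_left_eq_sub, act_sub, act_sum, Finset.sum_sub_distrib]
    simp [hVdef, hmdef, mul_smul, act_smul, ← Nat.cast_smul_eq_nsmul ℝ]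
  simp only [e]
  rw [integral_norm_sum_sq_pi (V := fun _ : Fin M => fun x => V x - act T m) (fun _ => hVc)]
  have h0 : ∫ x, (V x - act T m) ∂rareJump ρ t = 0 := by
    rw [integral_sub (hV.integrable one_le_two) (integrable_const _), hVm]; simp
  simp only [h0, Finset.sum_const_zero, norm_zero, sub_zero]
  have hle := integral_norm_sub_integral_sq_le hV
  rw [hVm] at hle
  have hVs : ∫ x, ‖V x‖ ^ 2 ∂rareJump ρ t = t * ∫ x in D, ‖act T x‖ ^ 2 ∂ρ := by
    have hind : (fun x => ‖V x‖ ^ 2) = D.indicator fun x => ‖act T x‖ ^ 2 := by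
      funext x
      by_cases hx : x ∈ D <;> simp [hVdef, hx]
    rw [integral_rareJump ht h, hind, integral_indicator hD]
    · have hV0 : V 0 = 0 := by rw [hVdef]; simp only [indicator_id_zero, act_zero]
      simp [hV0]
    · have : MemLp V 2 ρ := (actL T).comp_memLp' ((memLp_indicator_iff_restrict hD).mpr h2)
      exact (memLp_two_iff_integrable_sq_norm this.1).mp this
  rw [hVs] at hle
  simp only [Finset.sum_const, Finset.card_univ, Fintype.card_fin, nsmul_eq_mul]
  rw [mul_assoc]
  have := mul_le_mul_of_nonneg_left hle (Nat.cast_nonneg (α := ℝ) M)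
  simpa using this

lemma integrable_snd_splitLaw (hD : MeasurableSet D) (ht : 0 ≤ t)
    (h : t * ρ.real Set.univ ≤ 1) (h1 : IntegrableOn id Dᶜ ρ) :
    Integrable Prod.snd (splitLaw ρ D t M b₁ b₂) := by
  have := isProbabilityMeasure_rareJump ht h
  rw [splitLaw, integrable_map_measure measurable_snd.aestronglyMeasurable
    (measurable_splitMap hD M b₁ b₂).aemeasurable]
  refine (integrable_const b₂).add (integrable_finsetSum _ fun i _ => ?_)
  exact (measurePreserving_eval (fun _ : Fin M => rareJump ρ t) i).integrable_comp_of_integrable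
    (integrable_rareJump ((integrable_indicator_iff hD.compl).mpr h1))

lemma integral_norm_act_snd_le {n : ℕ} (T : Matrix (Fin n) (Fin d) ℝ) (hD : MeasurableSet D)
    (ht : 0 ≤ t) (h : t * ρ.real Set.univ ≤ 1) (h1 : IntegrableOn id Dᶜ ρ) :
    ∫ p, ‖act T p.2‖ ∂splitLaw ρ D t M b₁ b₂ ≤
      ‖act T b₂‖ + (M * t) * ∫ x in Dᶜ, ‖act T x‖ ∂ρ := by
  have := isProbabilityMeasure_rareJump ht h
  have hm : Measurable (Dᶜ.indicator (id : Euc d → Euc d)) := measurable_id.indicator hD.compl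
  have hI := integrable_rareJump (t := t) ((integrable_indicator_iff hD.compl).mpr h1)
  rw [splitLaw, integral_map (measurable_splitMap hD M b₁ b₂).aemeasurable
    (by
      have : Continuous fun p : Euc d × Euc d => ‖act T p.2‖ := by fun_prop
      exact this.aestronglyMeasurable)]
  set V : Euc d → Euc n := fun x => act T (Dᶜ.indicator id x) with hVdef
  have hV : Integrable V (rareJump ρ t) := (actL T).integrable_comp hI
  have hVi : ∀ i : Fin M, Integrable (fun ω : Fin M → Euc d => ‖V (ω i)‖)
      (Measure.pi fun _ : Fin M => rareJump ρ t) := fun i =>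
    (measurePreserving_eval (fun _ : Fin M => rareJump ρ t) i).integrable_comp_of_integrable
      hV.norm
  have hle : ∫ ω : Fin M → Euc d, ‖act T (b₂ + ∑ i, Dᶜ.indicator id (ω i))‖
      ∂(Measure.pi fun _ : Fin M => rareJump ρ t) ≤
      ∫ ω : Fin M → Euc d, (‖act T b₂‖ + ∑ i, ‖V (ω i)‖)
        ∂(Measure.pi fun _ : Fin M => rareJump ρ t) := by
    refine integral_mono_of_nonneg (Eventually.of_forall fun _ => norm_nonneg _)
      ((integrable_const _).add (integrable_finsetSum _ fun i _ => hVi i))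
      (Eventually.of_forall fun ω => ?_)
    simp only [act_add, act_sum]
    exact (norm_add_le _ _).trans (add_le_add le_rfl (norm_sum_le _ _))
  refine hle.trans ?_
  rw [integral_add (integrable_const _) (integrable_finsetSum _ fun i _ => hVi i),
    integral_finsetSum _ fun i _ => hVi i]
  have hVs : ∫ x, ‖V x‖ ∂rareJump ρ t = t * ∫ x in Dᶜ, ‖act T x‖ ∂ρ := by
    have hind : (fun x => ‖V x‖) = Dᶜ.indicator fun x => ‖act T x‖ := by
      funext x
      by_cases hx : x ∈ D <;> simp [hVdef, hx]
    rw [integral_rareJump ht h, hind, integral_indicator hD.compl]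
    · have hV0 : V 0 = 0 := by rw [hVdef]; simp only [indicator_id_zero, act_zero]
      simp [hV0]
    · exact ((actL T).integrable_comp ((integrable_indicator_iff hD.compl).mpr h1)).norm
  have : ∀ i : Fin M, ∫ ω : Fin M → Euc d, ‖V (ω i)‖
      ∂(Measure.pi fun _ : Fin M => rareJump ρ t) = t * ∫ x in Dᶜ, ‖act T x‖ ∂ρ := fun i => by
    rw [integral_eval_pi (Q := fun _ : Fin M => rareJump ρ t) i (g := fun x => ‖V x‖) hV.1.norm,
      hVs]
  simp only [this]
  simp [mul_assoc]

end RareJumps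

end MMAF

end

noncomputable section

namespace MMAF

variable {n d : ℕ}

/-! ### Approximation of infinitely divisible laws by split laws -/

/-- For every `c ≥ 0` there are laws on pairs (`L²` part, `L¹` part) whose sums have characteristic
functions converging to `exp (c Φ)`, with first and second moments of the `L²` part controlled by
`c μ` and `c τ`, and first moment of the `L¹` part controlled in the limit by `c κ`. -/
def SplitApprox (Φ : Euc d → ℂ) (τ κ : Matrix (Fin n) (Fin d) ℝ → ℝ) (μ : Euc d) : Prop :=
  ∀ c : ℝ, 0 ≤ c → ∃ (Q : ℕ → Measure (Euc d × Euc d)) (κ' : ℕ → Matrix (Fin n) (Fin d) ℝ → ℝ),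
    (∀ N, IsProbabilityMeasure (Q N)) ∧
    (∀ u, Tendsto (fun N => charFun ((Q N).map fun p => p.1 + p.2) u) atTop
      (𝓝 (Complex.exp (Φ u * c)))) ∧
    (∀ N, MemLp Prod.fst 2 (Q N)) ∧ (∀ N, ∫ p, p.1 ∂Q N = c • μ) ∧
    (∀ N T, ∫ p, ‖act T (p.1 - c • μ)‖ ^ 2 ∂Q N ≤ c * τ T) ∧
    (∀ N, Integrable Prod.snd (Q N)) ∧ (∀ N T, ∫ p, ‖act T p.2‖ ∂Q N ≤ c * κ' N T) ∧
    ∀ T, Tendsto (fun N => κ' N T) atTop (𝓝 (κ T))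

/-- A Taylor bound for `|y| ≤ 1`; for `|y| ≥ 1` the trivial bound `2 |y|` is at most `2 y²`, which
fixes the constant. -/
lemma norm_exp_I_mul_sub_one_sub_le (y : ℝ) :
    ‖Complex.exp (Complex.I * (y : ℂ)) - 1 - Complex.I * (y : ℂ)‖ ≤ 2 * y ^ 2 := by
  have hn : ‖Complex.I * (y : ℂ)‖ = |y| := by simp
  rcases le_total |y| 1 with h | h
  · refine (Complex.norm_exp_sub_one_sub_id_le (by rwa [hn])).trans ?_
    rw [hn, sq_abs]; nlinarith [sq_nonneg y]
  · refine (norm_sub_le _ _).trans ?_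
    have h1 : ‖Complex.exp (Complex.I * (y : ℂ)) - 1‖ ≤ |y| :=
      Real.norm_exp_I_mul_ofReal_sub_one_le
    rw [hn, ← sq_abs]
    nlinarith

lemma norm_exp_I_mul_sub_one_le_two (y : ℝ) :
    ‖Complex.exp (Complex.I * (y : ℂ)) - 1‖ ≤ 2 := by
  refine (norm_sub_le _ _).trans ?_
  rw [mul_comm, Complex.norm_exp_ofReal_mul_I]
  norm_num

/-- Any real sequence can be dominated by the index after slowing it down. -/
lemma exists_slow_index (a : ℕ → ℝ) :
    ∃ k : ℕ → ℕ, Tendsto k atTop atTop ∧ ∀ᶠ N : ℕ in atTop, a (k N) ≤ N := by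
  classical
  refine ⟨fun N => Nat.findGreatest (fun k => a k ≤ N) N, ?_, ?_⟩
  · refine tendsto_atTop.mpr fun K => ?_
    obtain ⟨m, hm⟩ := exists_nat_ge (a K)
    filter_upwards [eventually_ge_atTop (max K m)] with N hN
    refine Nat.le_findGreatest ((le_max_left _ _).trans hN) (hm.trans ?_)
    exact_mod_cast (le_max_right _ _).trans hN
  · obtain ⟨m, hm⟩ := exists_nat_ge (a 0)
    filter_upwards [eventually_ge_atTop m] with N hN
    exact Nat.findGreatest_spec (P := fun k => a k ≤ N) (m := 0) (Nat.zero_le _)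
      (hm.trans (by exact_mod_cast hN))

lemma norm_integral_exp_sub_one_le (ρ : Measure (Euc d)) [IsFiniteMeasure ρ] (u : Euc d) :
    ‖∫ x, (Complex.exp (Complex.I * ((inner ℝ u x : ℝ) : ℂ)) - 1) ∂ρ‖ ≤
      2 * ρ.real Set.univ :=
  norm_integral_le_of_norm_le_const
    (Eventually.of_forall fun _ => norm_exp_I_mul_sub_one_le_two _)

/-- A sum of `s` rare jumps at intensity `c / s` has a characteristic function `(1 + c z / s)^s`
times the drift factor, with limit `exp (c Φ)` once the exponents for `ρ k` converge. The masses of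
`ρ k` may blow up, so `k` has to grow slowly compared with `s`. Since `s * (c / s) = c`, the mean
and moment bounds of the parts scale with `c` at every stage. -/
lemma splitApprox_of_jumps {Φ : Euc d → ℂ} {τ κ : Matrix (Fin n) (Fin d) ℝ → ℝ} {μ : Euc d}
    {ρ : ℕ → Measure (Euc d)} (hρ : ∀ k, IsFiniteMeasure (ρ k)) {D : Set (Euc d)}
    (hD : MeasurableSet D) {b₁ b₂ : ℕ → Euc d}
    (hΦ : ∀ u, Tendsto (fun k => Complex.I * ((inner ℝ (b₁ k + b₂ k) u : ℝ) : ℂ) +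
      ∫ x, (Complex.exp (Complex.I * ((inner ℝ u x : ℝ) : ℂ)) - 1) ∂ρ k) atTop (𝓝 (Φ u)))
    (h2 : ∀ k, MemLp id 2 ((ρ k).restrict D)) (hμ : ∀ k, b₁ k + ∫ x in D, x ∂ρ k = μ)
    (hτ : ∀ k T, ∫ x in D, ‖act T x‖ ^ 2 ∂ρ k ≤ τ T)
    (h1 : ∀ k, IntegrableOn id Dᶜ (ρ k)) {κ' : ℕ → Matrix (Fin n) (Fin d) ℝ → ℝ}
    (hκ' : ∀ k T, ‖act T (b₂ k)‖ + ∫ x in Dᶜ, ‖act T x‖ ∂ρ k ≤ κ' k T)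
    (hκ : ∀ T, Tendsto (fun k => κ' k T) atTop (𝓝 (κ T))) :
    SplitApprox Φ τ κ μ := by
  intro c hc
  -- One number dominating both the total intensity and the drift. The `+ 1` gives `r ≤ r²`, so a
  -- bound on `r²` also bounds the mass.
  set r : ℕ → ℝ := fun k => c * (ρ k).real Set.univ + ‖b₁ k + b₂ k‖ + 1 with hr
  have hr1 : ∀ k, 1 ≤ r k := fun k => by
    have : 0 ≤ c * (ρ k).real Set.univ := by positivity
    have := norm_nonneg (b₁ k + b₂ k)
    simp only [hr]; linarith
  -- The error below is of order `r (k N)² / N`; the extra factor `k + 1` makes it tend to zero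
  -- instead of merely staying bounded.
  obtain ⟨k, hk, hkN⟩ := exists_slow_index fun k => r k ^ 2 * (k + 1)
  obtain ⟨N0, hN0⟩ := eventually_atTop.mp hkN
  -- Shifting past `N0` makes the domination hold for every index, as the rare jump laws must be
  -- probability measures throughout; the `+ 1` keeps `s N` positive.
  set s : ℕ → ℕ := fun N => N + (N0 + 1) with hs
  have hspos : ∀ N, (0 : ℝ) < s N := fun N => by simp only [hs]; positivity
  have hsk : ∀ N, r (k (s N)) ^ 2 * ((k (s N) : ℝ) + 1) ≤ s N := fun N =>
    hN0 _ (by simp only [hs]; omega)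
  have ht : ∀ N, 0 ≤ c / s N := fun N => div_nonneg hc (hspos N).le
  have hmass : ∀ N, c / s N * (ρ (k (s N))).real Set.univ ≤ 1 := fun N => by
    rw [div_mul_eq_mul_div, div_le_one (hspos N)]
    refine le_trans ?_ (hsk N)
    have h1 := hr1 (k (s N))
    have h3 : c * (ρ (k (s N))).real Set.univ ≤ r (k (s N)) := by
      have := norm_nonneg (b₁ (k (s N)) + b₂ (k (s N)))
      simp only [hr]; linarith
    have h4 : (0 : ℝ) ≤ k (s N) := Nat.cast_nonneg _
    nlinarith
  have hMt : ∀ N, (s N : ℝ) * (c / s N) = c := fun N => mul_div_cancel₀ _ (hspos N).ne'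
  refine ⟨fun N => splitLaw (ρ (k (s N))) D (c / s N) (s N) (c • b₁ (k (s N))) (c • b₂ (k (s N))),
    fun N => κ' (k (s N)), fun N => isProbabilityMeasure_splitLaw hD (ht N) (hmass N), ?_,
    fun N => memLp_fst_splitLaw hD (ht N) (hmass N) (h2 _), fun N => ?_, fun N T => ?_,
    fun N => integrable_snd_splitLaw hD (ht N) (hmass N) (h1 _), fun N T => ?_, fun T => ?_⟩
  · intro u
    set z : ℕ → ℂ := fun k =>
      ∫ x, (Complex.exp (Complex.I * ((inner ℝ u x : ℝ) : ℂ)) - 1) ∂ρ k with hz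
    set β : ℕ → ℝ := fun k => c * inner ℝ (b₁ k + b₂ k) u with hβ
    -- The drift is shared equally among the `N` factors, so that the characteristic function is
    -- exactly `(1 + g N)^N` and only `N * g N` has to be controlled.
    set g : ℕ → ℂ := fun N => (1 + (c / N : ℝ) * z (k N)) *
      Complex.exp (Complex.I * ((β (k N) / N : ℝ) : ℂ)) - 1 with hg
    have hgt : Tendsto (fun N : ℕ => (N : ℂ) * g N) atTop (𝓝 (Φ u * c)) := by
      have hlim : Tendsto (fun N : ℕ => (c : ℂ) * (Complex.I *
          ((inner ℝ (b₁ (k N) + b₂ (k N)) u : ℝ) : ℂ) + z (k N))) atTop (𝓝 (Φ u * c)) := by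
        rw [mul_comm]
        exact ((hΦ u).comp hk).const_mul _
      have herr : Tendsto (fun N : ℕ => (N : ℂ) * g N - (c : ℂ) * (Complex.I *
          ((inner ℝ (b₁ (k N) + b₂ (k N)) u : ℝ) : ℂ) + z (k N))) atTop (𝓝 0) := by
        have hsq : Tendsto (fun N : ℕ => (2 * (c * ‖u‖) + 2 * (c * ‖u‖) ^ 2) *
            (1 / ((k N : ℝ) + 1))) atTop (𝓝 0) := by
          have := (tendsto_one_div_add_atTop_nhds_zero_nat (𝕜 := ℝ)).comp hk
          simpa using this.const_mul (2 * (c * ‖u‖) + 2 * (c * ‖u‖) ^ 2)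
        refine squeeze_zero_norm' ?_ hsq
        filter_upwards [hkN, eventually_gt_atTop 0] with N hN hNpos
        have hNR : (0 : ℝ) < N := by exact_mod_cast hNpos
        have hNC : (N : ℂ) ≠ 0 := by exact_mod_cast hNpos.ne'
        set y : ℝ := β (k N) / N with hy
        set e : ℂ := Complex.exp (Complex.I * (y : ℂ)) with he
        -- The error consists of the interaction between jump and drift and the second-order
        -- remainder of the drift exponential, both `O(r² / N)`.
        have hid : (N : ℂ) * g N - (c : ℂ) * (Complex.I *
            ((inner ℝ (b₁ (k N) + b₂ (k N)) u : ℝ) : ℂ) + z (k N)) =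
            c * z (k N) * (e - 1) + N * (e - 1 - Complex.I * (y : ℂ)) := by
          simp only [hg, hβ, hy, he]
          push_cast
          field_simp
          ring
        rw [hid]
        have hR1 := hr1 (k N)
        set R := r (k N) with hR
        have hw : ‖(c : ℂ) * z (k N)‖ ≤ 2 * R := by
          rw [norm_mul, Complex.norm_real, Real.norm_of_nonneg hc]
          have h3 := mul_le_mul_of_nonneg_left (norm_integral_exp_sub_one_le (ρ (k N)) u) hc
          have h4 : c * (ρ (k N)).real Set.univ ≤ R := by
            have := norm_nonneg (b₁ (k N) + b₂ (k N))
            simp only [hR, hr]; linarith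
          have h5 : c * ‖z (k N)‖ ≤ c * (2 * (ρ (k N)).real Set.univ) := h3
          linarith
        have hβR : |β (k N)| ≤ (c * ‖u‖) * R := by
          simp only [hβ, abs_mul, abs_of_nonneg hc]
          have h3 := abs_real_inner_le_norm (b₁ (k N) + b₂ (k N)) u
          have h4 : ‖b₁ (k N) + b₂ (k N)‖ ≤ R := by
            have : 0 ≤ c * (ρ (k N)).real Set.univ := by positivity
            simp only [hR, hr]; linarith
          calc c * |inner ℝ (b₁ (k N) + b₂ (k N)) u|
              ≤ c * (‖b₁ (k N) + b₂ (k N)‖ * ‖u‖) := mul_le_mul_of_nonneg_left h3 hc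
            _ ≤ c * (R * ‖u‖) := by gcongr
            _ = _ := by ring
        have hyabs : |y| = |β (k N)| / N := by rw [hy, abs_div, abs_of_pos hNR]
        have he1 : ‖e - 1‖ ≤ |β (k N)| / N := by
          rw [← hyabs]; exact Real.norm_exp_I_mul_ofReal_sub_one_le
        have he2 := norm_exp_I_mul_sub_one_sub_le y
        have hRN : R ^ 2 / N ≤ 1 / ((k N : ℝ) + 1) := by
          rw [div_le_div_iff₀ hNR (by positivity), one_mul]; exact hN
        calc ‖c * z (k N) * (e - 1) + N * (e - 1 - Complex.I * (y : ℂ))‖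
            ≤ ‖(c : ℂ) * z (k N)‖ * ‖e - 1‖ + N * ‖e - 1 - Complex.I * (y : ℂ)‖ := by
              refine (norm_add_le _ _).trans ?_
              rw [norm_mul, norm_mul (N : ℂ), Complex.norm_natCast]
          _ ≤ (2 * R) * (((c * ‖u‖) * R) / N) + N * (2 * y ^ 2) := by
              gcongr
              exact he1.trans (by gcongr)
          _ = (2 * (c * ‖u‖)) * (R ^ 2 / N) + 2 * (|β (k N)| ^ 2 / N) := by
              rw [← sq_abs y, hyabs]; field_simp
          _ ≤ (2 * (c * ‖u‖)) * (R ^ 2 / N) + 2 * (((c * ‖u‖) * R) ^ 2 / N) := by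
              gcongr
          _ = (2 * (c * ‖u‖) + 2 * (c * ‖u‖) ^ 2) * (R ^ 2 / N) := by ring
          _ ≤ _ := by gcongr
      simpa using herr.add hlim
    have hpow := (Complex.tendsto_one_add_pow_exp_of_tendsto hgt).comp
      (tendsto_add_atTop_nat (N0 + 1))
    refine hpow.congr fun N => ?_
    have := hρ (k (s N))
    rw [charFun_splitLaw hD (ht N) (hmass N)]
    simp only [Function.comp, hg, add_sub_cancel]
    change ((1 + ((c / (s N : ℕ) : ℝ) : ℂ) * z (k (s N))) *
      Complex.exp (Complex.I * ((β (k (s N)) / (s N : ℕ) : ℝ) : ℂ))) ^ (s N) = _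
    rw [mul_pow, ← Complex.exp_nat_mul]
    congr 2
    have hsC : ((s N : ℕ) : ℂ) ≠ 0 := by exact_mod_cast (hspos N).ne'
    simp only [hβ, ← smul_add, real_inner_smul_left]
    push_cast
    field_simp
  · have := hρ (k (s N))
    rw [integral_fst_splitLaw hD (ht N) (hmass N) (h2 _), hMt, ← smul_add, hμ]
  · have := hρ (k (s N))
    have h := integral_norm_act_fst_sub_sq_le (M := s N) (b₁ := c • b₁ (k (s N)))
      (b₂ := c • b₂ (k (s N))) T hD (ht N) (hmass N) (h2 _)
    rw [hMt, ← smul_add, hμ] at h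
    exact h.trans (mul_le_mul_of_nonneg_left (hτ _ T) hc)
  · have := hρ (k (s N))
    refine (integral_norm_act_snd_le T hD (ht N) (hmass N) (h1 _)).trans ?_
    rw [hMt, act_smul, norm_smul, Real.norm_of_nonneg hc, ← mul_add]
    exact mul_le_mul_of_nonneg_left (hκ' _ T) hc
  · exact (hκ T).comp (hk.comp (tendsto_add_atTop_nat (N0 + 1)))

end MMAF

end

/-! ### Compound Poisson approximation of the Lévy-Khintchine exponent -/

noncomputable section

namespace MMAF

variable {n d : ℕ}

/-! ### Positive semidefinite matrices as sums of squares -/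

section PosSemidef

-- The vectors are the rows of a self-adjoint square root of `Sig`.
open scoped MatrixOrder ComplexOrder in
lemma exists_rank_one_decomposition {Sig : Matrix (Fin d) (Fin d) ℝ} (h : Sig.PosSemidef) :
    ∃ v : Fin d → Euc d, ∀ i j, Sig i j = ∑ l, v l i * v l j := by
  obtain ⟨X, hX, -, rfl⟩ := CFC.exists_sqrt_of_isSelfAdjoint_of_quasispectrumRestricts
    h.isHermitian (QuasispectrumRestricts.nnreal_of_nonneg h.nonneg)
  refine ⟨fun l => WithLp.toLp 2 fun i => X l i, fun i j => ?_⟩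
  simp only [Matrix.mul_apply]
  refine Finset.sum_congr rfl fun l _ => ?_
  congr 1
  have := congrFun (congrFun hX.star_eq i) l
  simpa [Matrix.star_apply] using this.symm

variable {Sig : Matrix (Fin d) (Fin d) ℝ} {v : Fin d → Euc d}

lemma inner_act_eq_sum_sq (hv : ∀ i j, Sig i j = ∑ l, v l i * v l j) (u : Euc d) :
    inner ℝ u (act Sig u) = ∑ l, (inner ℝ u (v l) : ℝ) ^ 2 := by
  simp only [PiLp.inner_apply, act_apply, hv, RCLike.inner_apply, conj_trivial, pow_two,
    Finset.sum_mul, Finset.mul_sum]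
  calc _ = ∑ i, ∑ l, ∑ j, v l i * v l j * u j * u i :=
        Finset.sum_congr rfl fun i _ => Finset.sum_comm
    _ = ∑ l, ∑ i, ∑ j, v l i * v l j * u j * u i := Finset.sum_comm
    _ = _ := by
      refine Finset.sum_congr rfl fun l _ => Finset.sum_congr rfl fun i _ =>
        Finset.sum_congr rfl fun j _ => by ring

lemma trace_mul_mul_transpose (T : Matrix (Fin n) (Fin d) ℝ) (Sig : Matrix (Fin d) (Fin d) ℝ) :
    (T * Sig * T.transpose).trace = ∑ i, ∑ j, ∑ k, T i j * Sig j k * T i k := by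
  simp only [Matrix.trace, Matrix.diag_apply, Matrix.mul_apply, Matrix.transpose_apply,
    Finset.sum_mul]
  exact Finset.sum_congr rfl fun i _ => Finset.sum_comm

lemma norm_act_sq (T : Matrix (Fin n) (Fin d) ℝ) (x : Euc d) :
    ‖act T x‖ ^ 2 = ∑ i, ∑ j, ∑ k, T i j * (x j * x k) * T i k := by
  rw [EuclideanSpace.norm_sq_eq]
  refine Finset.sum_congr rfl fun i _ => ?_
  rw [Real.norm_eq_abs, sq_abs, act_apply, pow_two, Finset.sum_mul_sum]
  exact Finset.sum_congr rfl fun j _ => Finset.sum_congr rfl fun k _ => by ring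

lemma trace_eq_sum_norm_sq (hv : ∀ i j, Sig i j = ∑ l, v l i * v l j)
    (T : Matrix (Fin n) (Fin d) ℝ) :
    (T * Sig * T.transpose).trace = ∑ l, ‖act T (v l)‖ ^ 2 := by
  simp only [trace_mul_mul_transpose, norm_act_sq, hv, Finset.mul_sum, Finset.sum_mul]
  calc _ = ∑ i, ∑ j, ∑ l, ∑ k, T i j * (v l j * v l k) * T i k :=
        Finset.sum_congr rfl fun i _ => Finset.sum_congr rfl fun j _ => Finset.sum_comm
    _ = ∑ i, ∑ l, ∑ j, ∑ k, T i j * (v l j * v l k) * T i k :=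
        Finset.sum_congr rfl fun i _ => Finset.sum_comm
    _ = _ := Finset.sum_comm

/-- Together with `trace_eq_sum_norm_sq` this turns the traces of the theorem into sums and
integrals of `‖T x‖²`, the form in which second moments of jumps arise. -/
lemma trace_secondMoment {ν : Measure (Euc d)} {D : Set (Euc d)}
    (h2 : IntegrableOn (fun x => ‖x‖ ^ 2) D ν)
    (T : Matrix (Fin n) (Fin d) ℝ) :
    (T * secondMoment ν D * T.transpose).trace = ∫ x in D, ‖act T x‖ ^ 2 ∂ν := by
  have hI : ∀ j k : Fin d, Integrable (fun x : Euc d => x j * x k) (ν.restrict D) := by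
    intro j k
    refine h2.mono' (by fun_prop) (Eventually.of_forall fun x => ?_)
    rw [norm_mul, pow_two]
    exact mul_le_mul (PiLp.norm_apply_le x j) (PiLp.norm_apply_le x k) (norm_nonneg _)
      (norm_nonneg _)
  simp only [trace_mul_mul_transpose, norm_act_sq, secondMoment, Matrix.of_apply]
  rw [integral_finsetSum _ fun i _ => integrable_finsetSum _ fun j _ => integrable_finsetSum _
    fun k _ => ((hI j k).const_mul _).mul_const _]
  refine Finset.sum_congr rfl fun i _ => ?_
  rw [integral_finsetSum _ fun j _ => integrable_finsetSum _
    fun k _ => ((hI j k).const_mul _).mul_const _]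
  refine Finset.sum_congr rfl fun j _ => ?_
  rw [integral_finsetSum _ fun k _ => ((hI j k).const_mul _).mul_const _]
  refine Finset.sum_congr rfl fun k _ => ?_
  rw [integral_mul_const, integral_const_mul]

end PosSemidef

/-! ### Small symmetric jumps -/

section SymJump

/-- Jumps `± r v_l` at rate `1 / (2 r²)` each; a jump approximation of the centred Gaussian law with
covariance `∑ v_l v_l'`. -/
def symJump (v : Fin d → Euc d) (r : ℝ) : Measure (Euc d) :=
  ∑ l, ENNReal.ofReal (1 / (2 * r ^ 2)) •
    (Measure.dirac (r • v l) + Measure.dirac (-(r • v l)))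

instance (v : Fin d → Euc d) (r : ℝ) : IsFiniteMeasure (symJump v r) := by
  unfold symJump
  have : ∀ l, IsFiniteMeasure (ENNReal.ofReal (1 / (2 * r ^ 2)) •
    (Measure.dirac (r • v l) + Measure.dirac (-(r • v l)))) := fun l =>
    Measure.smul_finite _ ENNReal.ofReal_ne_top
  infer_instance

variable {E : Type*} [NormedAddCommGroup E] (v : Fin d → Euc d) (r : ℝ)

lemma integrable_symJump (g : Euc d → E) : Integrable g (symJump v r) := by
  unfold symJump
  refine integrable_finsetSum_measure.mpr fun l _ => ?_
  exact ((integrable_dirac (by finiteness)).add_measure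
    (integrable_dirac (by finiteness))).smul_measure ENNReal.ofReal_ne_top

lemma integral_symJump [NormedSpace ℝ E] [CompleteSpace E] (g : Euc d → E) :
    ∫ x, g x ∂symJump v r =
      ∑ l, (1 / (2 * r ^ 2)) • (g (r • v l) + g (-(r • v l))) := by
  unfold symJump
  have hd : ∀ a : Euc d, Integrable g (Measure.dirac a) := fun a =>
    integrable_dirac (by finiteness)
  rw [integral_finsetSum_measure fun l _ =>
    ((hd _).add_measure (hd _)).smul_measure ENNReal.ofReal_ne_top]
  refine Finset.sum_congr rfl fun l _ => ?_
  rw [integral_smul_measure, integral_add_measure (hd _) (hd _), integral_dirac, integral_dirac,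
    ENNReal.toReal_ofReal (by positivity)]

/-- Opposite jumps cancel the odd part, leaving `(cos (r y) - 1) / r² → -y² / 2` in each direction
`v l`. -/
lemma tendsto_integral_exp_symJump {r : ℕ → ℝ} (hr : ∀ k, 0 < r k)
    (hr0 : Tendsto r atTop (𝓝 0)) (u : Euc d) :
    Tendsto (fun k => ∫ x, (Complex.exp (Complex.I * ((inner ℝ u x : ℝ) : ℂ)) - 1)
      ∂symJump v (r k)) atTop (𝓝 (-(1 / 2 : ℂ) * ((∑ l, (inner ℝ u (v l) : ℝ) ^ 2 : ℝ) : ℂ))) := by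
  simp only [integral_symJump]
  push_cast
  rw [Finset.mul_sum]
  refine tendsto_finsetSum _ fun l _ => ?_
  set y : ℝ := inner ℝ u (v l) with hy
  have hcos : ∀ k, (1 / (2 * r k ^ 2)) •
      ((Complex.exp (Complex.I * ((inner ℝ u (r k • v l) : ℝ) : ℂ)) - 1) +
      (Complex.exp (Complex.I * ((inner ℝ u (-(r k • v l)) : ℝ) : ℂ)) - 1)) =
      (((Real.cos (r k * y) - 1) / r k ^ 2 : ℝ) : ℂ) := by
    intro k
    have hrk : (r k : ℂ) ≠ 0 := by exact_mod_cast (hr k).ne'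
    rw [inner_neg_right, real_inner_smul_right, ← hy, Complex.real_smul]
    push_cast
    rw [Complex.cos]
    have e1 : Complex.I * -((r k : ℂ) * y) = -((r k : ℂ) * y) * Complex.I := by ring
    have e2 : Complex.I * ((r k : ℂ) * y) = ((r k : ℂ) * y) * Complex.I := by ring
    rw [e1, e2]
    field_simp
    ring
  simp only [hcos]
  have hreal : Tendsto (fun k => (Real.cos (r k * y) - 1) / r k ^ 2) atTop
      (𝓝 (-(1 / 2) * y ^ 2)) := by
    rw [tendsto_iff_norm_sub_tendsto_zero]
    -- The constant is that of the fourth-order remainder in `Real.cos_bound`.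
    have h0 : Tendsto (fun k => y ^ 4 * r k ^ 2 * (5 / 96)) atTop (𝓝 0) := by
      have := ((hr0.pow 2).const_mul (y ^ 4)).mul_const (5 / 96 : ℝ)
      simpa using this
    have hsmall : ∀ᶠ k in atTop, |r k * y| ≤ 1 := by
      have : Tendsto (fun k => |r k * y|) atTop (𝓝 0) := by
        simpa using (hr0.mul_const y).abs
      exact (this.eventually (gt_mem_nhds zero_lt_one)).mono fun _ h => h.le
    refine squeeze_zero' (Eventually.of_forall fun _ => norm_nonneg _) ?_ h0
    filter_upwards [hsmall] with k hk
    have hrk := hr k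
    have hb := Real.cos_bound hk
    have e : (Real.cos (r k * y) - 1) / r k ^ 2 - -(1 / 2) * y ^ 2 =
        (Real.cos (r k * y) - (1 - (r k * y) ^ 2 / 2)) / r k ^ 2 := by
      field_simp; ring
    rw [e, Real.norm_eq_abs, abs_div, abs_of_pos (pow_pos hrk 2), div_le_iff₀ (by positivity)]
    refine hb.trans (le_of_eq ?_)
    rw [show |r k * y| ^ 4 = (|r k * y| ^ 2) ^ 2 by ring, sq_abs]; ring
  have := (Complex.continuous_ofReal.tendsto _).comp hreal
  refine this.congr_dist ?_ |>.trans (le_of_eq ?_)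
  · simp
  · push_cast; rfl

end SymJump

/-! ### Lévy measures -/

section Levy

variable {ν : Measure (Euc d)}

lemma IsLevyMeasure.integrable_min (h : IsLevyMeasure ν) :
    Integrable (fun x : Euc d => min 1 (‖x‖ ^ 2)) ν := by
  refine ⟨by fun_prop, ?_⟩
  rw [hasFiniteIntegral_iff_ofReal (Eventually.of_forall fun x => by positivity)]
  exact h.2

lemma IsLevyMeasure.measure_norm_gt_lt_top (h : IsLevyMeasure ν) {r : ℝ} (hr : 0 < r) :
    ν {x | r < ‖x‖} < ⊤ := by
  have hm : 0 < min 1 (r ^ 2) := by positivity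
  refine lt_of_le_of_lt (measure_mono ?_) (h.integrable_min.measure_ge_lt_top hm)
  intro x hx
  have hx' : r < ‖x‖ := hx
  exact min_le_min le_rfl (pow_le_pow_left₀ hr.le hx'.le 2)

lemma IsLevyMeasure.integrableOn_sq (h : IsLevyMeasure ν) :
    IntegrableOn (fun x : Euc d => ‖x‖ ^ 2) {x | ‖x‖ ≤ 1} ν := by
  refine (h.integrable_min.integrableOn (s := {x | ‖x‖ ≤ 1})).congr_fun (fun x hx => ?_)
    (measurableSet_le measurable_norm measurable_const)
  have hx' : ‖x‖ ≤ 1 := hx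
  exact min_eq_right (by nlinarith [norm_nonneg x])

/-- The integrand of the Lévy-Khintchine formula. -/
def levyIntegrand (u x : Euc d) : ℂ :=
  Complex.exp (Complex.I * ((inner ℝ u x : ℝ) : ℂ)) - 1 -
      Complex.I * ((inner ℝ u x : ℝ) : ℂ) *
        (Metric.closedBall (0 : Euc d) 1).indicator (fun _ => (1 : ℂ)) x

lemma norm_levyIntegrand_le (u x : Euc d) :
    ‖levyIntegrand u x‖ ≤ (2 + 2 * ‖u‖ ^ 2) * min 1 (‖x‖ ^ 2) := by
  unfold levyIntegrand
  by_cases hx : ‖x‖ ≤ 1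
  · have hx' : x ∈ Metric.closedBall (0 : Euc d) 1 := by simpa using hx
    rw [Set.indicator_of_mem hx', mul_one, min_eq_right (by nlinarith [norm_nonneg x])]
    refine (norm_exp_I_mul_sub_one_sub_le _).trans ?_
    have h := abs_real_inner_le_norm u x
    rw [← sq_abs]
    have h2 : |(inner ℝ u x : ℝ)| ^ 2 ≤ (‖u‖ * ‖x‖) ^ 2 := pow_le_pow_left₀ (abs_nonneg _) h 2
    nlinarith [sq_nonneg ‖x‖]
  · have hx' : x ∉ Metric.closedBall (0 : Euc d) 1 := by simpa using hx
    push Not at hx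
    rw [Set.indicator_of_notMem hx', mul_zero, sub_zero, min_eq_left (by nlinarith), mul_one]
    exact (norm_exp_I_mul_sub_one_le_two _).trans (by nlinarith [sq_nonneg ‖u‖])

lemma measurable_levyIntegrand (u : Euc d) : Measurable (levyIntegrand u) := by
  unfold levyIntegrand
  have : Measurable ((Metric.closedBall (0 : Euc d) 1).indicator (fun _ => (1 : ℂ))) :=
    measurable_const.indicator Metric.isClosed_closedBall.measurableSet
  fun_prop

lemma IsLevyMeasure.integrable_levyIntegrand (h : IsLevyMeasure ν) (u : Euc d) :
    Integrable (levyIntegrand u) ν :=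
  (h.integrable_min.const_mul (2 + 2 * ‖u‖ ^ 2)).mono'
    (measurable_levyIntegrand u).aestronglyMeasurable
    (Eventually.of_forall (norm_levyIntegrand_le u))

lemma measurableSet_norm_gt (r : ℝ) : MeasurableSet {x : Euc d | r < ‖x‖} :=
  measurableSet_lt measurable_const measurable_norm

lemma measurableSet_norm_le (r : ℝ) : MeasurableSet {x : Euc d | ‖x‖ ≤ r} :=
  measurableSet_le measurable_norm measurable_const

/-- Dominated convergence. The origin need not enter the regions, and `g 0 = 0` makes this harmless
without any statement about `ν {0}`. -/
lemma tendsto_setIntegral_norm_gt {E : Type*} [NormedAddCommGroup E] [NormedSpace ℝ E]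
    {g : Euc d → E} (hg : Integrable g ν) (hg0 : g 0 = 0) {r : ℕ → ℝ}
    (hr0 : Tendsto r atTop (𝓝 0)) :
    Tendsto (fun k => ∫ x in {x | r k < ‖x‖}, g x ∂ν) atTop (𝓝 (∫ x, g x ∂ν)) := by
  simp only [← integral_indicator (measurableSet_norm_gt _)]
  refine tendsto_integral_of_dominated_convergence (fun x => ‖g x‖)
    (fun k => hg.1.indicator (measurableSet_norm_gt _)) hg.norm
    (fun k => Eventually.of_forall fun x => norm_indicator_le_norm_self _ _)
    (Eventually.of_forall fun x => ?_)
  by_cases hx : x = 0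
  · subst hx
    have : ∀ k, {x : Euc d | r k < ‖x‖}.indicator g 0 = 0 := fun k => by
      by_cases h0 : (0 : Euc d) ∈ {x : Euc d | r k < ‖x‖} <;> simp [h0, hg0]
    simp [this, hg0]
  · refine tendsto_const_nhds.congr' ?_
    filter_upwards [hr0.eventually (gt_mem_nhds (norm_pos_iff.mpr hx))] with k hk
    exact (Set.indicator_of_mem (s := {x : Euc d | r k < ‖x‖}) hk g).symm

/-- The jumps of size larger than `r`, together with small jumps replacing the Gaussian part. -/
def jumpApprox (ν : Measure (Euc d)) (v : Fin d → Euc d) (r : ℝ) : Measure (Euc d) :=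
  ν.restrict {x | r < ‖x‖} + symJump v r

/-- The drift compensating the jumps of size in `(r, 1]`. -/
def driftApprox (γ : Euc d) (ν : Measure (Euc d)) (r : ℝ) : Euc d :=
  γ - ∫ x in {x | r < ‖x‖ ∧ ‖x‖ ≤ 1}, x ∂ν

lemma IsLevyMeasure.isFiniteMeasure_jumpApprox (h : IsLevyMeasure ν) (v : Fin d → Euc d) {r : ℝ}
    (hr : 0 < r) : IsFiniteMeasure (jumpApprox ν v r) := by
  have : IsFiniteMeasure (ν.restrict {x | r < ‖x‖}) :=
    ⟨by rw [Measure.restrict_apply_univ]; exact h.measure_norm_gt_lt_top hr⟩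
  unfold jumpApprox
  infer_instance

lemma IsLevyMeasure.integrableOn_annulus (h : IsLevyMeasure ν) {r : ℝ} (hr : 0 < r) :
    IntegrableOn (fun x : Euc d => x) {x | r < ‖x‖ ∧ ‖x‖ ≤ 1} ν := by
  have hfin : ν {x | r < ‖x‖ ∧ ‖x‖ ≤ 1} < ⊤ :=
    lt_of_le_of_lt (measure_mono fun x hx => hx.1) (h.measure_norm_gt_lt_top hr)
  refine IntegrableOn.of_bound hfin (by fun_prop) 1 ?_
  exact (ae_restrict_iff' ((measurableSet_norm_gt r).inter (measurableSet_norm_le 1))).mpr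
    (Eventually.of_forall fun x hx => hx.2)

lemma integral_jumpApprox {E : Type*} [NormedAddCommGroup E] [NormedSpace ℝ E] [CompleteSpace E]
    (v : Fin d → Euc d) {r : ℝ} {D : Set (Euc d)} (hD : MeasurableSet D) {g : Euc d → E}
    (hg : IntegrableOn g (D ∩ {x | r < ‖x‖}) ν) :
    ∫ x in D, g x ∂jumpApprox ν v r = (∫ x in D ∩ {x | r < ‖x‖}, g x ∂ν) +
      ∑ l, (1 / (2 * r ^ 2)) • (D.indicator g (r • v l) + D.indicator g (-(r • v l))) := by
  rw [jumpApprox, Measure.restrict_add, Measure.restrict_restrict hD, integral_add_measure hg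
    (integrable_symJump v r g).integrableOn, ← integral_symJump, integral_indicator hD]

lemma integrableOn_jumpApprox {E : Type*} [NormedAddCommGroup E]
    (v : Fin d → Euc d) {r : ℝ} {D : Set (Euc d)} (hD : MeasurableSet D) {g : Euc d → E}
    (hg : IntegrableOn g (D ∩ {x | r < ‖x‖}) ν) : IntegrableOn g D (jumpApprox ν v r) := by
  rw [IntegrableOn, jumpApprox, Measure.restrict_add, Measure.restrict_restrict hD]
  exact Integrable.add_measure hg (integrable_symJump v r g).integrableOn

/-- Away from the origin `ν` is finite, so the compensator `i⟨u, x⟩` on `‖x‖ ≤ 1` can be integrated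
separately. It is exactly what `driftApprox` subtracts from `γ`; the truncated exponent plus
symmetric atoms is then of compound Poisson type. -/
lemma tendsto_exponent_jumpApprox (hν : IsLevyMeasure ν) {Sig : Matrix (Fin d) (Fin d) ℝ}
    {v : Fin d → Euc d} (hv : ∀ i j, Sig i j = ∑ l, v l i * v l j) (γ : Euc d) {r : ℕ → ℝ}
    (hr : ∀ k, 0 < r k) (hr0 : Tendsto r atTop (𝓝 0)) (u : Euc d) :
    Tendsto (fun k => Complex.I * ((inner ℝ (driftApprox γ ν (r k)) u : ℝ) : ℂ) +
      ∫ x, (Complex.exp (Complex.I * ((inner ℝ u x : ℝ) : ℂ)) - 1) ∂jumpApprox ν v (r k)) atTop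
      (𝓝 (cumulant γ Sig ν u)) := by
  have hlev := tendsto_setIntegral_norm_gt (hν.integrable_levyIntegrand u)
    (by simp [levyIntegrand]) hr0
  have hgau := tendsto_integral_exp_symJump v hr hr0 u
  have hsum := (hlev.add hgau).const_add (Complex.I * ((inner ℝ γ u : ℝ) : ℂ))
  have hlim : Complex.I * ((inner ℝ γ u : ℝ) : ℂ) + (∫ x, levyIntegrand u x ∂ν +
      -(1 / 2 : ℂ) * ((∑ l, (inner ℝ u (v l) : ℝ) ^ 2 : ℝ) : ℂ)) = cumulant γ Sig ν u := by
    rw [cumulant, inner_act_eq_sum_sq hv]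
    simp only [levyIntegrand]
    ring
  rw [hlim] at hsum
  refine hsum.congr fun k => ?_
  have hfin : IsFiniteMeasure (ν.restrict {x | r k < ‖x‖}) :=
    ⟨by rw [Measure.restrict_apply_univ]; exact hν.measure_norm_gt_lt_top (hr k)⟩
  have hE : Integrable (fun x : Euc d => Complex.exp (Complex.I * ((inner ℝ u x : ℝ) : ℂ)) - 1)
      (ν.restrict {x | r k < ‖x‖}) :=
    Integrable.of_bound (by fun_prop) 2
      (Eventually.of_forall fun x => norm_exp_I_mul_sub_one_le_two _)
  rw [jumpApprox, integral_add_measure hE (integrable_symJump v _ _)]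
  have hA := hν.integrableOn_annulus (hr k)
  have hdrift : Complex.I * ((inner ℝ (driftApprox γ ν (r k)) u : ℝ) : ℂ) =
      Complex.I * ((inner ℝ γ u : ℝ) : ℂ) - ∫ x in {x | r k < ‖x‖},
        Complex.I * ((inner ℝ u x : ℝ) : ℂ) *
          (Metric.closedBall (0 : Euc d) 1).indicator (fun _ => (1 : ℂ)) x ∂ν := by
    have h1 : (inner ℝ (∫ x in {x | r k < ‖x‖ ∧ ‖x‖ ≤ 1}, x ∂ν) u : ℝ) =
        ∫ x in {x | r k < ‖x‖ ∧ ‖x‖ ≤ 1}, (inner ℝ u x : ℝ) ∂ν := by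
      rw [real_inner_comm, ← integral_inner hA]
    have h2 : ∫ x in {x | r k < ‖x‖}, Complex.I * ((inner ℝ u x : ℝ) : ℂ) *
          (Metric.closedBall (0 : Euc d) 1).indicator (fun _ => (1 : ℂ)) x ∂ν =
        ∫ x in {x | r k < ‖x‖ ∧ ‖x‖ ≤ 1}, Complex.I * ((inner ℝ u x : ℝ) : ℂ) ∂ν := by
      have : ∀ x : Euc d, Complex.I * ((inner ℝ u x : ℝ) : ℂ) *
          (Metric.closedBall (0 : Euc d) 1).indicator (fun _ => (1 : ℂ)) x =
          {x : Euc d | ‖x‖ ≤ 1}.indicator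
            (fun x => Complex.I * ((inner ℝ u x : ℝ) : ℂ)) x := by
        intro x
        by_cases hx : ‖x‖ ≤ 1 <;> simp [hx]
      simp only [this]
      rw [setIntegral_indicator (measurableSet_norm_le 1)]
      rfl
    rw [h2, driftApprox, inner_sub_left, h1, integral_const_mul, integral_complex_ofReal]
    push_cast; ring
  have hI : Integrable (fun x : Euc d => Complex.I * ((inner ℝ u x : ℝ) : ℂ) *
          (Metric.closedBall (0 : Euc d) 1).indicator (fun _ => (1 : ℂ)) x)
      (ν.restrict {x | r k < ‖x‖}) := by
    have := hE.sub ((hν.integrable_levyIntegrand u).integrableOn (s := {x | r k < ‖x‖}))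
    refine this.congr (Eventually.of_forall fun x => ?_)
    simp [levyIntegrand]
  rw [hdrift]
  have hsplit : ∫ x in {x | r k < ‖x‖}, levyIntegrand u x ∂ν =
      (∫ x in {x | r k < ‖x‖}, (Complex.exp (Complex.I * ((inner ℝ u x : ℝ) : ℂ)) - 1) ∂ν) -
      ∫ x in {x | r k < ‖x‖}, Complex.I * ((inner ℝ u x : ℝ) : ℂ) *
          (Metric.closedBall (0 : Euc d) 1).indicator (fun _ => (1 : ℂ)) x ∂ν :=
    integral_sub hE hI
  rw [hsplit]
  ring

end Levy

end MMAF

end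

noncomputable section

namespace MMAF

variable {n d : ℕ} {ν : Measure (Euc d)} {γ : Euc d} {Sig : Matrix (Fin d) (Fin d) ℝ}

/-! ### Split approximations for the three decompositions of the jumps -/

/-- The index is shifted by a bound for `∑ ‖v l‖` so that the atoms replacing the Gaussian part lie
in the unit ball from the start. In regime (iv) they must fall on the square integrable side. -/
lemma exists_small_radii (v : Fin d → Euc d) :
    ∃ r : ℕ → ℝ, (∀ k, 0 < r k) ∧ (∀ k, r k ≤ 1) ∧ Tendsto r atTop (𝓝 0) ∧
      ∀ k l, ‖r k • v l‖ ≤ 1 := by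
  obtain ⟨K, hK⟩ := exists_nat_ge (∑ l, ‖v l‖)
  refine ⟨fun k => 1 / (((k + K : ℕ) : ℝ) + 1), fun k => by positivity, fun k => ?_, ?_,
    fun k l => ?_⟩
  · rw [div_le_one (by positivity)]
    have : (0 : ℝ) ≤ ((k + K : ℕ) : ℝ) := Nat.cast_nonneg _
    linarith
  · exact (tendsto_one_div_add_atTop_nhds_zero_nat (𝕜 := ℝ)).comp (tendsto_add_atTop_nat K)
  · rw [norm_smul, Real.norm_of_nonneg (by positivity), div_mul_eq_mul_div, one_mul,
      div_le_one (by positivity)]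
    have h1 : ‖v l‖ ≤ ∑ l, ‖v l‖ :=
      Finset.single_le_sum (f := fun l => ‖v l‖) (fun _ _ => norm_nonneg _) (Finset.mem_univ l)
    push_cast
    have : (0 : ℝ) ≤ k := Nat.cast_nonneg _
    linarith

lemma IsLevyMeasure.integrableOn_sq_gt (h : IsLevyMeasure ν)
    (h2 : IntegrableOn (fun x => ‖x‖ ^ 2) {x | 1 < ‖x‖} ν) :
    Integrable (fun x : Euc d => ‖x‖ ^ 2) ν := by
  rw [← integrableOn_univ]
  have : (Set.univ : Set (Euc d)) = {x | ‖x‖ ≤ 1} ∪ {x | 1 < ‖x‖} := by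
    ext x; simp [le_or_gt]
  rw [this]
  exact h.integrableOn_sq.union h2

lemma IsLevyMeasure.integrableOn_gt_of_large (h : IsLevyMeasure ν) {r : ℝ} (hr : 0 < r)
    (h1 : IntegrableOn (fun x => ‖x‖) {x | 1 < ‖x‖} ν) :
    IntegrableOn (fun x : Euc d => x) {x | r < ‖x‖} ν := by
  have hL : IntegrableOn (fun x : Euc d => x) {x | 1 < ‖x‖} ν :=
    (integrable_norm_iff (by fun_prop)).mp h1
  refine ((h.integrableOn_annulus hr).union hL).mono_set fun x hx => ?_
  rcases le_or_gt ‖x‖ 1 with h' | h'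
  · exact Or.inl ⟨hx, h'⟩
  · exact Or.inr h'

lemma integrableOn_norm_gt_of_sq
    (h2 : IntegrableOn (fun x => ‖x‖ ^ 2) {x | 1 < ‖x‖} ν) :
    IntegrableOn (fun x : Euc d => ‖x‖) {x | 1 < ‖x‖} ν := by
  refine Integrable.mono' h2 (by fun_prop) ?_
  refine (ae_restrict_iff' (measurableSet_norm_gt 1)).mpr (Eventually.of_forall fun x hx => ?_)
  have hx' : 1 < ‖x‖ := hx
  rw [norm_norm]; nlinarith

lemma integrable_norm_act_sq {D : Set (Euc d)} (h2 : IntegrableOn (fun x => ‖x‖ ^ 2) D ν)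
    (T : Matrix (Fin n) (Fin d) ℝ) : IntegrableOn (fun x => ‖act T x‖ ^ 2) D ν := by
  refine Integrable.mono' (h2.const_mul (frob T ^ 2))
    (by
      have : Continuous fun x => ‖act T x‖ ^ 2 := by fun_prop
      exact this.aestronglyMeasurable) (Eventually.of_forall fun x => ?_)
  rw [Real.norm_of_nonneg (by positivity)]
  exact norm_act_sq_le T x

lemma memLp_two_jumpApprox (v : Fin d → Euc d) {r : ℝ} {D : Set (Euc d)} (hD : MeasurableSet D)
    (h2 : IntegrableOn (fun x => ‖x‖ ^ 2) D ν) :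
    MemLp id 2 ((jumpApprox ν v r).restrict D) := by
  rw [memLp_two_iff_integrable_sq_norm (by fun_prop)]
  exact integrableOn_jumpApprox v hD (h2.mono_set Set.inter_subset_left)

/-- The pair `± r v_l` has total rate `1 / r²` and squared size `r² ‖T v_l‖²`, so its contribution
does not depend on `r`. Atoms outside `D` and the jumps of norm at most `r` can only lower the
integral. -/
lemma setIntegral_norm_act_sq_jumpApprox_le {v : Fin d → Euc d}
    (hv : ∀ i j, Sig i j = ∑ l, v l i * v l j) {r : ℝ} (hr : 0 < r) {D : Set (Euc d)}
    (hD : MeasurableSet D) (h2 : IntegrableOn (fun x => ‖x‖ ^ 2) D ν)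
    (T : Matrix (Fin n) (Fin d) ℝ) :
    ∫ x in D, ‖act T x‖ ^ 2 ∂jumpApprox ν v r ≤
      (T * (Sig + secondMoment ν D) * T.transpose).trace := by
  have hI := integrable_norm_act_sq h2 T
  rw [integral_jumpApprox v hD (hI.mono_set Set.inter_subset_left), Matrix.mul_add, Matrix.add_mul,
    Matrix.trace_add, trace_eq_sum_norm_sq hv, trace_secondMoment h2, add_comm]
  refine add_le_add (Finset.sum_le_sum fun l _ => ?_) ?_
  · have hle : ∀ x, D.indicator (fun x => ‖act T x‖ ^ 2) x ≤ ‖act T x‖ ^ 2 := fun x =>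
      Set.indicator_le_self' (fun _ _ => by positivity) x
    have hneg : act T (-(r • v l)) = -act T (r • v l) := (actL T).map_neg _
    have e : ‖act T (r • v l)‖ ^ 2 = r ^ 2 * ‖act T (v l)‖ ^ 2 := by
      rw [act_smul, norm_smul, mul_pow, Real.norm_eq_abs, sq_abs]
    have h1 := hle (r • v l)
    have h3 := hle (-(r • v l))
    rw [hneg, norm_neg, e] at h3
    rw [e] at h1
    rw [smul_eq_mul, one_div_mul_eq_div, div_le_iff₀ (by positivity)]
    linarith
  · exact setIntegral_mono_set hI (Eventually.of_forall fun _ => by positivity)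
      (Eventually.of_forall Set.inter_subset_left)

/-- All jumps belong to the square integrable part. -/
lemma splitApprox_of_sq_integrable (hν : IsLevyMeasure ν) (hSig : Sig.PosSemidef)
    (h2 : IntegrableOn (fun x => ‖x‖ ^ 2) {x | 1 < ‖x‖} ν) :
    SplitApprox (n := n) (cumulant γ Sig ν)
      (fun T => (T * (Sig + secondMoment ν Set.univ) * T.transpose).trace) (fun _ => 0)
      (γ + ∫ x in {x | 1 < ‖x‖}, x ∂ν) := by
  obtain ⟨v, hv⟩ := exists_rank_one_decomposition hSig
  obtain ⟨r, hr, hr1, hr0, -⟩ := exists_small_radii v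
  have hsq : IntegrableOn (fun x : Euc d => ‖x‖ ^ 2) Set.univ ν :=
    (hν.integrableOn_sq_gt h2).integrableOn
  have h1 := integrableOn_norm_gt_of_sq h2
  refine splitApprox_of_jumps (ρ := fun k => jumpApprox ν v (r k))
    (fun k => hν.isFiniteMeasure_jumpApprox v (hr k)) MeasurableSet.univ
    (b₁ := fun k => driftApprox γ ν (r k)) (b₂ := fun _ => 0) (κ' := fun _ _ => 0) ?_
    (fun k => memLp_two_jumpApprox v MeasurableSet.univ hsq) (fun k => ?_)
    (fun k T => setIntegral_norm_act_sq_jumpApprox_le hv (hr k) MeasurableSet.univ hsq T)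
    (by simp) (by simp) (by simp)
  · simpa using tendsto_exponent_jumpApprox hν hv γ hr hr0
  -- In the mean the compensated jumps with `r < ‖x‖ ≤ 1` cancel against the drift and the symmetric
  -- atoms cancel in pairs, so the mean is the same for all `k`.
  · have hI := hν.integrableOn_gt_of_large (hr k) h1
    have hd : Disjoint {x : Euc d | r k < ‖x‖ ∧ ‖x‖ ≤ 1} {x | 1 < ‖x‖} :=
      Set.disjoint_left.mpr fun x hx hx' => not_le.mpr hx' hx.2
    have hun : {x : Euc d | r k < ‖x‖} = {x | r k < ‖x‖ ∧ ‖x‖ ≤ 1} ∪ {x | 1 < ‖x‖} := by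
      ext x
      constructor
      · intro hx
        rcases le_or_gt ‖x‖ 1 with h' | h'
        · exact Or.inl ⟨hx, h'⟩
        · exact Or.inr h'
      · rintro (hx | hx)
        · exact hx.1
        · exact lt_of_le_of_lt (hr1 k) hx
    rw [integral_jumpApprox v MeasurableSet.univ (by simpa using hI), Set.univ_inter, hun,
      setIntegral_union hd (measurableSet_norm_gt 1) (hI.mono_set (by rw [hun]; exact
        Set.subset_union_left)) (hI.mono_set (by rw [hun]; exact Set.subset_union_right)),
      driftApprox]
    simp only [Set.indicator_univ, add_neg_cancel, smul_zero, Finset.sum_const_zero, add_zero]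
    abel

/-- Jumps of size at most `1` belong to the square integrable part, the others to the integrable
part. -/
lemma splitApprox_of_integrable_large (hν : IsLevyMeasure ν) (hSig : Sig.PosSemidef)
    (h1 : IntegrableOn (fun x => ‖x‖) {x | 1 < ‖x‖} ν) :
    SplitApprox (n := n) (cumulant γ Sig ν)
      (fun T => (T * (Sig + secondMoment ν {x | ‖x‖ ≤ 1}) * T.transpose).trace)
      (fun T => ∫ x in {x | 1 < ‖x‖}, ‖act T x‖ ∂ν) γ := by
  obtain ⟨v, hv⟩ := exists_rank_one_decomposition hSig
  obtain ⟨r, hr, hr1, hr0, hrv⟩ := exists_small_radii v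
  have hD := measurableSet_norm_le (d := d) 1
  have hc : ({x : Euc d | ‖x‖ ≤ 1})ᶜ = {x | 1 < ‖x‖} := by ext x; simp
  have hLs : ∀ k, {x : Euc d | 1 < ‖x‖} ∩ {x | r k < ‖x‖} = {x | 1 < ‖x‖} := fun k =>
    Set.inter_eq_left.mpr fun x hx => lt_of_le_of_lt (hr1 k) hx
  refine splitApprox_of_jumps (ρ := fun k => jumpApprox ν v (r k))
    (fun k => hν.isFiniteMeasure_jumpApprox v (hr k)) hD
    (b₁ := fun k => driftApprox γ ν (r k)) (b₂ := fun _ => 0)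
    (κ' := fun _ T => ∫ x in {x | 1 < ‖x‖}, ‖act T x‖ ∂ν) ?_
    (fun k => memLp_two_jumpApprox v hD hν.integrableOn_sq) (fun k => ?_)
    (fun k T => setIntegral_norm_act_sq_jumpApprox_le hv (hr k) hD hν.integrableOn_sq T)
    (fun k => ?_) (fun k T => ?_) (fun T => tendsto_const_nhds)
  · simpa using tendsto_exponent_jumpApprox hν hv γ hr hr0
  -- Only jumps of norm at most 1 count here, so the annulus integral cancels the compensator and
  -- exactly `γ` is left.
  · have hs : {x : Euc d | ‖x‖ ≤ 1} ∩ {x | r k < ‖x‖} = {x | r k < ‖x‖ ∧ ‖x‖ ≤ 1} := by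
      ext x; simp [and_comm]
    rw [integral_jumpApprox v hD (by rw [hs]; exact hν.integrableOn_annulus (hr k)), hs,
      driftApprox]
    have : ∀ l, {x : Euc d | ‖x‖ ≤ 1}.indicator (fun x => x) (r k • v l) +
        {x : Euc d | ‖x‖ ≤ 1}.indicator (fun x => x) (-(r k • v l)) = 0 := fun l => by
      have h1 : r k • v l ∈ {x : Euc d | ‖x‖ ≤ 1} := hrv k l
      have h2 : -(r k • v l) ∈ {x : Euc d | ‖x‖ ≤ 1} := by
        simpa only [Set.mem_ofPred_eq, norm_neg] using hrv k l
      rw [Set.indicator_of_mem h1, Set.indicator_of_mem h2, add_neg_cancel]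
    simp only [this, smul_zero, Finset.sum_const_zero]
    abel
  · rw [hc]
    refine integrableOn_jumpApprox v (measurableSet_norm_gt 1) ?_
    rw [hLs]; exact (integrable_norm_iff (by fun_prop)).mp h1
  · have hI : IntegrableOn (fun x => ‖act T x‖) {x | 1 < ‖x‖} ν :=
      ((actL T).integrable_comp ((integrable_norm_iff (by fun_prop)).mp h1)).norm
    rw [act_zero, norm_zero, zero_add, hc, integral_jumpApprox v (measurableSet_norm_gt 1)
      (by rw [hLs]; exact hI), hLs]
    have : ∀ l, {x : Euc d | 1 < ‖x‖}.indicator (fun x => ‖act T x‖) (r k • v l) +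
        {x : Euc d | 1 < ‖x‖}.indicator (fun x => ‖act T x‖) (-(r k • v l)) = 0 := fun l => by
      have h1 : r k • v l ∉ {x : Euc d | 1 < ‖x‖} := not_lt.mpr (hrv k l)
      have h2 : -(r k • v l) ∉ {x : Euc d | 1 < ‖x‖} := by
        simpa only [Set.mem_ofPred_eq, norm_neg, not_lt] using hrv k l
      rw [Set.indicator_of_notMem h1, Set.indicator_of_notMem h2, add_zero]
    simp [this]

/-- All jumps belong to the integrable part. -/
lemma splitApprox_of_integrable (hν : IsLevyMeasure ν) (h1 : Integrable (fun x => ‖x‖) ν) :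
    SplitApprox (n := n) (cumulant γ 0 ν) (fun _ => 0)
      (fun T => ‖act T (γ - ∫ x in {x | ‖x‖ ≤ 1}, x ∂ν)‖ + ∫ x, ‖act T x‖ ∂ν) 0 := by
  have hv : ∀ i j, (0 : Matrix (Fin d) (Fin d) ℝ) i j =
      ∑ l : Fin d, (fun _ => 0 : Fin d → Euc d) l i * (fun _ => 0 : Fin d → Euc d) l j := by
    simp
  obtain ⟨r, hr, hr1, hr0, -⟩ := exists_small_radii (fun _ => 0 : Fin d → Euc d)
  have hI : Integrable (fun x : Euc d => x) ν := (integrable_norm_iff (by fun_prop)).mp h1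
  -- With `D = ∅` the drift also sits in the integrable part. It tends to `γ₀` only as `k → ∞`,
  -- which is why the first-moment bounds `κ'` are allowed to vary along the sequence.
  refine splitApprox_of_jumps (ρ := fun k => jumpApprox ν (fun _ => 0) (r k))
    (fun k => hν.isFiniteMeasure_jumpApprox _ (hr k)) MeasurableSet.empty
    (b₁ := fun _ => 0) (b₂ := fun k => driftApprox γ ν (r k))
    (κ' := fun k T => ‖act T (driftApprox γ ν (r k))‖ + ∫ x, ‖act T x‖ ∂ν) ?_
    (by simp) (by simp) (by simp) (fun k => ?_) (fun k T => ?_) (fun T => ?_)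
  · simpa using tendsto_exponent_jumpApprox hν hv γ hr hr0
  · rw [Set.compl_empty]
    exact integrableOn_jumpApprox _ MeasurableSet.univ hI.integrableOn
  · have hT : Integrable (fun x => ‖act T x‖) ν := ((actL T).integrable_comp hI).norm
    rw [Set.compl_empty, integral_jumpApprox _ MeasurableSet.univ hT.integrableOn]
    simp only [smul_zero, neg_zero, Set.indicator_univ, act_zero, norm_zero, add_zero,
      Finset.sum_const_zero]
    exact add_le_add le_rfl
      (setIntegral_le_integral hT (Eventually.of_forall fun _ => norm_nonneg _))
  · refine Tendsto.add_const _ (Tendsto.norm (((continuous_act_right T).tendsto _).comp ?_))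
    have hg : Integrable ({x : Euc d | ‖x‖ ≤ 1}.indicator fun x => x) ν :=
      hI.indicator (measurableSet_norm_le 1)
    have := tendsto_setIntegral_norm_gt hg (by simp) hr0
    rw [integral_indicator (measurableSet_norm_le 1)] at this
    refine (this.const_sub γ).congr fun k => ?_
    rw [driftApprox, setIntegral_indicator (measurableSet_norm_le 1)]
    rfl

end MMAF

end

noncomputable section

namespace MMAF

/-! ### Linear functionals of finitely many independent infinitely divisible vectors -/

section SplitProduct

variable {n d : ℕ} {J : Type*} [Fintype J] {Q : J → Measure (Euc d × Euc d)}
  [∀ j, IsProbabilityMeasure (Q j)] {c : J → ℝ} {μ : Euc d}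
  {τ κ : Matrix (Fin n) (Fin d) ℝ → ℝ}

lemma memLp_sum_fst (h2 : ∀ j, MemLp Prod.fst 2 (Q j)) (β : J → Matrix (Fin n) (Fin d) ℝ) :
    MemLp (fun ω => ∑ j, act (β j) (ω j).1) 2 (Measure.pi Q) :=
  memLp_finsetSum _ fun j _ =>
    ((actL (β j)).comp_memLp' (h2 j)).comp_measurePreserving (measurePreserving_eval Q j)

/-- Variances add over independent vectors while the mean enters through the norm of its total, so
cancellation between the `act (β j) μ` is kept. This gives the squared norm of an integral in (ii)
and (iv). -/
lemma sqrt_integral_sum_fst_le (h2 : ∀ j, MemLp Prod.fst 2 (Q j))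
    (hμ : ∀ j, ∫ p, p.1 ∂Q j = c j • μ)
    (hτ : ∀ j T, ∫ p, ‖act T (p.1 - c j • μ)‖ ^ 2 ∂Q j ≤ c j * τ T)
    (β : J → Matrix (Fin n) (Fin d) ℝ) :
    Real.sqrt (∫ ω, ‖∑ j, act (β j) (ω j).1‖ ^ 2 ∂Measure.pi Q) ≤
      Real.sqrt (∑ j, c j * τ (β j) + ‖∑ j, c j • act (β j) μ‖ ^ 2) := by
  refine Real.sqrt_le_sqrt ?_
  have hV : ∀ j, MemLp (fun p : Euc d × Euc d => act (β j) p.1) 2 (Q j) := fun j =>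
    (actL (β j)).comp_memLp' (h2 j)
  have hm : ∀ j, ∫ p, act (β j) p.1 ∂Q j = c j • act (β j) μ := fun j => by
    have := (actL (β j)).integral_comp_comm ((h2 j).integrable one_le_two)
    simp only [actL_apply] at this
    rw [this, hμ, act_smul]
  rw [integral_norm_sum_sq_pi (V := fun j (p : Euc d × Euc d) => act (β j) p.1) hV]
  simp only [hm]
  rw [add_comm]
  refine add_le_add (Finset.sum_le_sum fun j _ => ?_) le_rfl
  simpa only [act_sub, act_smul] using hτ j (β j)

lemma integrable_sum_snd (h1 : ∀ j, Integrable Prod.snd (Q j))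
    (β : J → Matrix (Fin n) (Fin d) ℝ) :
    Integrable (fun ω => ∑ j, act (β j) (ω j).2) (Measure.pi Q) :=
  integrable_finsetSum _ fun j _ =>
    (measurePreserving_eval Q j).integrable_comp_of_integrable ((actL (β j)).integrable_comp (h1 j))

lemma integral_norm_sum_snd_le (h1 : ∀ j, Integrable Prod.snd (Q j))
    {κ' : J → Matrix (Fin n) (Fin d) ℝ → ℝ}
    (hκ : ∀ j T, ∫ p, ‖act T p.2‖ ∂Q j ≤ c j * κ' j T) (β : J → Matrix (Fin n) (Fin d) ℝ) :
    ∫ ω, ‖∑ j, act (β j) (ω j).2‖ ∂Measure.pi Q ≤ ∑ j, c j * κ' j (β j) := by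
  have hi : ∀ j, Integrable (fun p : Euc d × Euc d => act (β j) p.2) (Q j) := fun j =>
    (actL (β j)).integrable_comp (h1 j)
  have hi' : ∀ j, Integrable (fun ω : J → Euc d × Euc d => ‖act (β j) (ω j).2‖) (Measure.pi Q) :=
    fun j => (measurePreserving_eval Q j).integrable_comp_of_integrable (hi j).norm
  calc _ ≤ ∫ ω, ∑ j, ‖act (β j) (ω j).2‖ ∂Measure.pi Q :=
        integral_mono_of_nonneg (Eventually.of_forall fun _ => norm_nonneg _)
          (integrable_finsetSum _ fun j _ => hi' j)
          (Eventually.of_forall fun ω => norm_sum_le _ _)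
    _ = ∑ j, ∫ p, ‖act (β j) p.2‖ ∂Q j := by
        rw [integral_finsetSum _ fun j _ => hi' j]
        exact Finset.sum_congr rfl fun j _ =>
          integral_eval_pi (Q := Q) j (g := fun p : Euc d × Euc d => ‖act (β j) p.2‖)
            (hi j).1.norm
    _ ≤ _ := Finset.sum_le_sum fun j _ => hκ j (β j)

/-- The indices used by some `α a` form a block `S`; every `α' b` vanishes on it. The two families
are therefore functions of complementary blocks of independent coordinates. -/
lemma indepFun_sum_of_disjoint {u v : ℕ} {α : Fin u → J → Matrix (Fin n) (Fin d) ℝ}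
    {α' : Fin v → J → Matrix (Fin n) (Fin d) ℝ} (hdisj : ∀ a b j, α a j = 0 ∨ α' b j = 0) :
    IndepFun (fun (ω : J → Euc d × Euc d) a => ∑ j, act (α a j) ((ω j).1 + (ω j).2))
      (fun (ω : J → Euc d × Euc d) b => ∑ j, act (α' b j) ((ω j).1 + (ω j).2))
      (Measure.pi Q) := by
  classical
  set S : Finset J := Finset.univ.filter fun j => ∃ a, α a j ≠ 0 with hS
  have hi : iIndepFun (fun j (ω : J → Euc d × Euc d) => ω j) (Measure.pi Q) :=
    iIndepFun_pi (X := fun _ => id) fun _ => aemeasurable_id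
  have h := iIndepFun.indepFun_finset S Sᶜ disjoint_compl_right hi
    (fun j => measurable_pi_apply j)
  have hm : ∀ (s : Finset J) (k : ℕ) (θ : Fin k → J → Matrix (Fin n) (Fin d) ℝ),
      Measurable fun (x : s → Euc d × Euc d) (a : Fin k) =>
        ∑ j : s, act (θ a j) ((x j).1 + (x j).2) := by
    intro s k θ
    have : Continuous fun (x : s → Euc d × Euc d) (a : Fin k) =>
        ∑ j : s, act (θ a j) ((x j).1 + (x j).2) := by
      refine continuous_pi fun a => continuous_finsetSum _ fun j _ => ?_
      exact (continuous_act_right _).comp (by fun_prop)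
    exact this.measurable
  have hc := h.comp (hm S u α) (hm Sᶜ v α')
  refine hc.congr (Eventually.of_forall fun ω => ?_) (Eventually.of_forall fun ω => ?_)
  · funext a
    simp only [Function.comp]
    rw [Finset.sum_coe_sort S fun j => act (α a j) ((ω j).1 + (ω j).2)]
    refine Finset.sum_subset (Finset.subset_univ _) fun j _ hj => ?_
    have : α a j = 0 := by
      by_contra h0
      exact hj (by simp only [hS, Finset.mem_filter, Finset.mem_univ, true_and]; exact ⟨a, h0⟩)
    simp [this]
  · funext b
    simp only [Function.comp]
    rw [Finset.sum_coe_sort Sᶜ fun j => act (α' b j) ((ω j).1 + (ω j).2)]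
    refine Finset.sum_subset (Finset.subset_univ _) fun j _ hj => ?_
    have hj' : j ∈ S := by simpa using hj
    simp only [hS, Finset.mem_filter, Finset.mem_univ, true_and] at hj'
    obtain ⟨a, ha⟩ := hj'
    have : α' b j = 0 := (hdisj a b j).resolve_left ha
    simp [this]

end SplitProduct

section Limit

variable {Ω : Type*} [MeasurableSpace Ω] {P : Measure Ω} [IsProbabilityMeasure P]
  {n d : ℕ} {J : Type*} [Fintype J]

/-- Weak convergence of the laws of the sums of independent split vectors. -/
lemma tendsto_integral_split {W : J → Ω → Euc d} (hW : ∀ j, Measurable (W j))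
    (hind : iIndepFun W P) {Q : J → ℕ → Measure (Euc d × Euc d)}
    (hQ : ∀ j N, IsProbabilityMeasure (Q j N))
    (hchar : ∀ j u, Tendsto (fun N => charFun ((Q j N).map fun p => p.1 + p.2) u) atTop
      (𝓝 (charFun (P.map (W j)) u))) {H : (J → Euc d) → ℝ} (hH : Continuous H) {C : ℝ}
    (hC : ∀ x, |H x| ≤ C) :
    Tendsto (fun N => ∫ ω, H (fun j => (ω j).1 + (ω j).2) ∂Measure.pi fun j => Q j N) atTop
      (𝓝 (∫ ω, H (fun j => W j ω) ∂P)) := by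
  have hs : Measurable fun p : Euc d × Euc d => p.1 + p.2 := by fun_prop
  let A : J → ℕ → ProbabilityMeasure (Euc d) := fun j N =>
    ⟨(Q j N).map fun p => p.1 + p.2, Measure.isProbabilityMeasure_map hs.aemeasurable⟩
  let B : J → ProbabilityMeasure (Euc d) := fun j =>
    ⟨P.map (W j), Measure.isProbabilityMeasure_map (hW j).aemeasurable⟩
  have hAB : ∀ j, Tendsto (A j) atTop (𝓝 (B j)) := fun j =>
    ProbabilityMeasure.tendsto_of_tendsto_charFun fun u => hchar j u
  have hpi : Tendsto (fun N => ProbabilityMeasure.pi fun j => A j N) atTop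
      (𝓝 (ProbabilityMeasure.pi B)) :=
    (ProbabilityMeasure.continuous_pi.tendsto B).comp (tendsto_pi_nhds.mpr hAB)
  rw [ProbabilityMeasure.tendsto_iff_forall_integral_tendsto] at hpi
  have h := hpi (BoundedContinuousFunction.ofNormedAddCommGroup H hH C hC)
  simp only [BoundedContinuousFunction.coe_ofNormedAddCommGroup,
    ProbabilityMeasure.toMeasure_pi] at h
  have hlim : ∫ x, H x ∂Measure.pi (fun j => (B j : Measure (Euc d))) =
      ∫ ω, H (fun j => W j ω) ∂P := by
    have e : Measure.pi (fun j => (B j : Measure (Euc d))) = P.map fun ω j => W j ω :=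
      ((iIndepFun_iff_map_fun_eq_pi_map fun j => (hW j).aemeasurable).mp hind).symm
    rw [e, integral_map (measurable_pi_lambda _ hW).aemeasurable hH.aestronglyMeasurable]
  have hN : ∀ N, ∫ x, H x ∂Measure.pi (fun j => (A j N : Measure (Euc d))) =
      ∫ ω, H (fun j => (ω j).1 + (ω j).2) ∂Measure.pi fun j => Q j N := by
    intro N
    have hpr := fun j => hQ j N
    have e : Measure.pi (fun j => (A j N : Measure (Euc d))) =
        (Measure.pi fun j => Q j N).map fun ω j => (ω j).1 + (ω j).2 := by
      have := fun j => Measure.isProbabilityMeasure_map (μ := Q j N) hs.aemeasurable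
      exact (Measure.pi_map_pi (μ := fun j => Q j N)
        (f := fun _ (p : Euc d × Euc d) => p.1 + p.2) fun j => hs.aemeasurable).symm
    rw [e, integral_map (by fun_prop) hH.aestronglyMeasurable]
  rw [hlim] at h
  exact h.congr hN

lemma covariance_comp_eq {E Ω' : Type*} [TopologicalSpace E] [MeasurableSpace E]
    [OpensMeasurableSpace E] [MeasurableSpace Ω'] (Q : Measure Ω')
    [IsProbabilityMeasure Q] {f g : E → ℝ} (hf : Continuous f) (hg : Continuous g) {C C' : ℝ}
    (hC : ∀ x, |f x| ≤ C) (hC' : ∀ x, |g x| ≤ C') {w : Ω' → E} (hw : Measurable w) :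
    cov[fun ω => f (w ω), fun ω => g (w ω); Q] =
      ∫ ω, f (w ω) * g (w ω) ∂Q - (∫ ω, f (w ω) ∂Q) * ∫ ω, g (w ω) ∂Q :=
  covariance_eq_sub (memLp_of_abs_le (hf.measurable.comp hw) (fun _ => hC _) 2)
    (memLp_of_abs_le (hg.measurable.comp hw) (fun _ => hC' _) 2)

variable {Φ : Euc d → ℂ} {τ κ : Matrix (Fin n) (Fin d) ℝ → ℝ} {μ : Euc d}

/-- The bound for the remainders, over a finite family of independent vectors. -/
def remainderBound (τ κ : Matrix (Fin n) (Fin d) ℝ → ℝ) (μ : Euc d) (c : J → ℝ) (l : ℝ)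
    (β : J → Matrix (Fin n) (Fin d) ℝ) : ℝ :=
  Real.sqrt (∑ j, c j * τ (β j) + ‖∑ j, c j • act (β j) μ‖ ^ 2) + l * ∑ j, c j * κ (β j)

lemma continuous_sum_act (θ : J → Matrix (Fin n) (Fin d) ℝ) :
    Continuous fun x : J → Euc d => ∑ j, act (θ j) (x j) :=
  continuous_finsetSum _ fun j _ => (continuous_act_right _).comp (continuous_apply j)

/-- Covariance bound for bounded Lipschitz functionals of linear combinations of independent
infinitely divisible vectors. -/
lemma SplitApprox.abs_covariance_le (hΦ : SplitApprox Φ τ κ μ) {W : J → Ω → Euc d}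
    (hW : ∀ j, Measurable (W j)) (hind : iIndepFun W P) {c : J → ℝ} (hc : ∀ j, 0 ≤ c j)
    (hchar : ∀ j u, charFun (P.map (W j)) u = Complex.exp (Φ u * c j)) {u v : ℕ}
    {F : (Fin u → Euc n) → ℝ} (hF : IsBddLip F) {G : (Fin v → Euc n) → ℝ} (hG : IsBddLip G)
    {α β : Fin u → J → Matrix (Fin n) (Fin d) ℝ} {α' β' : Fin v → J → Matrix (Fin n) (Fin d) ℝ}
    (hdisj : ∀ a b j, α a j = 0 ∨ α' b j = 0) :
    |cov[fun ω => F (fun a => ∑ j, act (α a j + β a j) (W j ω)),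
        fun ω => G (fun b => ∑ j, act (α' b j + β' b j) (W j ω)); P]| ≤
      supNorm G * lipConst F * ∑ a, remainderBound τ κ μ c 2 (β a) +
        supNorm F * lipConst G * ∑ b, remainderBound τ κ μ c 2 (β' b) := by
  choose Q κ' hQ hQchar hQ2 hQμ hQτ hQ1 hQκ' hQκ using fun j => hΦ (c j) (hc j)
  set fF : (J → Euc d) → ℝ := fun x => F fun a => ∑ j, act (α a j + β a j) (x j) with hfF
  set fG : (J → Euc d) → ℝ := fun x => G fun b => ∑ j, act (α' b j + β' b j) (x j) with hfG
  have cF : Continuous fF := hF.continuous.comp (continuous_pi fun a => continuous_sum_act _)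
  have cG : Continuous fG := hG.continuous.comp (continuous_pi fun a => continuous_sum_act _)
  have bF : ∀ x, |fF x| ≤ supNorm F := fun x => hF.abs_le _
  have bG : ∀ x, |fG x| ≤ supNorm G := fun x => hG.abs_le _
  -- The functionals and their product are bounded and continuous in the totals, so weak convergence
  -- of the product laws is enough; no moments of `W` are needed.
  have hlim : Tendsto (fun N => cov[fun ω : J → Euc d × Euc d => fF fun j => (ω j).1 + (ω j).2,
      fun ω => fG fun j => (ω j).1 + (ω j).2; Measure.pi fun j => Q j N]) atTop
      (𝓝 (cov[fun ω => fF (fun j => W j ω), fun ω => fG (fun j => W j ω); P])) := by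
    have hchar' : ∀ j u, Tendsto (fun N => charFun ((Q j N).map fun p => p.1 + p.2) u) atTop
        (𝓝 (charFun (P.map (W j)) u)) := fun j u => by rw [hchar]; exact hQchar j u
    rw [covariance_comp_eq P cF cG bF bG (w := fun ω j => W j ω) (measurable_pi_lambda _ hW)]
    have hFG := tendsto_integral_split hW hind hQ hchar' (H := fun x => fF x * fG x)
      (cF.mul cG) (C := supNorm F * supNorm G) fun x => by
        rw [abs_mul]
        exact mul_le_mul (bF x) (bG x) (abs_nonneg _) (supNorm_nonneg F)
    have hF' := tendsto_integral_split hW hind hQ hchar' cF bF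
    have hG' := tendsto_integral_split hW hind hQ hchar' cG bG
    refine (hFG.sub (hF'.mul hG')).congr fun N => ?_
    have hpr := fun j => hQ j N
    exact (covariance_comp_eq (Measure.pi fun j => Q j N) cF cG bF bG
      (w := fun ω j => (ω j).1 + (ω j).2) (by fun_prop)).symm
  have hb : ∀ {k : ℕ} (θ : Fin k → J → Matrix (Fin n) (Fin d) ℝ) , Tendsto (fun N =>
      ∑ a, (Real.sqrt (∑ j, c j * τ (θ a j) + ‖∑ j, c j • act (θ a j) μ‖ ^ 2) +
        2 * ∑ j, c j * κ' j N (θ a j))) atTop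
      (𝓝 (∑ a, remainderBound τ κ μ c 2 (θ a))) := fun θ =>
    tendsto_finsetSum _ fun a _ => Tendsto.const_add _ (Tendsto.const_mul _
      (tendsto_finsetSum _ fun j _ => Tendsto.const_mul _ (hQκ j (θ a j))))
  refine le_of_tendsto_of_tendsto hlim.abs
    (((hb β).const_mul (supNorm G * lipConst F)).add ((hb β').const_mul (supNorm F * lipConst G)))
    (Eventually.of_forall fun N => ?_)
  have hpr := fun j => hQ j N
  have hms : ∀ θ : J → Matrix (Fin n) (Fin d) ℝ,
      Measurable (fun ω : J → Euc d × Euc d => ∑ j, act (θ j) ((ω j).1 + (ω j).2)) ∧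
      Measurable (fun ω : J → Euc d × Euc d => ∑ j, act (θ j) (ω j).1) ∧
      Measurable (fun ω : J → Euc d × Euc d => ∑ j, act (θ j) (ω j).2) := fun θ => by
    refine ⟨(continuous_finsetSum _ fun j _ => (continuous_act_right _).comp ?_).measurable,
      (continuous_finsetSum _ fun j _ => (continuous_act_right _).comp ?_).measurable,
      (continuous_finsetSum _ fun j _ => (continuous_act_right _).comp ?_).measurable⟩ <;> fun_prop
  -- The main part keeps whole vectors, while the remainder is separated into its `L²` and `L¹`
  -- components.
  have hX : ∀ (θ η : J → Matrix (Fin n) (Fin d) ℝ) (ω : J → Euc d × Euc d),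
      ∑ j, act (θ j + η j) ((ω j).1 + (ω j).2) = ∑ j, act (θ j) ((ω j).1 + (ω j).2) +
        ∑ j, act (η j) (ω j).1 + ∑ j, act (η j) (ω j).2 := fun θ η ω => by
    simp only [add_act, act_add, Finset.sum_add_distrib]; abel
  exact abs_covariance_le_of_split hF hG
    (fun a => (hms (α a)).1) (fun a => (hms (β a)).2.1) (fun a => (hms (β a)).2.2)
    (fun a ω => hX _ _ ω) (fun a => memLp_sum_fst (fun j => hQ2 j N) (β a))
    (fun a => sqrt_integral_sum_fst_le (fun j => hQ2 j N) (fun j => hQμ j N) (fun j => hQτ j N) _)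
    (fun a => integrable_sum_snd (fun j => hQ1 j N) (β a))
    (fun a => integral_norm_sum_snd_le (fun j => hQ1 j N) (fun j => hQκ' j N) (β a))
    (fun a => (hms (α' a)).1) (fun a => (hms (β' a)).2.1) (fun a => (hms (β' a)).2.2)
    (fun a ω => hX _ _ ω) (fun a => memLp_sum_fst (fun j => hQ2 j N) (β' a))
    (fun a => sqrt_integral_sum_fst_le (fun j => hQ2 j N) (fun j => hQμ j N) (fun j => hQτ j N) _)
    (fun a => integrable_sum_snd (fun j => hQ1 j N) (β' a))
    (fun a => integral_norm_sum_snd_le (fun j => hQ1 j N) (fun j => hQκ' j N) (β' a))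
    (indepFun_sum_of_disjoint hdisj)

/-- Bound for the truncated first moment of linear combinations of independent infinitely
divisible vectors. -/
lemma SplitApprox.integral_min_le (hΦ : SplitApprox Φ τ κ μ) {W : J → Ω → Euc d}
    (hW : ∀ j, Measurable (W j)) (hind : iIndepFun W P) {c : J → ℝ} (hc : ∀ j, 0 ≤ c j)
    (hchar : ∀ j u, charFun (P.map (W j)) u = Complex.exp (Φ u * c j))
    (β : J → Matrix (Fin n) (Fin d) ℝ) :
    ∫ ω, min 1 ‖∑ j, act (β j) (W j ω)‖ ∂P ≤ remainderBound τ κ μ c 1 β := by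
  choose Q κ' hQ hQchar hQ2 hQμ hQτ hQ1 hQκ' hQκ using fun j => hΦ (c j) (hc j)
  have hchar' : ∀ j u, Tendsto (fun N => charFun ((Q j N).map fun p => p.1 + p.2) u) atTop
      (𝓝 (charFun (P.map (W j)) u)) := fun j u => by rw [hchar]; exact hQchar j u
  have hlim := tendsto_integral_split hW hind hQ hchar'
    (H := fun x => min 1 ‖∑ j, act (β j) (x j)‖)
    (continuous_const.min (continuous_sum_act β).norm) (C := 1) fun x => by
      rw [abs_of_nonneg (by positivity)]; exact min_le_left _ _
  have hb : Tendsto (fun N => Real.sqrt (∑ j, c j * τ (β j) + ‖∑ j, c j • act (β j) μ‖ ^ 2) +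
        1 * ∑ j, c j * κ' j N (β j)) atTop (𝓝 (remainderBound τ κ μ c 1 β)) :=
    Tendsto.const_add _ (Tendsto.const_mul _
      (tendsto_finsetSum _ fun j _ => Tendsto.const_mul _ (hQκ j (β j))))
  refine le_of_tendsto_of_tendsto hlim hb (Eventually.of_forall fun N => ?_)
  have hpr := fun j => hQ j N
  have hY := memLp_sum_fst (fun j => hQ2 j N) β
  have hZ := integrable_sum_snd (fun j => hQ1 j N) β
  -- Jensen's inequality in the form that a variance is nonnegative.
  have hYn : ∫ ω, ‖∑ j, act (β j) (ω j).1‖ ∂(Measure.pi fun j => Q j N) ≤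
      Real.sqrt (∫ ω, ‖∑ j, act (β j) (ω j).1‖ ^ 2 ∂(Measure.pi fun j => Q j N)) := by
    refine Real.le_sqrt_of_sq_le ?_
    have h0 := variance_nonneg (fun ω : J → Euc d × Euc d => ‖∑ j, act (β j) (ω j).1‖)
      (Measure.pi fun j => Q j N)
    rw [variance_eq_sub hY.norm] at h0
    simp only [Pi.pow_apply] at h0
    linarith
  calc _ ≤ ∫ ω, (‖∑ j, act (β j) (ω j).1‖ + ‖∑ j, act (β j) (ω j).2‖)
        ∂(Measure.pi fun j => Q j N) := by
        refine integral_mono_of_nonneg (Eventually.of_forall fun _ => by positivity)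
          ((hY.integrable one_le_two).norm.add hZ.norm) (Eventually.of_forall fun ω => ?_)
        simp only [act_add, Finset.sum_add_distrib]
        exact (min_le_right _ _).trans (norm_add_le _ _)
    _ = _ := integral_add (hY.integrable one_le_two).norm hZ.norm
    _ ≤ _ := by
        simp only [one_mul]
        exact add_le_add (hYn.trans (sqrt_integral_sum_fst_le (fun j => hQ2 j N)
          (fun j => hQμ j N) (fun j => hQτ j N) β))
          (integral_norm_sum_snd_le (fun j => hQ1 j N) (fun j => hQκ' j N) β)

end Limit

end MMAF

end

/-! ### Integrals of simple functions as sums of independent vectors -/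

noncomputable section

namespace MMAF

variable {Ω : Type*} [MeasurableSpace Ω] {P : Measure Ω}
  {S : Type*} [MetricSpace S] [MeasurableSpace S] {m n d : ℕ}

/-! ### Bounded Borel sets and finite additivity -/

lemma BddBorel.empty : BddBorel (∅ : Set (S × (Fin m → ℝ))) :=
  ⟨MeasurableSet.empty, Bornology.isBounded_empty⟩

lemma BddBorel.union {A B : Set (S × (Fin m → ℝ))} (hA : BddBorel A) (hB : BddBorel B) :
    BddBorel (A ∪ B) :=
  ⟨hA.1.union hB.1, hA.2.union hB.2⟩

lemma BddBorel.biUnion {ι : Type*} (s : Finset ι) {B : ι → Set (S × (Fin m → ℝ))}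
    (hB : ∀ i ∈ s, BddBorel (B i)) : BddBorel (⋃ i ∈ s, B i) :=
  ⟨Finset.measurableSet_biUnion s fun i hi => (hB i hi).1,
    (Bornology.isBounded_biUnion_finset s).mpr fun i hi => (hB i hi).2⟩

/-- As `π` has mass 1, only boundedness in the `ℝ^m` direction matters. -/
lemma measure_lt_top_of_isBounded {π : Measure S} [IsProbabilityMeasure π]
    {B : Set (S × (Fin m → ℝ))} (hB : Bornology.IsBounded B) : (π.prod volume) B < ⊤ := by
  obtain ⟨R, hR⟩ := hB.image_snd.subset_closedBall (0 : Fin m → ℝ)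
  refine lt_of_le_of_lt (measure_mono (t := Set.univ ×ˢ Metric.closedBall 0 R) fun p hp =>
    ⟨trivial, hR ⟨p, hp, rfl⟩⟩) ?_
  rw [Measure.prod_prod, measure_univ, one_mul]
  exact (isCompact_closedBall 0 R).measure_lt_top

namespace IsLevyBasis

variable {Λ : Set (S × (Fin m → ℝ)) → Ω → Euc d}

/-- The partial sums for the constant sequence `∅` converge, and consecutive ones differ by `Λ ∅`.
-/
lemma ae_empty (hΛ : IsLevyBasis P Λ) : ∀ᵐ ω ∂P, Λ ∅ ω = 0 := by
  have h := hΛ.sigma_additive (fun _ => ∅) (fun _ => BddBorel.empty)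
    (fun _ _ _ => disjoint_bot_left) (by simpa using BddBorel.empty)
  filter_upwards [h] with ω hω
  simp only [Set.iUnion_empty] at hω
  have h1 := (hω.comp (tendsto_add_atTop_nat 1)).sub hω
  simp only [Function.comp_def, Finset.sum_range_succ, add_sub_cancel_left, sub_self] at h1
  exact tendsto_nhds_unique tendsto_const_nhds h1

lemma ae_union (hΛ : IsLevyBasis P Λ) {A B : Set (S × (Fin m → ℝ))} (hA : BddBorel A)
    (hB : BddBorel B) (hAB : Disjoint A B) :
    ∀ᵐ ω ∂P, Λ (A ∪ B) ω = Λ A ω + Λ B ω := by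
  set C : ℕ → Set (S × (Fin m → ℝ)) := fun i => if i = 0 then A else if i = 1 then B else ∅
    with hC
  have hCb : ∀ i, BddBorel (C i) := fun i => by
    simp only [hC]; split_ifs
    exacts [hA, hB, BddBorel.empty]
  have hCd : Pairwise fun i j => Disjoint (C i) (C j) := fun i j hij => by
    simp only [hC]
    split_ifs <;> first | omega | exact hAB | exact hAB.symm | simp
  have hU : ⋃ i, C i = A ∪ B := by
    ext x
    simp only [Set.mem_iUnion, Set.mem_union]
    constructor
    · rintro ⟨i, hi⟩
      simp only [hC] at hi
      split_ifs at hi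
      exacts [Or.inl hi, Or.inr hi, hi.elim]
    · rintro (h | h)
      · exact ⟨0, by simpa [hC] using h⟩
      · exact ⟨1, by simpa [hC] using h⟩
  have h := hΛ.sigma_additive C hCb hCd (by rw [hU]; exact hA.union hB)
  filter_upwards [h, hΛ.ae_empty] with ω hω h0
  rw [hU] at hω
  refine tendsto_nhds_unique hω (tendsto_const_nhds.congr' ?_)
  filter_upwards [eventually_ge_atTop 2] with N hN
  obtain ⟨k, rfl⟩ := Nat.exists_eq_add_of_le hN
  rw [Finset.sum_range_add]
  have : ∀ i, Λ (C (2 + i)) ω = 0 := fun i => by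
    simp only [hC]
    rw [if_neg (by omega), if_neg (by omega), h0]
  simp only [this, Finset.sum_const_zero, add_zero]
  simp [Finset.sum_range_succ, hC]

lemma ae_biUnion (hΛ : IsLevyBasis P Λ) {ι : Type*} (s : Finset ι)
    {B : ι → Set (S × (Fin m → ℝ))} (hB : ∀ i ∈ s, BddBorel (B i))
    (hd : Pairwise fun i j => Disjoint (B i) (B j)) :
    ∀ᵐ ω ∂P, Λ (⋃ i ∈ s, B i) ω = ∑ i ∈ s, Λ (B i) ω := by
  classical
  induction s using Finset.induction_on with
  | empty => simpa using hΛ.ae_empty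
  | insert i s hi ih =>
    have hs : ∀ j ∈ s, BddBorel (B j) := fun j hj => hB j (Finset.mem_insert_of_mem hj)
    have hdis : Disjoint (B i) (⋃ j ∈ s, B j) := by
      rw [Set.disjoint_iUnion₂_right]
      exact fun j hj => hd (fun h => hi (h ▸ hj))
    filter_upwards [ih hs, hΛ.ae_union (hB i (Finset.mem_insert_self i s)) (BddBorel.biUnion s hs)
      hdis] with ω h1 h2
    rw [Finset.set_biUnion_insert, h2, h1, Finset.sum_insert hi]

end IsLevyBasis

/-! ### Atoms of simple functions -/

section Atoms

lemma pairwise_disjoint_atoms {X V : Type*} [MeasurableSpace X] {Ψ : SimpleFunc X V} (E : Set X) :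
    Pairwise fun a b : V => Disjoint (E ∩ Ψ ⁻¹' {a}) (E ∩ Ψ ⁻¹' {b}) := fun a b hab =>
  Set.disjoint_left.mpr fun p hp hp' => hab (by
    have h1 : Ψ p = a := hp.2
    have h2 : Ψ p = b := hp'.2
    rw [← h1, ← h2])

variable {V : Type*} [Zero V]

open scoped Classical in
/-- The nonzero values of a simple function. -/
def atoms {X : Type*} [MeasurableSpace X] (Ψ : SimpleFunc X V) : Finset V :=
  Ψ.range.filter (· ≠ 0)

lemma mem_atoms {X : Type*} [MeasurableSpace X] {Ψ : SimpleFunc X V} {a : V} :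
    a ∈ atoms Ψ ↔ a ∈ Set.range Ψ ∧ a ≠ 0 := by
  simp [atoms]

variable {Ψ : SimpleFunc (S × (Fin m → ℝ)) V}

lemma bddBorel_atom (hΨ : Bornology.IsBounded {p | Ψ p ≠ 0}) {E : Set (S × (Fin m → ℝ))}
    (hE : MeasurableSet E) {a : V} (ha : a ≠ 0) : BddBorel (E ∩ Ψ ⁻¹' {a}) :=
  ⟨hE.inter (Ψ.measurableSet_fiber a), hΨ.subset fun p hp => by
    have h : Ψ p = a := hp.2
    change Ψ p ≠ 0
    rwa [h]⟩

lemma integral_comp_simpleFunc {π : Measure S} [IsProbabilityMeasure π]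
    (hΨ : Bornology.IsBounded {p | Ψ p ≠ 0}) {E : Set (S × (Fin m → ℝ))}
    (hE : MeasurableSet E) {F : Type*} [NormedAddCommGroup F] [NormedSpace ℝ F] [CompleteSpace F]
    {g : V → F} (hg : g 0 = 0) :
    ∫ p in E, g (Ψ p) ∂(π.prod volume) =
      ∑ a : atoms Ψ, ((π.prod volume) (E ∩ Ψ ⁻¹' {(a : V)})).toReal • g a := by
  classical
  have hsum : ∀ p, g (Ψ p) = ∑ a : atoms Ψ, (Ψ ⁻¹' {(a : V)}).indicator (fun _ => g a) p := by
    intro p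
    by_cases hp : Ψ p = 0
    · rw [hp, hg]
      refine (Finset.sum_eq_zero fun a _ => Set.indicator_of_notMem ?_ _).symm
      intro h
      have h' : Ψ p = a := h
      exact (mem_atoms.mp a.2).2 (h' ▸ hp)
    · have hm : Ψ p ∈ atoms Ψ := mem_atoms.mpr ⟨⟨p, rfl⟩, hp⟩
      rw [Finset.sum_eq_single (⟨Ψ p, hm⟩ : atoms Ψ)]
      · exact (Set.indicator_of_mem (show Ψ p = Ψ p from rfl) _).symm
      · intro b _ hb
        refine Set.indicator_of_notMem (fun h => hb ?_) _
        have h' : Ψ p = b := h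
        exact Subtype.ext h'.symm
      · simp
  simp only [hsum]
  have hfin : ∀ a : atoms Ψ, ((π.prod volume).restrict E) (Ψ ⁻¹' {(a : V)}) < ⊤ := fun a => by
    rw [Measure.restrict_apply (Ψ.measurableSet_fiber _), Set.inter_comm]
    exact measure_lt_top_of_isBounded (bddBorel_atom hΨ hE (mem_atoms.mp a.2).2).2
  rw [integral_finsetSum _ fun a _ =>
    (integrable_indicator_iff (Ψ.measurableSet_fiber _)).mpr
      (integrableOn_const (hfin a).ne)]
  refine Finset.sum_congr rfl fun a _ => ?_
  rw [integral_indicator_const _ (Ψ.measurableSet_fiber _), measureReal_def,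
    Measure.restrict_apply (Ψ.measurableSet_fiber _), Set.inter_comm]

/-- This lets several simple functions share one partition: if each is a function of `Ψ`, all
integrals are linear in the same independent vectors. A fibre over `b ≠ 0` is a finite disjoint
union of atoms of `Ψ`. The fibre over 0 may be unbounded, where nothing is known about `Λ`, but its
coefficient is zero. -/
lemma simpleIntegral_map_ae {Λ : Set (S × (Fin m → ℝ)) → Ω → Euc d} (hΛ : IsLevyBasis P Λ)
    (hΨ : Bornology.IsBounded {p | Ψ p ≠ 0}) {E : Set (S × (Fin m → ℝ))} (hE : MeasurableSet E)
    (φ : SimpleFunc (S × (Fin m → ℝ)) (Matrix (Fin n) (Fin d) ℝ))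
    {θ : V → Matrix (Fin n) (Fin d) ℝ} (hφ : ∀ p, φ p = θ (Ψ p)) (hθ : θ 0 = 0) :
    ∀ᵐ ω ∂P, simpleIntegral Λ φ E ω =
      ∑ a : atoms Ψ, act (θ a) (Λ (E ∩ Ψ ⁻¹' {(a : V)}) ω) := by
  classical
  have hfib : ∀ b : Matrix (Fin n) (Fin d) ℝ, ∀ᵐ ω ∂P, b ≠ 0 →
      Λ (E ∩ φ ⁻¹' {b}) ω =
        ∑ a ∈ (atoms Ψ).filter (fun a => θ a = b), Λ (E ∩ Ψ ⁻¹' {a}) ω := by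
    intro b
    by_cases hb : b = 0
    · exact Eventually.of_forall fun ω h => absurd hb h
    have hset : E ∩ φ ⁻¹' {b} = ⋃ a ∈ (atoms Ψ).filter (fun a => θ a = b), E ∩ Ψ ⁻¹' {a} := by
      ext p
      simp only [Set.mem_inter_iff, Set.mem_preimage, Set.mem_singleton_iff, Set.mem_iUnion,
        Finset.mem_filter, exists_prop, hφ]
      constructor
      · rintro ⟨hpE, hp⟩
        refine ⟨Ψ p, ⟨mem_atoms.mpr ⟨⟨p, rfl⟩, fun h0 => hb ?_⟩, hp⟩, hpE, rfl⟩
        rw [← hp, h0, hθ]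
      · rintro ⟨a, ⟨-, ha⟩, hpE, rfl⟩
        exact ⟨hpE, ha⟩
    have h := hΛ.ae_biUnion ((atoms Ψ).filter fun a => θ a = b) (B := fun a => E ∩ Ψ ⁻¹' {a})
      (fun a ha => bddBorel_atom hΨ hE (mem_atoms.mp (Finset.mem_filter.mp ha).1).2)
      (pairwise_disjoint_atoms E)
    filter_upwards [h] with ω hω _
    rw [hset, hω]
  have hall : ∀ᵐ ω ∂P, ∀ b ∈ φ.range, b ≠ 0 → Λ (E ∩ φ ⁻¹' {b}) ω =
        ∑ a ∈ (atoms Ψ).filter (fun a => θ a = b), Λ (E ∩ Ψ ⁻¹' {a}) ω :=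
    (Filter.eventually_all_finset φ.range).mpr fun b _ => hfib b
  filter_upwards [hall] with ω hω
  have hmap : ∀ a ∈ atoms Ψ, θ a ∈ φ.range := fun a ha => by
    obtain ⟨⟨p, rfl⟩, -⟩ := mem_atoms.mp ha
    rw [← hφ]
    exact SimpleFunc.mem_range_self φ p
  rw [Finset.sum_coe_sort (atoms Ψ) fun a => act (θ a) (Λ (E ∩ Ψ ⁻¹' {a}) ω),
    ← Finset.sum_fiberwise_of_maps_to hmap, simpleIntegral]
  refine Finset.sum_congr rfl fun b hb => ?_
  by_cases hb0 : b = 0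
  · subst hb0
    rw [zero_act]
    refine (Finset.sum_eq_zero fun a ha => ?_).symm
    rw [(Finset.mem_filter.mp ha).2, zero_act]
  · rw [hω b hb hb0, act_sum]
    exact Finset.sum_congr rfl fun a ha => by rw [(Finset.mem_filter.mp ha).2]

lemma iIndepFun_atoms {Λ : Set (S × (Fin m → ℝ)) → Ω → Euc d} (hΛ : IsLevyBasis P Λ)
    (hΨ : Bornology.IsBounded {p | Ψ p ≠ 0}) {E : Set (S × (Fin m → ℝ))} (hE : MeasurableSet E) :
    iIndepFun (fun a : atoms Ψ => Λ (E ∩ Ψ ⁻¹' {(a : V)})) P := by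
  set e := Fintype.equivFin (atoms Ψ)
  have h := hΛ.indep _ (fun i => E ∩ Ψ ⁻¹' {((e.symm i : atoms Ψ) : V)})
    (fun i => bddBorel_atom hΨ hE (mem_atoms.mp (e.symm i).2).2)
    (fun i j hij => pairwise_disjoint_atoms E
      fun h' => hij (e.symm.injective (Subtype.ext h')))
  have := h.precomp e.injective
  simpa using this

end Atoms

/-- A finite family of simple functions as one simple function. -/
def simplePi {X ι V : Type*} [MeasurableSpace X] [Finite ι] (f : ι → SimpleFunc X V) :
    SimpleFunc X (ι → V) where
  toFun p i := f i p
  measurableSet_fiber' x := by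
    have : (fun p i => f i p) ⁻¹' {x} = ⋂ i, f i ⁻¹' {x i} := by
      ext p; simp [funext_iff]
    rw [this]
    exact MeasurableSet.iInter fun i => (f i).measurableSet_fiber _
  finite_range' := (Set.Finite.pi' fun i => (f i).finite_range).subset (by
    rintro _ ⟨p, rfl⟩ i
    exact ⟨p, rfl⟩)

lemma covariance_congr_ae {X X' Y Y' : Ω → ℝ} (hX : X =ᵐ[P] X') (hY : Y =ᵐ[P] Y') :
    cov[X, Y; P] = cov[X', Y'; P] := by
  rw [covariance, covariance, integral_congr_ae hX, integral_congr_ae hY]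
  refine integral_congr_ae ?_
  filter_upwards [hX, hY] with ω h1 h2
  rw [h1, h2]

/-! ### Covariances and truncated moments of integrals of simple functions -/

section Simple

variable {π : Measure S} {Λ : Set (S × (Fin m → ℝ)) → Ω → Euc d} {γ : Euc d}
  {Sig : Matrix (Fin d) (Fin d) ℝ} {ν : Measure (Euc d)}
  {τ κ : Matrix (Fin n) (Fin d) ℝ → ℝ} {μ : Euc d}

/-- The bound for the integral over `E` of the kernel `g`. -/
def tailBound (π : Measure S) (τ κ : Matrix (Fin n) (Fin d) ℝ → ℝ) (μ : Euc d) (l : ℝ)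
    (g : S × (Fin m → ℝ) → Matrix (Fin n) (Fin d) ℝ) (E : Set (S × (Fin m → ℝ))) : ℝ :=
  Real.sqrt ((∫ p in E, τ (g p) ∂(π.prod volume)) +
    ‖∫ p in E, act (g p) μ ∂(π.prod volume)‖ ^ 2) + l * ∫ p in E, κ (g p) ∂(π.prod volume)

lemma remainderBound_eq_tailBound [IsProbabilityMeasure π] {V : Type*} [Zero V]
    {Ψ : SimpleFunc (S × (Fin m → ℝ)) V} (hτ0 : τ 0 = 0) (hκ0 : κ 0 = 0)
    (hΨ : Bornology.IsBounded {p | Ψ p ≠ 0}) {E : Set (S × (Fin m → ℝ))}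
    (hE : MeasurableSet E) {β : V → Matrix (Fin n) (Fin d) ℝ} (hβ : β 0 = 0) (l : ℝ) :
    remainderBound τ κ μ (fun a : atoms Ψ => ((π.prod volume) (E ∩ Ψ ⁻¹' {(a : V)})).toReal) l
      (fun a => β a) = tailBound π τ κ μ l (fun p => β (Ψ p)) E := by
  unfold remainderBound tailBound
  rw [integral_comp_simpleFunc (g := fun a => τ (β a)) hΨ hE (by simp [hβ, hτ0]),
    integral_comp_simpleFunc (g := fun a => act (β a) μ) hΨ hE (by simp [hβ]),
    integral_comp_simpleFunc (g := fun a => κ (β a)) hΨ hE (by simp [hβ, hκ0])]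
  simp only [smul_eq_mul]

variable [IsProbabilityMeasure P]

/-- All main and remainder kernels of both families are bundled into one simple function with values
in tuples of matrices. An atom is a tuple, so its entries are the coefficients, and pointwise
disjointness of the main kernels becomes disjointness of coefficients. -/
lemma abs_covariance_simpleIntegral_le (hΛ : IsLevyBasisWith P Λ γ Sig ν π)
    (hΦ : SplitApprox (cumulant γ Sig ν) τ κ μ) (hτ0 : τ 0 = 0) (hκ0 : κ 0 = 0) {u v : ℕ}
    {F : (Fin u → Euc n) → ℝ} (hF : IsBddLip F) {G : (Fin v → Euc n) → ℝ} (hG : IsBddLip G)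
    {φ α β : Fin u → SimpleFunc (S × (Fin m → ℝ)) (Matrix (Fin n) (Fin d) ℝ)}
    {φ' α' β' : Fin v → SimpleFunc (S × (Fin m → ℝ)) (Matrix (Fin n) (Fin d) ℝ)}
    (hφ : ∀ a p, φ a p = α a p + β a p) (hφ' : ∀ a p, φ' a p = α' a p + β' a p)
    (hα : ∀ a, Bornology.IsBounded (Function.support (α a)))
    (hβ : ∀ a, Bornology.IsBounded (Function.support (β a)))
    (hα' : ∀ a, Bornology.IsBounded (Function.support (α' a)))
    (hβ' : ∀ a, Bornology.IsBounded (Function.support (β' a)))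
    (hdisj : ∀ a b p, α a p = 0 ∨ α' b p = 0) :
    |cov[fun ω => F (fun a => simpleIntegral Λ (φ a) Set.univ ω),
        fun ω => G (fun b => simpleIntegral Λ (φ' b) Set.univ ω); P]| ≤
      supNorm G * lipConst F * ∑ a, tailBound π τ κ μ 2 (β a) Set.univ +
        supNorm F * lipConst G * ∑ b, tailBound π τ κ μ 2 (β' b) Set.univ := by
  have := hΛ.prob
  have hΛb := hΛ.toIsLevyBasis
  set Ψ : SimpleFunc (S × (Fin m → ℝ)) ((Fin u ⊕ Fin u) ⊕ (Fin v ⊕ Fin v) →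
      Matrix (Fin n) (Fin d) ℝ) :=
    simplePi (Sum.elim (Sum.elim α β) (Sum.elim α' β')) with hΨdef
  have hΨ : Bornology.IsBounded {p | Ψ p ≠ 0} := by
    have hb : ∀ i, Bornology.IsBounded
        (Function.support ((Sum.elim (Sum.elim α β) (Sum.elim α' β')) i)) := by
      rintro ((i | i) | (i | i))
      exacts [hα i, hβ i, hα' i, hβ' i]
    refine (Bornology.isBounded_iUnion.mpr hb).subset fun p hp => ?_
    obtain ⟨i, hi⟩ := Function.ne_iff.mp (show Ψ p ≠ 0 from hp)
    exact Set.mem_iUnion.mpr ⟨i, hi⟩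
  have hE : MeasurableSet (Set.univ : Set (S × (Fin m → ℝ))) := MeasurableSet.univ
  have h1 : ∀ᵐ ω ∂P, ∀ a, simpleIntegral Λ (φ a) Set.univ ω =
      ∑ j : atoms Ψ, act (j.1 (Sum.inl (Sum.inl a)) + j.1 (Sum.inl (Sum.inr a)))
        (Λ (Set.univ ∩ Ψ ⁻¹' {j.1}) ω) :=
    ae_all_iff.mpr fun a => simpleIntegral_map_ae hΛb hΨ hE (φ a)
      (θ := fun x => x (Sum.inl (Sum.inl a)) + x (Sum.inl (Sum.inr a))) (fun p => hφ a p) (by simp)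
  have h2 : ∀ᵐ ω ∂P, ∀ b, simpleIntegral Λ (φ' b) Set.univ ω =
      ∑ j : atoms Ψ, act (j.1 (Sum.inr (Sum.inl b)) + j.1 (Sum.inr (Sum.inr b)))
        (Λ (Set.univ ∩ Ψ ⁻¹' {j.1}) ω) :=
    ae_all_iff.mpr fun b => simpleIntegral_map_ae hΛb hΨ hE (φ' b)
      (θ := fun x => x (Sum.inr (Sum.inl b)) + x (Sum.inr (Sum.inr b))) (fun p => hφ' b p)
      (by simp)
  have hcov : cov[fun ω => F (fun a => simpleIntegral Λ (φ a) Set.univ ω),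
        fun ω => G (fun b => simpleIntegral Λ (φ' b) Set.univ ω); P] =
      cov[fun ω => F (fun a => ∑ j : atoms Ψ,
          act (j.1 (Sum.inl (Sum.inl a)) + j.1 (Sum.inl (Sum.inr a)))
          (Λ (Set.univ ∩ Ψ ⁻¹' {j.1}) ω)),
        fun ω => G (fun b => ∑ j : atoms Ψ,
          act (j.1 (Sum.inr (Sum.inl b)) + j.1 (Sum.inr (Sum.inr b)))
          (Λ (Set.univ ∩ Ψ ⁻¹' {j.1}) ω)); P] := by
    refine covariance_congr_ae ?_ ?_
    · filter_upwards [h1] with ω hω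
      simp only [hω]
    · filter_upwards [h2] with ω hω
      simp only [hω]
  rw [hcov]
  have hbb : ∀ j : atoms Ψ, BddBorel (Set.univ ∩ Ψ ⁻¹' {j.1}) := fun j =>
    bddBorel_atom hΨ hE (mem_atoms.mp j.2).2
  have hmain := hΦ.abs_covariance_le (P := P) (W := fun j : atoms Ψ => Λ (Set.univ ∩ Ψ ⁻¹' {j.1}))
    (fun j => hΛb.measurable _ (hbb j)) (iIndepFun_atoms hΛb hΨ hE)
    (c := fun j => ((π.prod volume) (Set.univ ∩ Ψ ⁻¹' {j.1})).toReal)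
    (fun j => ENNReal.toReal_nonneg) (fun j u => hΛ.charFun_eq _ (hbb j) u) hF hG
    (α := fun a j => j.1 (Sum.inl (Sum.inl a))) (β := fun a j => j.1 (Sum.inl (Sum.inr a)))
    (α' := fun b j => j.1 (Sum.inr (Sum.inl b))) (β' := fun b j => j.1 (Sum.inr (Sum.inr b)))
    (fun a b j => by
      obtain ⟨⟨p, hp⟩, -⟩ := mem_atoms.mp j.2
      rw [← hp]
      exact hdisj a b p)
  refine hmain.trans (le_of_eq ?_)
  congr 2 <;>
  · refine Finset.sum_congr rfl fun a _ => ?_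
    first
    | exact remainderBound_eq_tailBound (π := π) hτ0 hκ0 hΨ hE
        (β := fun x => x (Sum.inl (Sum.inr a))) rfl 2
    | exact remainderBound_eq_tailBound (π := π) hτ0 hκ0 hΨ hE
        (β := fun x => x (Sum.inr (Sum.inr a))) rfl 2

lemma integral_min_simpleIntegral_sub_le (hΛ : IsLevyBasisWith P Λ γ Sig ν π)
    (hΦ : SplitApprox (cumulant γ Sig ν) τ κ μ) (hτ0 : τ 0 = 0) (hκ0 : κ 0 = 0)
    {φ ψ : SimpleFunc (S × (Fin m → ℝ)) (Matrix (Fin n) (Fin d) ℝ)}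
    (hφ : Bornology.IsBounded (Function.support φ))
    (hψ : Bornology.IsBounded (Function.support ψ))
    {E : Set (S × (Fin m → ℝ))} (hE : MeasurableSet E) :
    ∫ ω, min 1 ‖simpleIntegral Λ φ E ω - simpleIntegral Λ ψ E ω‖ ∂P ≤
      tailBound π τ κ μ 1 (fun p => φ p - ψ p) E := by
  have := hΛ.prob
  have hΛb := hΛ.toIsLevyBasis
  set Ψ : SimpleFunc (S × (Fin m → ℝ))
      (Matrix (Fin n) (Fin d) ℝ × Matrix (Fin n) (Fin d) ℝ) := φ.pair ψ with hΨdef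
  have hΨ : Bornology.IsBounded {p | Ψ p ≠ 0} := by
    refine (hφ.union hψ).subset fun p hp => ?_
    by_contra hnot
    simp only [Set.mem_union, Function.mem_support, not_or, not_not] at hnot
    exact hp (Prod.ext hnot.1 hnot.2)
  have h1 := simpleIntegral_map_ae hΛb hΨ hE φ (θ := Prod.fst) (fun p => rfl) rfl
  have h2 := simpleIntegral_map_ae hΛb hΨ hE ψ (θ := Prod.snd) (fun p => rfl) rfl
  have hbb : ∀ j : atoms Ψ, BddBorel (E ∩ Ψ ⁻¹' {j.1}) := fun j =>
    bddBorel_atom hΨ hE (mem_atoms.mp j.2).2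
  have hmain := hΦ.integral_min_le (P := P) (W := fun j : atoms Ψ => Λ (E ∩ Ψ ⁻¹' {j.1}))
    (fun j => hΛb.measurable _ (hbb j)) (iIndepFun_atoms hΛb hΨ hE)
    (c := fun j => ((π.prod volume) (E ∩ Ψ ⁻¹' {j.1})).toReal)
    (fun j => ENNReal.toReal_nonneg) (fun j u => hΛ.charFun_eq _ (hbb j) u)
    (fun j => j.1.1 - j.1.2)
  rw [remainderBound_eq_tailBound (π := π) hτ0 hκ0 hΨ hE (β := fun x => x.1 - x.2) (by simp) 1]
    at hmain
  refine le_trans (le_of_eq (integral_congr_ae ?_)) hmain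
  filter_upwards [h1, h2] with ω e1 e2
  rw [e1, e2, ← Finset.sum_sub_distrib]
  simp only [sub_act]

end Simple

end MMAF

end

/-! ### Approximating sequences dominated by the kernel -/

noncomputable section

namespace MMAF

/-! ### Convergence in probability from summable truncated increments -/

section Convergence

variable {Ω : Type*} [MeasurableSpace Ω] {P : Measure Ω}

/-- The truncated increments have a summable total expectation, so their sum is almost surely
finite. Then they are eventually below 1, where truncation has no effect, and the sequence is almost
surely Cauchy. -/
lemma exists_tendstoInMeasure_of_summable [IsProbabilityMeasure P] {E : Type*}
    [NormedAddCommGroup E] [MeasurableSpace E] [BorelSpace E] [SecondCountableTopology E]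
    [CompleteSpace E] {f : ℕ → Ω → E}
    (hf : ∀ k, Measurable (f k)) {b : ℕ → ℝ} (hb : Summable b)
    (h : ∀ k, ∫ ω, min 1 ‖f (k + 1) ω - f k ω‖ ∂P ≤ b k) :
    ∃ Y : Ω → E, TendstoInMeasure P f atTop Y := by
  set e : ℕ → Ω → ℝ := fun k ω => min 1 ‖f (k + 1) ω - f k ω‖ with he
  have hem : ∀ k, Measurable (e k) := fun k =>
    measurable_const.min ((hf (k + 1)).sub (hf k)).norm
  have he0 : ∀ k ω, 0 ≤ e k ω := fun k ω => le_min zero_le_one (norm_nonneg _)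
  have hei : ∀ k, Integrable (e k) P := fun k =>
    Integrable.of_bound (hem k).aestronglyMeasurable 1 (Eventually.of_forall fun ω => by
      rw [Real.norm_of_nonneg (he0 k ω)]; exact min_le_left _ _)
  have hb0 : ∀ k, 0 ≤ b k := fun k => (integral_nonneg (he0 k)).trans (h k)
  have hfin : ∫⁻ ω, ∑' k, ENNReal.ofReal (e k ω) ∂P ≠ ⊤ := by
    rw [lintegral_tsum fun k => (hem k).ennreal_ofReal.aemeasurable]
    refine ne_top_of_le_ne_top hb.tsum_ofReal_ne_top (ENNReal.tsum_le_tsum fun k => ?_)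
    rw [← ofReal_integral_eq_lintegral_ofReal (hei k) (Eventually.of_forall (he0 k))]
    exact ENNReal.ofReal_le_ofReal (h k)
  have hae := ae_lt_top (Measurable.tsum fun k => (hem k).ennreal_ofReal) hfin
  have hconv : ∀ᵐ ω ∂P, ∃ y, Tendsto (fun k => f k ω) atTop (𝓝 y) := by
    filter_upwards [hae] with ω hω
    have hs : Summable fun k => e k ω := by
      have := ENNReal.summable_toReal hω.ne
      simpa only [ENNReal.toReal_ofReal (he0 _ ω)] using this
    have hev : ∀ᶠ k in atTop, e k ω = ‖f (k + 1) ω - f k ω‖ := by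
      filter_upwards [hs.tendsto_atTop_zero.eventually (gt_mem_nhds zero_lt_one)] with k hk
      rcases min_choice 1 ‖f (k + 1) ω - f k ω‖ with h' | h'
      · exact absurd h' hk.ne
      · exact h'
    have hs' : Summable fun k => dist (f k ω) (f (k + 1) ω) := by
      rw [← Nat.cofinite_eq_atTop] at hev
      refine (hs.congr_cofinite ?_)
      filter_upwards [hev] with k hk
      rw [hk, dist_eq_norm, norm_sub_rev]
    exact cauchySeq_tendsto_of_complete (cauchySeq_of_summable_dist hs')
  classical
  refine ⟨fun ω => if hω : ∃ y, Tendsto (fun k => f k ω) atTop (𝓝 y) then hω.choose else 0,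
    tendstoInMeasure_of_tendsto_ae (fun k => (hf k).aestronglyMeasurable) ?_⟩
  filter_upwards [hconv] with ω hω
  rw [dif_pos hω]
  exact hω.choose_spec

lemma exists_common_seq_tendsto_ae {E ι : Type*} [NormedAddCommGroup E] (s : Finset ι)
    {f : ι → ℕ → Ω → E} {g : ι → Ω → E} (h : ∀ i, TendstoInMeasure P (f i) atTop (g i)) :
    ∃ ns : ℕ → ℕ, StrictMono ns ∧
      ∀ i ∈ s, ∀ᵐ ω ∂P, Tendsto (fun k => f i (ns k) ω) atTop (𝓝 (g i ω)) := by
  classical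
  induction s using Finset.induction_on with
  | empty => exact ⟨id, strictMono_id, by simp⟩
  | insert i s _ ih =>
    obtain ⟨ns, hns, hs⟩ := ih
    obtain ⟨ns', hns', hi⟩ := ((h i).comp hns.tendsto_atTop).exists_seq_tendsto_ae
    refine ⟨ns ∘ ns', hns.comp hns', fun j hj => ?_⟩
    rcases Finset.mem_insert.mp hj with rfl | hj
    · exact hi
    · filter_upwards [hs j hj] with ω hω
      exact hω.comp hns'.tendsto_atTop

end Convergence

/-! ### Approximating sequences with a pointwise bound -/

section Approx

variable {n d : ℕ}

/-- The functions that control the `L²` and `L¹` parts are continuous and bounded by `C₁ ‖T‖²` and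
`C₂ ‖T‖` respectively. -/
structure TailControl (τ κ : Matrix (Fin n) (Fin d) ℝ → ℝ) (μ : Euc d) (C₁ C₂ : ℝ) : Prop where
  continuous_τ : Continuous τ
  continuous_κ : Continuous κ
  τ_nonneg : ∀ T, 0 ≤ τ T
  κ_nonneg : ∀ T, 0 ≤ κ T
  τ_le : ∀ T, τ T ≤ C₁ * frob T ^ 2
  κ_le : ∀ T, κ T ≤ C₂ * frob T
  act_le : ∀ T : Matrix (Fin n) (Fin d) ℝ, ‖act T μ‖ ≤ C₂ * frob T
  C₁_nonneg : 0 ≤ C₁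
  C₂_nonneg : 0 ≤ C₂

variable {τ κ : Matrix (Fin n) (Fin d) ℝ → ℝ} {μ : Euc d} {C₁ C₂ : ℝ}

lemma TailControl.τ_zero (h : TailControl τ κ μ C₁ C₂) : τ 0 = 0 :=
  le_antisymm (by simpa using h.τ_le 0) (h.τ_nonneg 0)

lemma TailControl.κ_zero (h : TailControl τ κ μ C₁ C₂) : κ 0 = 0 :=
  le_antisymm (by simpa using h.κ_le 0) (h.κ_nonneg 0)

lemma frob_sub_le_two_mul (A B : Matrix (Fin n) (Fin d) ℝ) :
    frob (A - B) ≤ 2 * (frob A + frob B) := by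
  have hA := frob_nonneg A
  have hB := frob_nonneg B
  refine le_of_sq_le_sq ((frob_sub_le A B).trans ?_) (by positivity)
  nlinarith

variable {Ω : Type*} [MeasurableSpace Ω] {P : Measure Ω} {S : Type*} [MeasurableSpace S] {m : ℕ}
  {π : Measure S} {Λ : Set (S × (Fin m → ℝ)) → Ω → Euc d} {γ : Euc d}
  {Sig : Matrix (Fin d) (Fin d) ℝ} {ν : Measure (Euc d)}

lemma tailBound_le [MetricSpace S] (hc : TailControl τ κ μ C₁ C₂)
    {g : S × (Fin m → ℝ) → Matrix (Fin n) (Fin d) ℝ}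
    (h2 : Integrable (fun p => C₁ * frob (g p) ^ 2) (π.prod volume))
    (h1 : Integrable (fun p => C₂ * frob (g p)) (π.prod volume)) (E : Set (S × (Fin m → ℝ))) :
    tailBound π τ κ μ 1 g E ≤ Real.sqrt (∫ p, C₁ * frob (g p) ^ 2 ∂(π.prod volume)) +
      2 * ∫ p, C₂ * frob (g p) ∂(π.prod volume) := by
  have hC1 := hc.C₁_nonneg
  have hC2 := hc.C₂_nonneg
  have n1 : ∀ p, 0 ≤ C₂ * frob (g p) := fun p => mul_nonneg hC2 (frob_nonneg _)
  have n2 : ∀ p, 0 ≤ C₁ * frob (g p) ^ 2 := fun p => by positivity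
  have hτ : ∫ p in E, τ (g p) ∂(π.prod volume) ≤ ∫ p, C₁ * frob (g p) ^ 2 ∂(π.prod volume) :=
    (integral_mono_of_nonneg (Eventually.of_forall fun p => hc.τ_nonneg _) h2.integrableOn
      (Eventually.of_forall fun p => hc.τ_le _)).trans
      (setIntegral_le_integral h2 (Eventually.of_forall n2))
  have hκ : ∫ p in E, κ (g p) ∂(π.prod volume) ≤ ∫ p, C₂ * frob (g p) ∂(π.prod volume) :=
    (integral_mono_of_nonneg (Eventually.of_forall fun p => hc.κ_nonneg _) h1.integrableOn
      (Eventually.of_forall fun p => hc.κ_le _)).trans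
      (setIntegral_le_integral h1 (Eventually.of_forall n1))
  have hμ : ‖∫ p in E, act (g p) μ ∂(π.prod volume)‖ ≤
      ∫ p, C₂ * frob (g p) ∂(π.prod volume) :=
    (norm_integral_le_of_norm_le h1.integrableOn
      (Eventually.of_forall fun p => hc.act_le _)).trans
      (setIntegral_le_integral h1 (Eventually.of_forall n1))
  have i1 : 0 ≤ ∫ p, C₂ * frob (g p) ∂(π.prod volume) := integral_nonneg n1
  have i2 : 0 ≤ ∫ p, C₁ * frob (g p) ^ 2 ∂(π.prod volume) := integral_nonneg n2
  have hsq : Real.sqrt ((∫ p in E, τ (g p) ∂(π.prod volume)) +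
      ‖∫ p in E, act (g p) μ ∂(π.prod volume)‖ ^ 2) ≤
      Real.sqrt (∫ p, C₁ * frob (g p) ^ 2 ∂(π.prod volume)) +
      ∫ p, C₂ * frob (g p) ∂(π.prod volume) := by
    refine Real.sqrt_le_iff.mpr ⟨by positivity, ?_⟩
    have e1 := Real.sq_sqrt i2
    have e2 : ‖∫ p in E, act (g p) μ ∂(π.prod volume)‖ ^ 2 ≤
        (∫ p, C₂ * frob (g p) ∂(π.prod volume)) ^ 2 := pow_le_pow_left₀ (norm_nonneg _) hμ 2
    have e3 := mul_nonneg (Real.sqrt_nonneg (∫ p, C₁ * frob (g p) ^ 2 ∂(π.prod volume))) i1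
    nlinarith
  unfold tailBound
  linarith

/-- Both functions are small, hence so is the difference: the two integrals are at most `4 q²`, and
`2 q + 2 * 4 q² ≤ 10 q` because `q ≤ 1`. -/
lemma tailBound_sub_le [MetricSpace S] (hc : TailControl τ κ μ C₁ C₂)
    {a b : S × (Fin m → ℝ) → Matrix (Fin n) (Fin d) ℝ}
    (hm : Measurable fun p => frob (a p - b p))
    (ia2 : Integrable (fun p => C₁ * frob (a p) ^ 2) (π.prod volume))
    (ib2 : Integrable (fun p => C₁ * frob (b p) ^ 2) (π.prod volume))
    (ia1 : Integrable (fun p => C₂ * frob (a p)) (π.prod volume))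
    (ib1 : Integrable (fun p => C₂ * frob (b p)) (π.prod volume)) {q : ℝ} (hq0 : 0 ≤ q)
    (hq1 : q ≤ 1) (ha2 : ∫ p, C₁ * frob (a p) ^ 2 ∂(π.prod volume) ≤ q ^ 2)
    (hb2 : ∫ p, C₁ * frob (b p) ^ 2 ∂(π.prod volume) ≤ q ^ 2)
    (ha1 : ∫ p, C₂ * frob (a p) ∂(π.prod volume) ≤ q ^ 2)
    (hb1 : ∫ p, C₂ * frob (b p) ∂(π.prod volume) ≤ q ^ 2) (E : Set (S × (Fin m → ℝ))) :
    tailBound π τ κ μ 1 (fun p => a p - b p) E ≤ 10 * q := by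
  have hC1 := hc.C₁_nonneg
  have hC2 := hc.C₂_nonneg
  have l1 : ∀ p, C₂ * frob (a p - b p) ≤ 2 * (C₂ * frob (a p) + C₂ * frob (b p)) := fun p => by
    have := mul_le_mul_of_nonneg_left (frob_sub_le_two_mul (a p) (b p)) hC2
    linarith
  have l2 : ∀ p, C₁ * frob (a p - b p) ^ 2 ≤
      2 * (C₁ * frob (a p) ^ 2 + C₁ * frob (b p) ^ 2) := fun p => by
    have := mul_le_mul_of_nonneg_left (frob_sub_le (a p) (b p)) hC1
    linarith
  have s1 := (ia1.add ib1).const_mul 2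
  have s2 := (ia2.add ib2).const_mul 2
  have j1 : Integrable (fun p => C₂ * frob (a p - b p)) (π.prod volume) :=
    s1.mono' (hm.const_mul _).aestronglyMeasurable (Eventually.of_forall fun p => by
      rw [Real.norm_of_nonneg (mul_nonneg hC2 (frob_nonneg _))]; exact l1 p)
  have j2 : Integrable (fun p => C₁ * frob (a p - b p) ^ 2) (π.prod volume) :=
    s2.mono' ((hm.pow_const 2).const_mul _).aestronglyMeasurable
      (Eventually.of_forall fun p => by
        rw [Real.norm_of_nonneg (mul_nonneg hC1 (sq_nonneg _))]; exact l2 p)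
  have k1 : ∫ p, C₂ * frob (a p - b p) ∂(π.prod volume) ≤ 4 * q ^ 2 := by
    refine (integral_mono j1 s1 l1).trans ?_
    rw [integral_const_mul]
    have := integral_add ia1 ib1
    simp only [Pi.add_apply] at this ⊢
    linarith
  have k2 : ∫ p, C₁ * frob (a p - b p) ^ 2 ∂(π.prod volume) ≤ 4 * q ^ 2 := by
    refine (integral_mono j2 s2 l2).trans ?_
    rw [integral_const_mul]
    have := integral_add ia2 ib2
    simp only [Pi.add_apply] at this ⊢
    linarith
  have hs : Real.sqrt (∫ p, C₁ * frob (a p - b p) ^ 2 ∂(π.prod volume)) ≤ 2 * q :=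
    Real.sqrt_le_iff.mpr ⟨by linarith, by linarith⟩
  have hq2 : q ^ 2 ≤ q := by nlinarith only [hq0, hq1]
  have := tailBound_le (m := m) hc j2 j1 E
  linarith

lemma measurable_simpleIntegral [MetricSpace S] (hΛ : IsLevyBasis P Λ)
    {φ : SimpleFunc (S × (Fin m → ℝ)) (Matrix (Fin n) (Fin d) ℝ)}
    (hφ : Bornology.IsBounded (Function.support φ)) {E : Set (S × (Fin m → ℝ))}
    (hE : MeasurableSet E) : Measurable (simpleIntegral Λ φ E) := by
  unfold simpleIntegral
  refine Finset.measurable_fun_sum _ fun a _ => ?_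
  by_cases ha : a = 0
  · subst ha
    simp only [zero_act]
    exact measurable_const
  · exact (continuous_act_right a).measurable.comp
      (hΛ.measurable _ (bddBorel_atom (Ψ := φ) hφ hE ha))

lemma measurable_comp_kernel {X Z : Type*} [MeasurableSpace X] [TopologicalSpace Z]
    [MeasurableSpace Z] [BorelSpace Z] {g : X → Matrix (Fin n) (Fin d) ℝ}
    (hg : ∀ i j, Measurable fun p => g p i j) {ψ : Matrix (Fin n) (Fin d) ℝ → Z}
    (hψ : Continuous ψ) : Measurable fun p => ψ (g p) := by
  have h1 : Measurable fun p => (fun i j => g p i j : Fin n → Fin d → ℝ) :=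
    measurable_pi_lambda _ fun i => measurable_pi_lambda _ fun j => hg i j
  have h2 : Continuous fun x : Fin n → Fin d → ℝ => ψ (Matrix.of x) := hψ.comp continuous_id
  exact h2.measurable.comp h1

lemma exists_simple_approx [MetricSpace S] [OpensMeasurableSpace (S × (Fin m → ℝ))] [Nonempty S]
    {g : S × (Fin m → ℝ) → Matrix (Fin n) (Fin d) ℝ}
    (hg : ∀ i j, Measurable fun p => g p i j) :
    ∃ (φ : ℕ → SimpleFunc (S × (Fin m → ℝ)) (Matrix (Fin n) (Fin d) ℝ)) (K : ℝ), 0 ≤ K ∧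
      (∀ k, Bornology.IsBounded (Function.support (φ k))) ∧
      (∀ p, Tendsto (fun k => φ k p) atTop (𝓝 (g p))) ∧ ∀ k p, frob (φ k p) ≤ K * frob (g p) := by
  set g' : S × (Fin m → ℝ) → Fin n → Fin d → ℝ := fun p i j => g p i j with hg'
  have hgm : Measurable g' :=
    measurable_pi_lambda _ fun i => measurable_pi_lambda _ fun j => hg i j
  set ψ : ℕ → SimpleFunc (S × (Fin m → ℝ)) (Fin n → Fin d → ℝ) :=
    SimpleFunc.approxOn g' hgm Set.univ 0 trivial with hψ
  let x0 : S × (Fin m → ℝ) := (Classical.arbitrary S, 0)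
  have hball : ∀ k : ℕ, MeasurableSet (Metric.closedBall x0 k) := fun k =>
    Metric.isClosed_closedBall.measurableSet
  -- Restriction to growing balls gives bounded supports without affecting pointwise limits. The
  -- factor 2 comes from `SimpleFunc.norm_approxOn_zero_le`, the root from passing from entries to
  -- the Frobenius norm.
  refine ⟨fun k => ((ψ k).restrict (Metric.closedBall x0 k)).map Matrix.of,
    Real.sqrt (n * d) * 2, by positivity, fun k => ?_, fun p => ?_, fun k p => ?_⟩
  · refine (Metric.isBounded_closedBall (x := x0) (r := k)).subset fun p hp => ?_
    by_contra hnot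
    refine hp ?_
    simp only [SimpleFunc.map_apply, SimpleFunc.restrict_apply _ (hball k),
      Set.indicator_of_notMem hnot]
    rfl
  · have h := SimpleFunc.tendsto_approxOn hgm (s := Set.univ) (y₀ := 0) trivial (x := p)
      (by simp)
    have h' : Tendsto (fun k => ψ k p) atTop (𝓝 (g' p)) := h
    change Tendsto (fun k => (((ψ k).restrict (Metric.closedBall x0 k)) p)) atTop (𝓝 (g' p))
    refine h'.congr' ?_
    obtain ⟨N, hN⟩ := exists_nat_ge (dist p x0)
    filter_upwards [eventually_ge_atTop N] with k hk
    rw [SimpleFunc.restrict_apply _ (hball k), Set.indicator_of_mem]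
    exact Metric.mem_closedBall.mpr (hN.trans (by exact_mod_cast hk))
  · have hle : ‖ψ k p‖ ≤ 2 * frob (g p) := by
      refine (SimpleFunc.norm_approxOn_zero_le hgm (s := Set.univ) trivial p k).trans ?_
      have : ‖g' p‖ ≤ frob (g p) := by
        refine (pi_norm_le_iff_of_nonneg (frob_nonneg _)).mpr fun i =>
          (pi_norm_le_iff_of_nonneg (frob_nonneg _)).mpr fun j => ?_
        exact abs_apply_le_frob (g p) i j
      linarith
    rw [mul_assoc]
    refine frob_le_of_abs_le _ (by have := frob_nonneg (g p); positivity) fun i j => ?_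
    have h2 : ‖((ψ k).restrict (Metric.closedBall x0 k)) p‖ ≤ ‖ψ k p‖ := by
      rw [SimpleFunc.restrict_apply _ (hball k)]
      exact norm_indicator_le_norm_self _ _
    exact ((norm_le_pi_norm (((ψ k).restrict (Metric.closedBall x0 k)) p i) j).trans
      (norm_le_pi_norm _ i)).trans (h2.trans hle)

variable [MetricSpace S] [BorelSpace S]

/-- Approximation by simple functions, geometrically fast in mean. -/
lemma exists_fast_simple_approx [Nonempty S] (hC1 : 0 ≤ C₁) (hC2 : 0 ≤ C₂)
    {g : S × (Fin m → ℝ) → Matrix (Fin n) (Fin d) ℝ} (hg : ∀ i j, Measurable fun p => g p i j)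
    (h2 : Integrable (fun p => C₁ * frob (g p) ^ 2) (π.prod volume))
    (h1 : Integrable (fun p => C₂ * frob (g p)) (π.prod volume)) :
    ∃ (φ : ℕ → SimpleFunc (S × (Fin m → ℝ)) (Matrix (Fin n) (Fin d) ℝ)) (K : ℝ), 0 ≤ K ∧
      (∀ k, Bornology.IsBounded (Function.support (φ k))) ∧
      (∀ p, Tendsto (fun k => φ k p) atTop (𝓝 (g p))) ∧ (∀ k p, frob (φ k p) ≤ K * frob (g p)) ∧
      (∀ k, Integrable (fun p => C₁ * frob (φ k p - g p) ^ 2) (π.prod volume)) ∧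
      (∀ k, Integrable (fun p => C₂ * frob (φ k p - g p)) (π.prod volume)) ∧
      (∀ k, ∫ p, C₁ * frob (φ k p - g p) ^ 2 ∂(π.prod volume) ≤ (1 / 4) ^ k) ∧
      (∀ k, ∫ p, C₂ * frob (φ k p - g p) ∂(π.prod volume) ≤ (1 / 4) ^ k) := by
  obtain ⟨ψ, K, hK, hψb, hψt, hψK⟩ := exists_simple_approx hg
  have hfm : ∀ k, Measurable fun p => frob (ψ k p - g p) := fun k =>
    measurable_comp_kernel (g := fun p => ψ k p - g p) (fun i j => by
      have : Measurable fun p => ψ k p i j :=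
        ((ψ k).map fun A : Matrix (Fin n) (Fin d) ℝ => A i j).measurable
      exact this.sub (hg i j)) continuous_frob
  have hle1 : ∀ k p, frob (ψ k p - g p) ≤ 2 * (K + 1) * frob (g p) := fun k p => by
    refine (frob_sub_le_two_mul _ _).trans ?_
    have := hψK k p
    linarith
  have hle2 : ∀ k p, frob (ψ k p - g p) ^ 2 ≤ (2 * (K + 1)) ^ 2 * frob (g p) ^ 2 := fun k p => by
    rw [← mul_pow]
    exact pow_le_pow_left₀ (frob_nonneg _) (hle1 k p) 2
  have hlim0 : ∀ p, Tendsto (fun k => frob (ψ k p - g p)) atTop (𝓝 0) := fun p => by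
    have h := (continuous_frob.tendsto _).comp ((hψt p).sub_const (g p))
    simpa [Function.comp_def] using h
  have ib1 : Integrable (fun p => 2 * (K + 1) * (C₂ * frob (g p))) (π.prod volume) :=
    h1.const_mul _
  have ib2 : Integrable (fun p => (2 * (K + 1)) ^ 2 * (C₁ * frob (g p) ^ 2)) (π.prod volume) :=
    h2.const_mul _
  have bd1 : ∀ k p, ‖C₂ * frob (ψ k p - g p)‖ ≤ 2 * (K + 1) * (C₂ * frob (g p)) := fun k p => by
    rw [Real.norm_of_nonneg (mul_nonneg hC2 (frob_nonneg _))]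
    have := mul_le_mul_of_nonneg_left (hle1 k p) hC2
    linarith
  have bd2 : ∀ k p, ‖C₁ * frob (ψ k p - g p) ^ 2‖ ≤
      (2 * (K + 1)) ^ 2 * (C₁ * frob (g p) ^ 2) := fun k p => by
    rw [Real.norm_of_nonneg (by positivity)]
    have := mul_le_mul_of_nonneg_left (hle2 k p) hC1
    linarith
  have m1 : ∀ k, AEStronglyMeasurable (fun p => C₂ * frob (ψ k p - g p)) (π.prod volume) :=
    fun k => ((hfm k).const_mul _).aestronglyMeasurable
  have m2 : ∀ k, AEStronglyMeasurable (fun p => C₁ * frob (ψ k p - g p) ^ 2) (π.prod volume) :=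
    fun k => (((hfm k).pow_const 2).const_mul _).aestronglyMeasurable
  have t1 : Tendsto (fun k => ∫ p, C₂ * frob (ψ k p - g p) ∂(π.prod volume)) atTop (𝓝 0) := by
    have := tendsto_integral_of_dominated_convergence
      (F := fun k p => C₂ * frob (ψ k p - g p)) (f := fun _ => 0) (μ := π.prod volume) _
      m1 ib1 (fun k => Eventually.of_forall (bd1 k))
      (Eventually.of_forall fun p => by simpa using (hlim0 p).const_mul C₂)
    simpa using this
  have t2 : Tendsto (fun k => ∫ p, C₁ * frob (ψ k p - g p) ^ 2 ∂(π.prod volume)) atTop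
      (𝓝 0) := by
    have := tendsto_integral_of_dominated_convergence
      (F := fun k p => C₁ * frob (ψ k p - g p) ^ 2) (f := fun _ => 0) (μ := π.prod volume) _
      m2 ib2 (fun k => Eventually.of_forall (bd2 k))
      (Eventually.of_forall fun p => by simpa using ((hlim0 p).pow 2).const_mul C₁)
    simpa using this
  have hev : ∀ k : ℕ, ∀ᶠ N in atTop,
      ∫ p, C₁ * frob (ψ N p - g p) ^ 2 ∂(π.prod volume) < (1 / 4) ^ k ∧
      ∫ p, C₂ * frob (ψ N p - g p) ∂(π.prod volume) < (1 / 4) ^ k := fun k =>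
    (t2.eventually (gt_mem_nhds (by positivity))).and (t1.eventually (gt_mem_nhds (by positivity)))
  obtain ⟨ns, hns, hans⟩ := extraction_forall_of_eventually hev
  exact ⟨fun k => ψ (ns k), K, hK, fun k => hψb _, fun p => (hψt p).comp hns.tendsto_atTop,
    fun k p => hψK _ p,
    fun k => ib2.mono' (m2 _) (Eventually.of_forall (bd2 _)),
    fun k => ib1.mono' (m1 _) (Eventually.of_forall (bd1 _)),
    fun k => (hans k).1.le, fun k => (hans k).2.le⟩

/-- A kernel with the integrability required by the control functions has an approximating
sequence that is pointwise dominated by the kernel. -/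
lemma exists_isApproxSeq [IsProbabilityMeasure P] (hΛ : IsLevyBasisWith P Λ γ Sig ν π)
    (hΦ : SplitApprox (cumulant γ Sig ν) τ κ μ) (hc : TailControl τ κ μ C₁ C₂)
    {g : S × (Fin m → ℝ) → Matrix (Fin n) (Fin d) ℝ} (hg : ∀ i j, Measurable fun p => g p i j)
    (h2 : Integrable (fun p => C₁ * frob (g p) ^ 2) (π.prod volume))
    (h1 : Integrable (fun p => C₂ * frob (g p)) (π.prod volume)) :
    ∃ (φ : ℕ → SimpleFunc (S × (Fin m → ℝ)) (Matrix (Fin n) (Fin d) ℝ)) (K : ℝ),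
      IsApproxSeq P Λ π g φ ∧ 0 ≤ K ∧ (∀ p, Tendsto (fun k => φ k p) atTop (𝓝 (g p))) ∧
      ∀ k p, frob (φ k p) ≤ K * frob (g p) := by
  have := hΛ.prob
  have : Nonempty S := π.nonempty_of_neZero
  obtain ⟨ψ, K, hK, hψb, hψt, hψK, i2, i1, a2, a1⟩ :=
    exists_fast_simple_approx hc.C₁_nonneg hc.C₂_nonneg hg h2 h1
  refine ⟨ψ, K, ⟨hψb, Eventually.of_forall hψt, fun E hE => ?_⟩, hK, hψt, hψK⟩
  refine exists_tendstoInMeasure_of_summable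
    (fun k => measurable_simpleIntegral hΛ.toIsLevyBasis (hψb _) hE)
    (b := fun k => 10 * (1 / 2 : ℝ) ^ k)
    ((summable_geometric_of_lt_one (by norm_num) (by norm_num)).mul_left _) fun k => ?_
  refine (integral_min_simpleIntegral_sub_le hΛ hΦ hc.τ_zero hc.κ_zero (hψb _) (hψb _) hE).trans ?_
  have hq : (1 / 4 : ℝ) ^ k = ((1 / 2) ^ k) ^ 2 := by rw [← pow_mul, mul_comm, pow_mul]; norm_num
  have hq' : (1 / 4 : ℝ) ^ (k + 1) ≤ ((1 / 2) ^ k) ^ 2 := by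
    rw [← hq]; exact pow_le_pow_of_le_one (by norm_num) (by norm_num) (Nat.le_succ k)
  have hm : ∀ i j, Measurable fun p => (ψ (k + 1) p - ψ k p) i j := fun i j =>
    ((ψ (k + 1)).map fun A : Matrix (Fin n) (Fin d) ℝ => A i j).measurable.sub
      ((ψ k).map fun A : Matrix (Fin n) (Fin d) ℝ => A i j).measurable
  -- Consecutive approximants are compared through `g`. The rate `4⁻ᵏ` was chosen so that its square
  -- root `2⁻ᵏ` is still summable.
  have key := tailBound_sub_le hc (a := fun p => ψ (k + 1) p - g p) (b := fun p => ψ k p - g p)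
    (by simpa only [sub_sub_sub_cancel_right] using measurable_comp_kernel hm continuous_frob)
    (i2 _) (i2 _) (i1 _) (i1 _) (q := (1 / 2) ^ k) (by positivity)
    (pow_le_one₀ (by norm_num) (by norm_num)) ((a2 _).trans hq') ((a2 _).trans hq.le)
    ((a1 _).trans hq') ((a1 _).trans hq.le) E
  simpa only [sub_sub_sub_cancel_right] using key

end Approx

end MMAF

end

/-! ### Tail regions and limits of both sides of the inequality -/

noncomputable section

namespace MMAF

section Limit

variable {S : Type*} {m n d : ℕ}

/-! ### Shifts of the time variable -/

/-- The points at which the kernel of `X_t` sees the tail region. -/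
def tailRegion (S : Type*) {m : ℕ} (h : ℝ) (t : Fin m → ℝ) : Set (S × (Fin m → ℝ)) :=
  {p | p.2 - t ∈ cubeCompl m h}

/-- A point in both open cubes of side `h` would put `s` and `t` at sup distance less than `h`. This
is why the cubes have half-width `h / 2`. -/
lemma mem_tailRegion_or {h : ℝ} (hh : 0 < h) {s t : Fin m → ℝ} (hst : h ≤ dist s t)
    (p : S × (Fin m → ℝ)) : p ∈ tailRegion S h s ∨ p ∈ tailRegion S h t := by
  by_contra hcon
  simp only [tailRegion, cubeCompl, Set.mem_ofPred_eq, Set.mem_compl_iff, not_or, not_not,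
    Pi.sub_apply] at hcon
  refine absurd hst (not_le.mpr ((dist_pi_lt_iff hh).mpr fun i => ?_))
  have h1 := hcon.1 i
  have h2 := hcon.2 i
  rw [Real.dist_eq, abs_lt]
  constructor <;> linarith [h1.1, h1.2, h2.1, h2.2]

variable [MeasurableSpace S] {π : Measure S}

lemma measurePreserving_prod_sub_left [SFinite π] (t : Fin m → ℝ) :
    MeasurePreserving (fun p : S × (Fin m → ℝ) => (p.1, t - p.2)) (π.prod volume)
      (π.prod volume) :=
  (MeasurePreserving.id π).prod (Measure.measurePreserving_sub_left volume t)

lemma measurableSet_cubeCompl (h : ℝ) : MeasurableSet (cubeCompl m h) := by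
  refine MeasurableSet.compl ?_
  rw [show {s : Fin m → ℝ | ∀ i, -(h / 2) < s i ∧ s i < h / 2} =
    ⋂ i, (fun s : Fin m → ℝ => s i) ⁻¹' Set.Ioo (-(h / 2)) (h / 2) by ext; simp]
  exact MeasurableSet.iInter fun i => measurable_pi_apply i measurableSet_Ioo

lemma measurableSet_tailRegion (h : ℝ) (t : Fin m → ℝ) : MeasurableSet (tailRegion S h t) :=
  (measurable_snd.sub_const t) (measurableSet_cubeCompl h)

/-- Translating time by `t` removes the dependence on `t`, so every index point contributes the same
bound. -/
lemma setIntegral_tailRegion [SFinite π] {E : Type*} [NormedAddCommGroup E] [NormedSpace ℝ E]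
    (ψ : S × (Fin m → ℝ) → E) (h : ℝ) (t : Fin m → ℝ) :
    ∫ p in tailRegion S h t, ψ (p.1, t - p.2) ∂(π.prod volume) =
      ∫ p in Set.univ ×ˢ cubeCompl m h, ψ (p.1, -p.2) ∂(π.prod volume) := by
  have hmp : MeasurePreserving (fun p : S × (Fin m → ℝ) => (p.1, p.2 - t)) (π.prod volume)
      (π.prod volume) :=
    (MeasurePreserving.id π).prod (measurePreserving_sub_right volume t)
  have hemb : MeasurableEmbedding (fun p : S × (Fin m → ℝ) => (p.1, p.2 - t)) :=
    (MeasurableEquiv.prodCongr (MeasurableEquiv.refl S)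
      (MeasurableEquiv.subRight t)).measurableEmbedding
  have := hmp.setIntegral_preimage_emb hemb (fun p => ψ (p.1, -p.2)) (Set.univ ×ˢ cubeCompl m h)
  rw [← this]
  simp only [neg_sub]
  congr 2
  ext p
  simp [tailRegion]

lemma continuous_act_left {n d : ℕ} (x : Euc d) :
    Continuous fun T : Matrix (Fin n) (Fin d) ℝ => act T x :=
  continuous_act.comp (continuous_id.prodMk continuous_const)

/-! ### Passage to the limit along approximating sequences -/

variable {τ κ : Matrix (Fin n) (Fin d) ℝ → ℝ} {μ : Euc d} {C₁ C₂ : ℝ}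

lemma tendsto_tailBound (hc : TailControl τ κ μ C₁ C₂)
    {g : S × (Fin m → ℝ) → Matrix (Fin n) (Fin d) ℝ}
    {φ : ℕ → SimpleFunc (S × (Fin m → ℝ)) (Matrix (Fin n) (Fin d) ℝ)} {K : ℝ}
    (hφ : ∀ p, Tendsto (fun k => φ k p) atTop (𝓝 (g p)))
    (hφK : ∀ k p, frob (φ k p) ≤ K * frob (g p))
    (h2 : Integrable (fun p => C₁ * frob (g p) ^ 2) (π.prod volume))
    (h1 : Integrable (fun p => C₂ * frob (g p)) (π.prod volume)) (l : ℝ)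
    (E : Set (S × (Fin m → ℝ))) :
    Tendsto (fun k => tailBound π τ κ μ l (φ k) E) atTop (𝓝 (tailBound π τ κ μ l g E)) := by
  have b1 : ∀ k p, C₂ * frob (φ k p) ≤ K * (C₂ * frob (g p)) := fun k p => by
    have := mul_le_mul_of_nonneg_left (hφK k p) hc.C₂_nonneg
    linarith
  have b2 : ∀ k p, C₁ * frob (φ k p) ^ 2 ≤ K ^ 2 * (C₁ * frob (g p) ^ 2) := fun k p => by
    have := mul_le_mul_of_nonneg_left (pow_le_pow_left₀ (frob_nonneg _) (hφK k p) 2)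
      hc.C₁_nonneg
    linarith
  have i1 := (h1.const_mul K).integrableOn (s := E)
  have i2 := (h2.const_mul (K ^ 2)).integrableOn (s := E)
  have l1 : Tendsto (fun k => ∫ p in E, τ (φ k p) ∂(π.prod volume)) atTop
      (𝓝 (∫ p in E, τ (g p) ∂(π.prod volume))) :=
    tendsto_integral_of_dominated_convergence _
      (fun k => ((φ k).map τ).measurable.aestronglyMeasurable) i2
      (fun k => Eventually.of_forall fun p => by
        rw [Real.norm_of_nonneg (hc.τ_nonneg _)]; exact (hc.τ_le _).trans (b2 k p))
      (Eventually.of_forall fun p => (hc.continuous_τ.tendsto _).comp (hφ p))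
  have l2 : Tendsto (fun k => ∫ p in E, κ (φ k p) ∂(π.prod volume)) atTop
      (𝓝 (∫ p in E, κ (g p) ∂(π.prod volume))) :=
    tendsto_integral_of_dominated_convergence _
      (fun k => ((φ k).map κ).measurable.aestronglyMeasurable) i1
      (fun k => Eventually.of_forall fun p => by
        rw [Real.norm_of_nonneg (hc.κ_nonneg _)]; exact (hc.κ_le _).trans (b1 k p))
      (Eventually.of_forall fun p => (hc.continuous_κ.tendsto _).comp (hφ p))
  have l3 : Tendsto (fun k => ∫ p in E, act (φ k p) μ ∂(π.prod volume)) atTop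
      (𝓝 (∫ p in E, act (g p) μ ∂(π.prod volume))) :=
    tendsto_integral_of_dominated_convergence _
      (fun k => ((φ k).map fun T => act T μ).measurable.aestronglyMeasurable) i1
      (fun k => Eventually.of_forall fun p => (hc.act_le _).trans (b1 k p))
      (Eventually.of_forall fun p => ((continuous_act_left μ).tendsto _).comp (hφ p))
  exact ((l1.add (l3.norm.pow 2)).sqrt).add (l2.const_mul l)

lemma tailBound_restrict (hτ0 : τ 0 = 0) (hκ0 : κ 0 = 0)
    (φ : SimpleFunc (S × (Fin m → ℝ)) (Matrix (Fin n) (Fin d) ℝ)) (l : ℝ)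
    {E : Set (S × (Fin m → ℝ))} (hE : MeasurableSet E) :
    tailBound π τ κ μ l (φ.restrict E) Set.univ = tailBound π τ κ μ l φ E := by
  have key : ∀ {V : Type} [NormedAddCommGroup V] [NormedSpace ℝ V]
      (ψ : Matrix (Fin n) (Fin d) ℝ → V), ψ 0 = 0 →
      ∫ p, ψ (φ.restrict E p) ∂(π.prod volume) = ∫ p in E, ψ (φ p) ∂(π.prod volume) := by
    intro V _ _ ψ hψ
    rw [← integral_indicator hE]
    refine integral_congr_ae (Eventually.of_forall fun p => ?_)
    simp only [SimpleFunc.restrict_apply _ hE]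
    by_cases hp : p ∈ E <;> simp [hp, hψ]
  unfold tailBound
  simp only [Measure.restrict_univ]
  rw [key τ hτ0, key κ hκ0, key (fun T => act T μ) (zero_act μ)]

variable {Ω : Type*} [MeasurableSpace Ω] {P : Measure Ω} [IsProbabilityMeasure P]

lemma tendsto_covariance_comp {u v : ℕ} {F : (Fin u → Euc n) → ℝ} (hF : IsBddLip F)
    {G : (Fin v → Euc n) → ℝ} (hG : IsBddLip G) {Y : ℕ → Fin u → Ω → Euc n}
    {Z : ℕ → Fin v → Ω → Euc n} {Y' : Fin u → Ω → Euc n} {Z' : Fin v → Ω → Euc n}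
    (hY : ∀ k a, Measurable (Y k a)) (hZ : ∀ k b, Measurable (Z k b))
    (hY' : ∀ a, Measurable (Y' a)) (hZ' : ∀ b, Measurable (Z' b))
    (hYt : ∀ a, ∀ᵐ ω ∂P, Tendsto (fun k => Y k a ω) atTop (𝓝 (Y' a ω)))
    (hZt : ∀ b, ∀ᵐ ω ∂P, Tendsto (fun k => Z k b ω) atTop (𝓝 (Z' b ω))) :
    Tendsto (fun k => cov[fun ω => F (fun a => Y k a ω), fun ω => G (fun b => Z k b ω); P]) atTop
      (𝓝 cov[fun ω => F (fun a => Y' a ω), fun ω => G (fun b => Z' b ω); P]) := by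
  obtain ⟨C, hC⟩ := hF.1
  obtain ⟨D, hD⟩ := hG.1
  have hFc := hF.continuous
  have hGc := hG.continuous
  have mF : ∀ {W : Fin u → Ω → Euc n}, (∀ a, Measurable (W a)) →
      Measurable fun ω => F (fun a => W a ω) := fun hW =>
    hFc.measurable.comp (measurable_pi_lambda _ hW)
  have mG : ∀ {W : Fin v → Ω → Euc n}, (∀ b, Measurable (W b)) →
      Measurable fun ω => G (fun b => W b ω) := fun hW =>
    hGc.measurable.comp (measurable_pi_lambda _ hW)
  have tF : ∀ᵐ ω ∂P, Tendsto (fun k => F (fun a => Y k a ω)) atTop (𝓝 (F fun a => Y' a ω)) := by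
    filter_upwards [ae_all_iff.mpr hYt] with ω hω
    exact (hFc.tendsto _).comp (tendsto_pi_nhds.mpr hω)
  have tG : ∀ᵐ ω ∂P, Tendsto (fun k => G (fun b => Z k b ω)) atTop (𝓝 (G fun b => Z' b ω)) := by
    filter_upwards [ae_all_iff.mpr hZt] with ω hω
    exact (hGc.tendsto _).comp (tendsto_pi_nhds.mpr hω)
  have e1 : Tendsto (fun k => ∫ ω, F (fun a => Y k a ω) * G (fun b => Z k b ω) ∂P) atTop
      (𝓝 (∫ ω, F (fun a => Y' a ω) * G (fun b => Z' b ω) ∂P)) :=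
    tendsto_integral_of_dominated_convergence (fun _ => C * D)
      (fun k => ((mF (hY k)).mul (mG (hZ k))).aestronglyMeasurable) (integrable_const _)
      (fun k => Eventually.of_forall fun ω => by
        rw [norm_mul]
        exact mul_le_mul (hC _) (hD _) (norm_nonneg _) ((abs_nonneg _).trans (hC fun _ => 0)))
      (by filter_upwards [tF, tG] with ω h1 h2 using h1.mul h2)
  have e2 : Tendsto (fun k => ∫ ω, F (fun a => Y k a ω) ∂P) atTop
      (𝓝 (∫ ω, F (fun a => Y' a ω) ∂P)) :=
    tendsto_integral_of_dominated_convergence (fun _ => C)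
      (fun k => (mF (hY k)).aestronglyMeasurable) (integrable_const _)
      (fun k => Eventually.of_forall fun ω => hC _) tF
  have e3 : Tendsto (fun k => ∫ ω, G (fun b => Z k b ω) ∂P) atTop
      (𝓝 (∫ ω, G (fun b => Z' b ω) ∂P)) :=
    tendsto_integral_of_dominated_convergence (fun _ => D)
      (fun k => (mG (hZ k)).aestronglyMeasurable) (integrable_const _)
      (fun k => Eventually.of_forall fun ω => hD _) tG
  rw [covariance_eq_sub (memLp_of_abs_le (mF hY') (fun ω => hC _) 2)
    (memLp_of_abs_le (mG hZ') (fun ω => hD _) 2)]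
  refine (e1.sub (e2.mul e3)).congr fun k => ?_
  rw [covariance_eq_sub (memLp_of_abs_le (mF (hY k)) (fun ω => hC _) 2)
    (memLp_of_abs_le (mG (hZ k)) (fun ω => hD _) 2)]
  rfl

end Limit

end MMAF

end

/-! ### The covariance bound for the field and its decay -/

noncomputable section

namespace MMAF

/-! ### The tail region decreases to the empty set -/

lemma cubeCompl_antitone {m : ℕ} {h h' : ℝ} (hh : h ≤ h') : cubeCompl m h' ⊆ cubeCompl m h := by
  refine Set.compl_subset_compl.mpr fun s hs i => ?_
  have := hs i
  constructor <;> linarith [this.1, this.2]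

lemma iInter_cubeCompl {S : Type*} {m : ℕ} :
    ⋂ h : ℝ, (Set.univ ×ˢ cubeCompl m h : Set (S × (Fin m → ℝ))) = ∅ := by
  rw [Set.eq_empty_iff_forall_notMem]
  intro p hp
  refine ((Set.mem_iInter.mp hp (2 * (‖p.2‖ + 1))).2 : p.2 ∈ cubeCompl m _) fun i => ?_
  have := norm_le_pi_norm p.2 i
  rw [Real.norm_eq_abs, abs_le] at this
  constructor <;> linarith [this.1, this.2]

variable {Ω : Type*} [MeasurableSpace Ω] {P : Measure Ω} [IsProbabilityMeasure P]
  {S : Type*} [MeasurableSpace S] {m n d : ℕ}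
  {π : Measure S} {Λ : Set (S × (Fin m → ℝ)) → Ω → Euc d} {γ : Euc d}
  {Sig : Matrix (Fin d) (Fin d) ℝ} {ν : Measure (Euc d)}
  {τ κ : Matrix (Fin n) (Fin d) ℝ → ℝ} {μ : Euc d} {C₁ C₂ : ℝ}
  {f : S × (Fin m → ℝ) → Matrix (Fin n) (Fin d) ℝ} {X : (Fin m → ℝ) → Ω → Euc n}

/-- The bound for the part of the integral that comes from outside the cube of side `h`. -/
def cubeTailBound (π : Measure S) (τ κ : Matrix (Fin n) (Fin d) ℝ → ℝ) (μ : Euc d)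
    (f : S × (Fin m → ℝ) → Matrix (Fin n) (Fin d) ℝ) (h : ℝ) : ℝ :=
  tailBound π τ κ μ 2 (fun p => f (p.1, -p.2)) (Set.univ ×ˢ cubeCompl m h)

lemma tailBound_tailRegion [SFinite π] (h : ℝ) (t : Fin m → ℝ) :
    tailBound π τ κ μ 2 (fun p => f (p.1, t - p.2)) (tailRegion S h t) =
      cubeTailBound π τ κ μ f h := by
  unfold cubeTailBound tailBound
  rw [setIntegral_tailRegion (fun p => τ (f p)), setIntegral_tailRegion (fun p => κ (f p)),
    setIntegral_tailRegion (fun p => act (f p) μ)]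

lemma support_restrict_subset {V : Type*} [Zero V]
    (φ : SimpleFunc (S × (Fin m → ℝ)) V) {E : Set (S × (Fin m → ℝ))} (hE : MeasurableSet E) :
    Function.support (φ.restrict E) ⊆ Function.support φ := by
  intro p hp hφ
  refine hp ?_
  rw [SimpleFunc.restrict_apply _ hE, Set.indicator_apply_eq_zero]
  exact fun _ => hφ

lemma cubeTailBound_nonneg (hc : TailControl τ κ μ C₁ C₂) (h : ℝ) :
    0 ≤ cubeTailBound π τ κ μ f h := by
  unfold cubeTailBound tailBound
  have : 0 ≤ ∫ p in Set.univ ×ˢ cubeCompl m h, κ (f (p.1, -p.2)) ∂(π.prod volume) :=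
    integral_nonneg fun p => hc.κ_nonneg _
  positivity

lemma tendsto_setIntegral_cubeCompl {E : Type*} [NormedAddCommGroup E] [NormedSpace ℝ E]
    {g : S × (Fin m → ℝ) → E} (hg : Integrable g (π.prod volume)) :
    Tendsto (fun h : ℝ => ∫ p in Set.univ ×ˢ cubeCompl m h, g p ∂(π.prod volume)) atTop
      (𝓝 0) := by
  have := tendsto_setIntegral_of_antitone
    (s := fun h : ℝ => (Set.univ ×ˢ cubeCompl m h : Set (S × (Fin m → ℝ)))) (f := g)
    (fun h => MeasurableSet.univ.prod (measurableSet_cubeCompl h))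
    (fun h h' hh => Set.prod_mono le_rfl (cubeCompl_antitone hh)) ⟨0, hg.integrableOn⟩
  simpa [iInter_cubeCompl] using this

lemma TailControl.integrable_comp (hc : TailControl τ κ μ C₁ C₂)
    {g : S × (Fin m → ℝ) → Matrix (Fin n) (Fin d) ℝ} (hg : ∀ i j, Measurable fun p => g p i j)
    (h2 : Integrable (fun p => C₁ * frob (g p) ^ 2) (π.prod volume))
    (h1 : Integrable (fun p => C₂ * frob (g p)) (π.prod volume)) :
    Integrable (fun p => τ (g p)) (π.prod volume) ∧
      Integrable (fun p => κ (g p)) (π.prod volume) ∧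
      Integrable (fun p => act (g p) μ) (π.prod volume) :=
  ⟨h2.mono' (measurable_comp_kernel hg hc.continuous_τ).aestronglyMeasurable
      (Eventually.of_forall fun p => by rw [Real.norm_of_nonneg (hc.τ_nonneg _)]; exact hc.τ_le _),
    h1.mono' (measurable_comp_kernel hg hc.continuous_κ).aestronglyMeasurable
      (Eventually.of_forall fun p => by rw [Real.norm_of_nonneg (hc.κ_nonneg _)]; exact hc.κ_le _),
    h1.mono' (measurable_comp_kernel hg (continuous_act_left μ)).aestronglyMeasurable
      (Eventually.of_forall fun p => hc.act_le _)⟩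

lemma integrable_reflect [SFinite π] {E : Type*} [NormedAddCommGroup E]
    {g : S × (Fin m → ℝ) → E} (hg : Integrable g (π.prod volume)) :
    Integrable (fun p : S × (Fin m → ℝ) => g (p.1, -p.2)) (π.prod volume) := by
  simpa [Function.comp_def] using
    (measurePreserving_prod_sub_left (π := π) (0 : Fin m → ℝ)).integrable_comp_of_integrable hg

lemma tendsto_cubeTailBound [SFinite π] (hf : ∀ i j, Measurable fun p => f p i j)
    (hc : TailControl τ κ μ C₁ C₂)
    (h2 : Integrable (fun p => C₁ * frob (f p) ^ 2) (π.prod volume))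
    (h1 : Integrable (fun p => C₂ * frob (f p)) (π.prod volume)) :
    Tendsto (cubeTailBound π τ κ μ f) atTop (𝓝 0) := by
  obtain ⟨i1, i2, i3⟩ := hc.integrable_comp hf h2 h1
  have := (((tendsto_setIntegral_cubeCompl (integrable_reflect i1)).add
    ((tendsto_setIntegral_cubeCompl (integrable_reflect i3)).norm.pow 2)).sqrt).add
    ((tendsto_setIntegral_cubeCompl (integrable_reflect i2)).const_mul 2)
  simp only [norm_zero, ne_eq, OfNat.ofNat_ne_zero, not_false_eq_true, zero_pow, add_zero,
    Real.sqrt_zero, mul_zero] at this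
  exact this

/-! ### Iterated integrals -/

lemma setIntegral_eq_tailInt [SFinite π] {E : Type*} [NormedAddCommGroup E] [NormedSpace ℝ E]
    {g : S × (Fin m → ℝ) → E} (hg : Integrable g (π.prod volume)) (h : ℝ) :
    ∫ p in Set.univ ×ˢ cubeCompl m h, g (p.1, -p.2) ∂(π.prod volume) =
      tailInt π h fun A s => g (A, -s) := by
  rw [setIntegral_prod _ (integrable_reflect hg).integrableOn, Measure.restrict_univ]
  rfl

lemma cubeTailBound_eq [SFinite π] (hf : ∀ i j, Measurable fun p => f p i j)
    (hc : TailControl τ κ μ C₁ C₂)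
    (h2 : Integrable (fun p => C₁ * frob (f p) ^ 2) (π.prod volume))
    (h1 : Integrable (fun p => C₂ * frob (f p)) (π.prod volume)) (h : ℝ) :
    cubeTailBound π τ κ μ f h =
      Real.sqrt ((tailInt π h fun A (s : Fin m → ℝ) => τ (f (A, -s))) +
        ‖tailInt π h fun A (s : Fin m → ℝ) => act (f (A, -s)) μ‖ ^ 2) +
      2 * tailInt π h fun A (s : Fin m → ℝ) => κ (f (A, -s)) := by
  obtain ⟨i1, i2, i3⟩ := hc.integrable_comp hf h2 h1
  unfold cubeTailBound tailBound
  rw [setIntegral_eq_tailInt i1, setIntegral_eq_tailInt i2, setIntegral_eq_tailInt i3]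

/-! ### The master estimate -/

variable [MetricSpace S] [BorelSpace S]

/-- The covariance inequality for Lipschitz functions of a moving average field. -/
lemma abs_covariance_le (hΛ : IsLevyBasisWith P Λ γ Sig ν π)
    (hf : ∀ i j, Measurable fun p => f p i j) (hX : IsMMAF P Λ π f X)
    (hΦ : SplitApprox (cumulant γ Sig ν) τ κ μ) (hc : TailControl τ κ μ C₁ C₂)
    (h2 : Integrable (fun p => C₁ * frob (f p) ^ 2) (π.prod volume))
    (h1 : Integrable (fun p => C₂ * frob (f p)) (π.prod volume)) {h : ℝ} (hh : 0 < h) {u v : ℕ}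
    {F : (Fin u → Euc n) → ℝ} (hF : IsBddLip F) {G : (Fin v → Euc n) → ℝ} (hG : IsBddLip G)
    {I : Fin u → Fin m → ℝ} {J : Fin v → Fin m → ℝ} (hIJ : ∀ a b, h ≤ dist (I a) (J b)) :
    |cov[fun ω => F (fun a => X (I a) ω), fun ω => G (fun b => X (J b) ω); P]| ≤
      (u * supNorm G * lipConst F + v * supNorm F * lipConst G) *
        cubeTailBound π τ κ μ f h := by
  have := hΛ.prob
  have hg : ∀ (t : Fin m → ℝ) i j, Measurable fun p : S × (Fin m → ℝ) => f (p.1, t - p.2) i j :=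
    fun t i j => (hf i j).comp (measurePreserving_prod_sub_left (π := π) t).measurable
  have g2 : ∀ t : Fin m → ℝ,
      Integrable (fun p => C₁ * frob (f (p.1, t - p.2)) ^ 2) (π.prod volume) := fun t =>
    (measurePreserving_prod_sub_left (π := π) t).integrable_comp_of_integrable h2
  have g1 : ∀ t : Fin m → ℝ,
      Integrable (fun p => C₂ * frob (f (p.1, t - p.2))) (π.prod volume) := fun t =>
    (measurePreserving_prod_sub_left (π := π) t).integrable_comp_of_integrable h1
  choose φ K hφ hK hφt hφK using fun t : Fin m → ℝ =>
    exists_isApproxSeq hΛ hΦ hc (hg t) (g2 t) (g1 t)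
  have hEm : ∀ t : Fin m → ℝ, MeasurableSet (tailRegion S h t) := fun t =>
    measurableSet_tailRegion h t
  -- Only finitely many index points occur, so a single subsequence turns convergence in probability
  -- into almost sure convergence for all of them.
  obtain ⟨ns, hns, hlim⟩ := exists_common_seq_tendsto_ae
    (Finset.univ.image (Sum.elim I J)) fun t => (hX t).tendsto _ (hφ t)
  have hms : ∀ t k, Measurable (simpleIntegral Λ (φ t k) Set.univ) := fun t k =>
    measurable_simpleIntegral hΛ.toIsLevyBasis ((hφ t).bounded k) MeasurableSet.univ
  have hcov := (tendsto_covariance_comp (P := P) hF hG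
    (Y := fun k a => simpleIntegral Λ (φ (I a) (ns k)) Set.univ)
    (Z := fun k b => simpleIntegral Λ (φ (J b) (ns k)) Set.univ)
    (Y' := fun a => X (I a)) (Z' := fun b => X (J b))
    (fun k a => hms _ _) (fun k b => hms _ _) (fun a => (hX _).measurable)
    (fun b => (hX _).measurable)
    (fun a => hlim _ (Finset.mem_image_of_mem (Sum.elim I J) (Finset.mem_univ (Sum.inl a))))
    (fun b => hlim _ (Finset.mem_image_of_mem (Sum.elim I J) (Finset.mem_univ (Sum.inr b))))).abs
  have hbd : ∀ t, Tendsto (fun k => tailBound π τ κ μ 2 (φ t (ns k)) (tailRegion S h t)) atTop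
      (𝓝 (cubeTailBound π τ κ μ f h)) := fun t => by
    rw [← tailBound_tailRegion h t]
    exact (tendsto_tailBound hc (hφt t) (hφK t) (g2 t) (g1 t) 2 _).comp hns.tendsto_atTop
  have hrhs : Tendsto (fun k => supNorm G * lipConst F *
        ∑ a, tailBound π τ κ μ 2 (φ (I a) (ns k)) (tailRegion S h (I a)) +
      supNorm F * lipConst G *
        ∑ b, tailBound π τ κ μ 2 (φ (J b) (ns k)) (tailRegion S h (J b))) atTop
      (𝓝 (supNorm G * lipConst F * ∑ _a : Fin u, cubeTailBound π τ κ μ f h +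
        supNorm F * lipConst G * ∑ _b : Fin v, cubeTailBound π τ κ μ f h)) :=
    ((tendsto_finsetSum _ fun a _ => hbd (I a)).const_mul _).add
      ((tendsto_finsetSum _ fun b _ => hbd (J b)).const_mul _)
  have hle := le_of_tendsto_of_tendsto' hcov hrhs fun k => by
    -- The cut at the cube is made on the simple approximants, where the parts are again simple.
    have hsplit : ∀ t p, φ t (ns k) p = (φ t (ns k)).restrict (tailRegion S h t)ᶜ p +
        (φ t (ns k)).restrict (tailRegion S h t) p := fun t p => by
      rw [SimpleFunc.restrict_apply _ (hEm t).compl, SimpleFunc.restrict_apply _ (hEm t)]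
      by_cases hp : p ∈ tailRegion S h t <;> simp [hp]
    have hb1 : ∀ t, Bornology.IsBounded
        (Function.support ((φ t (ns k)).restrict (tailRegion S h t)ᶜ)) := fun t =>
      ((hφ t).bounded _).subset (support_restrict_subset _ (hEm t).compl)
    have hb2 : ∀ t, Bornology.IsBounded
        (Function.support ((φ t (ns k)).restrict (tailRegion S h t))) := fun t =>
      ((hφ t).bounded _).subset (support_restrict_subset _ (hEm t))
    have key := abs_covariance_simpleIntegral_le hΛ hΦ hc.τ_zero hc.κ_zero hF hG
      (fun a => hsplit (I a)) (fun b => hsplit (J b)) (fun a => hb1 _) (fun a => hb2 _)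
      (fun b => hb1 _) (fun b => hb2 _) (fun a b p => by
        rw [SimpleFunc.restrict_apply _ (hEm _).compl, SimpleFunc.restrict_apply _ (hEm _).compl]
        rcases mem_tailRegion_or hh (hIJ a b) p with hp | hp
        · left; simp [hp]
        · right; simp [hp])
    simp only [tailBound_restrict hc.τ_zero hc.κ_zero _ _ (hEm _)] at key
    exact key
  simp only [Finset.sum_const, Finset.card_univ, Fintype.card_fin, nsmul_eq_mul] at hle
  refine hle.trans_eq ?_
  ring

lemma eta_le_cubeTailBound (hΛ : IsLevyBasisWith P Λ γ Sig ν π)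
    (hf : ∀ i j, Measurable fun p => f p i j) (hX : IsMMAF P Λ π f X)
    (hΦ : SplitApprox (cumulant γ Sig ν) τ κ μ) (hc : TailControl τ κ μ C₁ C₂)
    (h2 : Integrable (fun p => C₁ * frob (f p) ^ 2) (π.prod volume))
    (h1 : Integrable (fun p => C₂ * frob (f p)) (π.prod volume)) {h : ℝ} (hh : 0 < h) :
    eta P X h ≤ ENNReal.ofReal (cubeTailBound π τ κ μ f h) := by
  refine iSup₂_le fun u _ => iSup₂_le fun v _ => sSup_le ?_
  rintro r ⟨F, G, I, J, hF, hG, _, _, hIJ, rfl⟩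
  -- This covers a vanishing denominator too: the covariance inequality then forces the numerator to
  -- be 0.
  refine ENNReal.div_le_of_le_mul ?_
  rw [← ENNReal.ofReal_mul (cubeTailBound_nonneg hc h), mul_comm]
  exact ENNReal.ofReal_le_ofReal (abs_covariance_le hΛ hf hX hΦ hc h2 h1 hh hF hG hIJ)

lemma isEtaWeaklyDependent_of_tailControl (hΛ : IsLevyBasisWith P Λ γ Sig ν π)
    (hf : ∀ i j, Measurable fun p => f p i j) (hX : IsMMAF P Λ π f X)
    (hΦ : SplitApprox (cumulant γ Sig ν) τ κ μ) (hc : TailControl τ κ μ C₁ C₂)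
    (h2 : Integrable (fun p => C₁ * frob (f p) ^ 2) (π.prod volume))
    (h1 : Integrable (fun p => C₂ * frob (f p)) (π.prod volume)) :
    IsEtaWeaklyDependent P X := by
  have := hΛ.prob
  have hlim := ENNReal.tendsto_ofReal (tendsto_cubeTailBound hf hc h2 h1)
  rw [ENNReal.ofReal_zero] at hlim
  refine tendsto_of_tendsto_of_tendsto_of_le_of_le' tendsto_const_nhds hlim
    (Eventually.of_forall fun _ => zero_le) ?_
  filter_upwards [eventually_gt_atTop 0] with h hh
  exact eta_le_cubeTailBound hΛ hf hX hΦ hc h2 h1 hh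

/-- Weak dependence with the bound of a tail control. -/
lemma isEtaWeaklyDependent_and_eta_le (hΛ : IsLevyBasisWith P Λ γ Sig ν π)
    (hf : ∀ i j, Measurable fun p => f p i j) (hX : IsMMAF P Λ π f X)
    (hΦ : SplitApprox (cumulant γ Sig ν) τ κ μ) (hc : TailControl τ κ μ C₁ C₂)
    (h2 : Integrable (fun p => C₁ * frob (f p) ^ 2) (π.prod volume))
    (h1 : Integrable (fun p => C₂ * frob (f p)) (π.prod volume)) :
    IsEtaWeaklyDependent P X ∧ ∀ h : ℝ, 0 < h → eta P X h ≤ ENNReal.ofReal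
      (Real.sqrt ((tailInt π h fun A (s : Fin m → ℝ) => τ (f (A, -s))) +
        ‖tailInt π h fun A (s : Fin m → ℝ) => act (f (A, -s)) μ‖ ^ 2) +
      2 * tailInt π h fun A (s : Fin m → ℝ) => κ (f (A, -s))) := by
  have := hΛ.prob
  refine ⟨isEtaWeaklyDependent_of_tailControl hΛ hf hX hΦ hc h2 h1, fun h hh => ?_⟩
  rw [← cubeTailBound_eq hf hc h2 h1]
  exact eta_le_cubeTailBound hΛ hf hX hΦ hc h2 h1 hh

end MMAF

end

noncomputable section

namespace MMAF

section Controls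

variable {n d : ℕ} {ν : Measure (Euc d)} {Sig : Matrix (Fin d) (Fin d) ℝ}

/-! ### Tail controls for the three decompositions of the jumps -/

lemma exists_trace_le (hSig : Sig.PosSemidef) {D : Set (Euc d)}
    (h2 : IntegrableOn (fun x => ‖x‖ ^ 2) D ν) :
    ∃ C : ℝ, 0 ≤ C ∧ ∀ T : Matrix (Fin n) (Fin d) ℝ,
      0 ≤ (T * (Sig + secondMoment ν D) * T.transpose).trace ∧
      (T * (Sig + secondMoment ν D) * T.transpose).trace ≤ C * frob T ^ 2 := by
  obtain ⟨v, hv⟩ := exists_rank_one_decomposition hSig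
  have hI : 0 ≤ ∫ x in D, ‖x‖ ^ 2 ∂ν := integral_nonneg fun x => by positivity
  refine ⟨∑ l, ‖v l‖ ^ 2 + ∫ x in D, ‖x‖ ^ 2 ∂ν, by positivity, fun T => ?_⟩
  rw [Matrix.mul_add, Matrix.add_mul, Matrix.trace_add, trace_secondMoment h2,
    trace_eq_sum_norm_sq hv]
  have h3 : ∫ x in D, ‖act T x‖ ^ 2 ∂ν ≤ ∫ x in D, frob T ^ 2 * ‖x‖ ^ 2 ∂ν :=
    integral_mono (integrable_norm_act_sq h2 T) (h2.const_mul _) fun x => norm_act_sq_le T x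
  have h4 : ∑ l, ‖act T (v l)‖ ^ 2 ≤ ∑ l, frob T ^ 2 * ‖v l‖ ^ 2 :=
    Finset.sum_le_sum fun l _ => norm_act_sq_le T (v l)
  rw [integral_const_mul] at h3
  rw [← Finset.mul_sum] at h4
  have h5 : 0 ≤ ∫ x in D, ‖act T x‖ ^ 2 ∂ν := integral_nonneg fun x => by positivity
  exact ⟨by positivity, by linarith⟩

lemma continuous_trace_mul_mul_transpose (M : Matrix (Fin d) (Fin d) ℝ) :
    Continuous fun T : Matrix (Fin n) (Fin d) ℝ => (T * M * T.transpose).trace := by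
  fun_prop

lemma integrable_norm_act {D : Set (Euc d)} (h1 : IntegrableOn (fun x => ‖x‖) D ν)
    (T : Matrix (Fin n) (Fin d) ℝ) : IntegrableOn (fun x => ‖act T x‖) D ν :=
  Integrable.mono' (h1.const_mul (frob T))
    (continuous_act_right T).norm.aestronglyMeasurable (Eventually.of_forall fun x => by
      rw [norm_norm]; exact norm_act_le T x)

lemma integral_norm_act_le {D : Set (Euc d)} (h1 : IntegrableOn (fun x => ‖x‖) D ν)
    (T : Matrix (Fin n) (Fin d) ℝ) :
    ∫ x in D, ‖act T x‖ ∂ν ≤ (∫ x in D, ‖x‖ ∂ν) * frob T := by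
  have := integral_mono (integrable_norm_act h1 T) (h1.const_mul (frob T)) fun x => norm_act_le T x
  rwa [integral_const_mul, mul_comm] at this

/-- Near `T₀` the Frobenius norm stays below `frob T₀ + 1`, which supplies an integrable majorant.
-/
lemma continuous_integral_norm_act {D : Set (Euc d)} (h1 : IntegrableOn (fun x => ‖x‖) D ν) :
    Continuous fun T : Matrix (Fin n) (Fin d) ℝ => ∫ x in D, ‖act T x‖ ∂ν := by
  have : FirstCountableTopology (Matrix (Fin n) (Fin d) ℝ) :=
    inferInstanceAs (FirstCountableTopology (Fin n → Fin d → ℝ))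
  refine continuous_iff_continuousAt.mpr fun T₀ => ?_
  refine continuousAt_of_dominated (bound := fun x => (frob T₀ + 1) * ‖x‖)
    (Eventually.of_forall fun T => (continuous_act_right T).norm.aestronglyMeasurable) ?_
    (h1.const_mul _) (Eventually.of_forall fun x => (continuous_act_left x).norm.continuousAt)
  filter_upwards [(continuous_frob.tendsto T₀).eventually (gt_mem_nhds (lt_add_one _))] with T hT
  refine Eventually.of_forall fun x => ?_
  rw [norm_norm]
  exact (norm_act_le T x).trans (mul_le_mul_of_nonneg_right hT.le (norm_nonneg x))

lemma exists_tailControl_sq (hSig : Sig.PosSemidef) {D : Set (Euc d)}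
    (h2 : IntegrableOn (fun x => ‖x‖ ^ 2) D ν) (μ : Euc d) :
    ∃ C₁, TailControl (n := n) (fun T => (T * (Sig + secondMoment ν D) * T.transpose).trace)
      (fun _ => 0) μ C₁ ‖μ‖ := by
  obtain ⟨C, hC, hT⟩ := exists_trace_le (n := n) hSig h2
  exact ⟨C, continuous_trace_mul_mul_transpose _, continuous_const, fun T => (hT T).1,
    fun _ => le_rfl, fun T => (hT T).2, fun T => mul_nonneg (norm_nonneg _) (frob_nonneg _),
    fun T => by rw [mul_comm]; exact norm_act_le T μ, hC, norm_nonneg _⟩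

lemma exists_tailControl_large (hSig : Sig.PosSemidef) {D E : Set (Euc d)}
    (h2 : IntegrableOn (fun x => ‖x‖ ^ 2) D ν) (h1 : IntegrableOn (fun x => ‖x‖) E ν)
    (μ : Euc d) :
    ∃ C₁ C₂, TailControl (n := n)
      (fun T => (T * (Sig + secondMoment ν D) * T.transpose).trace)
      (fun T => ∫ x in E, ‖act T x‖ ∂ν) μ C₁ C₂ := by
  obtain ⟨C, hC, hT⟩ := exists_trace_le (n := n) hSig h2
  have hI : 0 ≤ ∫ x in E, ‖x‖ ∂ν := integral_nonneg fun x => norm_nonneg _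
  refine ⟨C, ‖μ‖ + ∫ x in E, ‖x‖ ∂ν, continuous_trace_mul_mul_transpose _,
    continuous_integral_norm_act h1, fun T => (hT T).1,
    fun T => integral_nonneg fun x => norm_nonneg _, fun T => (hT T).2, fun T => ?_, fun T => ?_,
    hC, by positivity⟩
  · have := integral_norm_act_le h1 T
    have := mul_nonneg (norm_nonneg μ) (frob_nonneg T)
    linarith
  · have := norm_act_le T μ
    have := mul_nonneg hI (frob_nonneg T)
    linarith

lemma tailControl_integrable (h1 : Integrable (fun x => ‖x‖) ν) (γ : Euc d) :
    TailControl (n := n) (fun _ => 0) (fun T => ‖act T γ‖ + ∫ x, ‖act T x‖ ∂ν) (0 : Euc d) 0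
      (‖γ‖ + ∫ x, ‖x‖ ∂ν) := by
  rw [← integrableOn_univ] at h1
  have hle := fun T => integral_norm_act_le (n := n) h1 T
  have hcont := continuous_integral_norm_act (n := n) h1
  simp only [Measure.restrict_univ] at hle hcont
  have hI : 0 ≤ ∫ x, ‖x‖ ∂ν := integral_nonneg fun x => norm_nonneg _
  refine ⟨continuous_const, (continuous_act_left γ).norm.add hcont, fun _ => le_rfl,
    fun T => add_nonneg (norm_nonneg _) (integral_nonneg fun x => norm_nonneg _), fun T => by simp,
    fun T => ?_, fun T => ?_, le_rfl, by positivity⟩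
  · have := norm_act_le T γ
    have := hle T
    linarith
  · have := frob_nonneg T
    rw [act_zero, norm_zero]
    positivity

end Controls

lemma tailInt_add {S : Type*} [MeasurableSpace S] {m : ℕ} {π : Measure S} [SFinite π] {E : Type*}
    [NormedAddCommGroup E] [NormedSpace ℝ E] {g g' : S × (Fin m → ℝ) → E}
    (hg : Integrable g (π.prod volume)) (hg' : Integrable g' (π.prod volume)) (h : ℝ) :
    (tailInt π h fun A (s : Fin m → ℝ) => g (A, -s) + g' (A, -s)) =
      (tailInt π h fun A s => g (A, -s)) + tailInt π h fun A s => g' (A, -s) := by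
  rw [← setIntegral_eq_tailInt hg, ← setIntegral_eq_tailInt hg',
    ← setIntegral_eq_tailInt (g := fun p => g p + g' p) (hg.add hg'),
    integral_add (integrable_reflect hg).integrableOn (integrable_reflect hg').integrableOn]

lemma tailInt_zero {S : Type*} [MeasurableSpace S] {m : ℕ} {π : Measure S} {E : Type*}
    [NormedAddCommGroup E] [NormedSpace ℝ E] (h : ℝ) :
    (tailInt π h fun _ (_ : Fin m → ℝ) => (0 : E)) = 0 := by
  simp [tailInt]

end MMAF

end

/-! ### The four regimes -/

theorem proposition3p14 {Ω : Type*} [MeasurableSpace Ω] (P : Measure Ω) [IsProbabilityMeasure P]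
    {S : Type*} [MetricSpace S] [CompleteSpace S] [SecondCountableTopology S]
    [MeasurableSpace S] [BorelSpace S] {m n d : ℕ}
    (γ : MMAF.Euc d) (Sig : Matrix (Fin d) (Fin d) ℝ) (ν : Measure (MMAF.Euc d)) (π : Measure S)
    (Λ : Set (S × (Fin m → ℝ)) → Ω → MMAF.Euc d) (hΛ : MMAF.IsLevyBasisWith P Λ γ Sig ν π)
    (f : S × (Fin m → ℝ) → Matrix (Fin n) (Fin d) ℝ) (hf : ∀ i j, Measurable fun p => f p i j)
    (X : (Fin m → ℝ) → Ω → MMAF.Euc n) (hX : MMAF.IsMMAF P Λ π f X) :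
    -- regime (i)
    (IntegrableOn (fun x => ‖x‖ ^ 2) {x | 1 < ‖x‖} ν →
      γ + ∫ x in {x | 1 < ‖x‖}, x ∂ν = 0 →
      MemLp (fun p => MMAF.frob (f p)) 2 (π.prod volume) →
      MMAF.IsEtaWeaklyDependent P X ∧
      ∀ h : ℝ, 0 < h → MMAF.eta P X h ≤ ENNReal.ofReal
        (Real.sqrt (MMAF.tailInt π h fun A (s : Fin m → ℝ) =>
          (f (A, -s) * (Sig + MMAF.secondMoment ν Set.univ) * (f (A, -s)).transpose).trace)))
    ∧
    -- regime (ii)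
    (IntegrableOn (fun x => ‖x‖ ^ 2) {x | 1 < ‖x‖} ν →
      MemLp (fun p => MMAF.frob (f p)) 2 (π.prod volume) →
      MemLp (fun p => MMAF.frob (f p)) 1 (π.prod volume) →
      MMAF.IsEtaWeaklyDependent P X ∧
      ∀ h : ℝ, 0 < h → MMAF.eta P X h ≤ ENNReal.ofReal
        (Real.sqrt
          ((MMAF.tailInt π h fun A (s : Fin m → ℝ) =>
            (f (A, -s) * (Sig + MMAF.secondMoment ν Set.univ) * (f (A, -s)).transpose).trace)
          + ‖MMAF.tailInt π h fun A (s : Fin m → ℝ) =>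
              MMAF.act (f (A, -s)) (γ + ∫ x in {x | 1 < ‖x‖}, x ∂ν)‖ ^ 2)))
    ∧
    -- regime (iii)
    (Integrable (fun x => ‖x‖) ν →
      Sig = 0 →
      MemLp (fun p => MMAF.frob (f p)) 1 (π.prod volume) →
      MMAF.IsEtaWeaklyDependent P X ∧
      ∀ h : ℝ, 0 < h → MMAF.eta P X h ≤ ENNReal.ofReal
        (2 * ((MMAF.tailInt π h fun A (s : Fin m → ℝ) =>
            ‖MMAF.act (f (A, -s)) (γ - ∫ x in {x | ‖x‖ ≤ 1}, x ∂ν)‖)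
          + MMAF.tailInt π h fun A (s : Fin m → ℝ) =>
              ∫ x, ‖MMAF.act (f (A, -s)) x‖ ∂ν)))
    ∧
    -- regime (iv)
    (IntegrableOn (fun x => ‖x‖) {x | 1 < ‖x‖} ν →
      MemLp (fun p => MMAF.frob (f p)) 1 (π.prod volume) →
      MemLp (fun p => MMAF.frob (f p)) 2 (π.prod volume) →
      MMAF.IsEtaWeaklyDependent P X ∧
      ∀ h : ℝ, 0 < h → MMAF.eta P X h ≤ ENNReal.ofReal
        (Real.sqrt
          ((MMAF.tailInt π h fun A (s : Fin m → ℝ) =>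
            (f (A, -s) * (Sig + MMAF.secondMoment ν {x | ‖x‖ ≤ 1}) *
              (f (A, -s)).transpose).trace)
          + ‖MMAF.tailInt π h fun A (s : Fin m → ℝ) => MMAF.act (f (A, -s)) γ‖ ^ 2)
        + 2 * MMAF.tailInt π h fun A (s : Fin m → ℝ) =>
            ∫ x in {x | 1 < ‖x‖}, ‖MMAF.act (f (A, -s)) x‖ ∂ν)) := by
  have hν := hΛ.levyMeasure
  have hSig := hΛ.posSemidef
  have hπ := hΛ.prob
  have int1 : ∀ (C : ℝ), MemLp (fun p => MMAF.frob (f p)) 1 (π.prod volume) →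
      Integrable (fun p => C * MMAF.frob (f p)) (π.prod volume) := fun C h =>
    (memLp_one_iff_integrable.mp h).const_mul C
  have int2 : ∀ (C : ℝ), MemLp (fun p => MMAF.frob (f p)) 2 (π.prod volume) →
      Integrable (fun p => C * MMAF.frob (f p) ^ 2) (π.prod volume) := fun C h =>
    h.integrable_sq.const_mul C
  refine ⟨fun h2 h0 hL2 => ?_, fun h2 hL2 hL1 => ?_, fun h1 hSig0 hL1 => ?_, fun h1 hL1 hL2 => ?_⟩
  -- With mean zero the control holds with `C₂ = ‖0‖ = 0`, so the `L¹` requirement on the kernel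
  -- becomes trivial and `L²` alone suffices.
  · obtain ⟨C, hc⟩ := MMAF.exists_tailControl_sq (n := n) hSig
      (hν.integrableOn_sq_gt h2).integrableOn 0
    have hΦ := MMAF.splitApprox_of_sq_integrable (n := n) (γ := γ) hν hSig h2
    rw [h0] at hΦ
    have := MMAF.isEtaWeaklyDependent_and_eta_le hΛ hf hX hΦ hc (int2 _ hL2) (by simp)
    simpa only [MMAF.act_zero, MMAF.tailInt_zero, norm_zero, ne_eq, OfNat.ofNat_ne_zero,
      not_false_eq_true, zero_pow, add_zero, mul_zero] using this
  · obtain ⟨C, hc⟩ := MMAF.exists_tailControl_sq (n := n) hSig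
      (hν.integrableOn_sq_gt h2).integrableOn (γ + ∫ x in {x | 1 < ‖x‖}, x ∂ν)
    have := MMAF.isEtaWeaklyDependent_and_eta_le hΛ hf hX
      (MMAF.splitApprox_of_sq_integrable hν hSig h2) hc (int2 _ hL2) (int1 _ hL1)
    simpa only [MMAF.tailInt_zero, add_zero, mul_zero] using this
  -- Here `τ`, `μ` and `C₁` vanish, so the square root disappears and no `L²` condition is left.
  · subst hSig0
    have hc := MMAF.tailControl_integrable (n := n) h1 (γ - ∫ x in {x | ‖x‖ ≤ 1}, x ∂ν)
    -- The control with zero drift isolates the integrability of the jump term, needed to separate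
    -- the two tail integrals.
    have hc0 := MMAF.tailControl_integrable (n := n) h1 0
    have i1 : Integrable (fun p => ‖MMAF.act (f p) (γ - ∫ x in {x | ‖x‖ ≤ 1}, x ∂ν)‖)
        (π.prod volume) :=
      (int1 ‖γ - ∫ x in {x | ‖x‖ ≤ 1}, x ∂ν‖ hL1).mono'
        (MMAF.measurable_comp_kernel hf (MMAF.continuous_act_left _)).norm.aestronglyMeasurable
        (Eventually.of_forall fun p => by
          rw [norm_norm, mul_comm]; exact MMAF.norm_act_le _ _)
    have i2 : Integrable (fun p => ∫ x, ‖MMAF.act (f p) x‖ ∂ν) (π.prod volume) := by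
      have := (hc0.integrable_comp hf (by simp) (int1 _ hL1)).2.1
      simpa only [MMAF.act_zero, norm_zero, zero_add] using this
    have := MMAF.isEtaWeaklyDependent_and_eta_le hΛ hf hX
      (MMAF.splitApprox_of_integrable hν h1) hc (by simp) (int1 _ hL1)
    simpa only [MMAF.act_zero, MMAF.tailInt_zero, MMAF.tailInt_add i1 i2, norm_zero, ne_eq,
      OfNat.ofNat_ne_zero, not_false_eq_true, zero_pow, add_zero, zero_add,
      Real.sqrt_zero] using this
  · obtain ⟨C₁, C₂, hc⟩ := MMAF.exists_tailControl_large (n := n) hSig hν.integrableOn_sq h1 γ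
    exact MMAF.isEtaWeaklyDependent_and_eta_le hΛ hf hX
      (MMAF.splitApprox_of_integrable_large hν hSig h1) hc (int2 _ hL2) (int1 _ hL1)
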